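/- Let $T,C$ be real constants with $C+2T^2\neq 0$. A \emph{solution} (on a 3-manifold) consists of a smooth coframe $\omega^0,\omega^1,\omega^2$ and a smooth function $\epsilon>0$ such that $$d\omega^0=-T\,\omega^0\wedge\omega^1,\qquad d\omega^1=-4T\,\omega^0\wedge\omega^2,\qquad d\omega^2=\omega^0\wedge\omega^1+2\epsilon\,\omega^0\wedge\omega^2-T\,\omega^1\wedge\omega^2,$$ $$d\epsilon=P\,\omega^0-T\epsilon\,\omega^1+C\,\omega^2,\qquad P=D\epsilon,$$ where $D=e_0$ is the first vector field of the dual frame $(e_0,e_1,e_2)$. These are the structure equations of the type D, properly $CH_1$ Lorentzian metrics $g=\tfrac12(\omega^1)^2-2\omega^0\omega^2$. In the frame, $\eta_{02}=\eta_{20}=-1$, $\eta_{11}=\tfrac12$, the other $\eta_{ab}$ being $0$. \textbf{Proposition.} Generically, these metrics are classified by 5th-order invariants. Precisely: (1) Solutions exist on every open set $U\subseteq\mathbb R^3$. Let $U$ be open and convex, and give the space of solutions on $U$ the $C^\infty$ topology (uniform convergence of all derivatives on compact subsets). For each $y\in U$, the solutions with $d\epsilon\wedge d(D\epsilon)\wedge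 d(D^2\epsilon)\neq0$ at $y$ form an open dense set; the solutions for which $\epsilon,D\epsilon,D^2\epsilon$ are functionally independent on a dense subset of $U$ form a set that is both residual and dense. (2) Let a solution on a smooth 3-manifold $M$ be such that $\epsilon,D\epsilon,D^2\epsilon$ are functionally independent at every point, i.e. $d\epsilon\wedge d(D\epsilon)\wedge d(D^2\epsilon)\neq0$ on $M$. Then $(M,g)$ has curvature of Petrov type D, is fully regular and curvature regular, and $$(t_p)=(0,0,1,2,3,3,3,\dots),\qquad (s_p)=(1,0,0,\dots),\qquad (r_p)=(2,3,4,5,6,6,6,\dots).$$ In particular $q=5$ is the smallest integer with $r_{q-1}=r_q$ (with $r_{-1}=0$), that is, $g$ has order $q-1=4$ and is classified by its 5th-order differential invariants. Here $r_p$ is the (constant) rank of the lift of $R^{(p)}=(R_{abcd},\dots,R_{abcd;e_1\dots e_p})$ to the bundle of $\eta$-orthogonal frames. Full regularity means that every $r_p$ is constant. A $p$th order normalizing cross-section is a submanifold $S$ of the space $\bigoplus_{k=0}^{p}\otimes^{4+k}(\mathbb R^3)^*$ of values of $R^{(p)}$, together with a subgroup $G_p\subset O(\eta)$ fixing $S$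 pointwise, such that $X\in O(\eta)$ and $X(S)\cap S\neq\emptyset$ imply $X\in G_p$, and such that $M$ is covered by $\eta$-orthogonal moving coframes relative to which $R^{(p)}$ takes values in $S$. Curvature regularity means that one exists for every $p$; then $s_p=\dim G_p$, and $t_p$ is the rank of the normalized components $R^{(p)}$ as functions on $M$. -/

import Mathlib

open scoped Manifold ContDiff Topology

noncomputable section

namespace Lorentz3

/-! ### Local coordinates -/

/-- The coordinate space of three-dimensional manifolds. -/
abbrev E3 : Type := EuclideanSpace ℝ (Fin 3)

/-- The `i`-th coordinate vector. -/
def coordVec (i : Fin 3) : E3 := EuclideanSpace.single i (1 : ℝ)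

/-- The partial derivative `∂f/∂yⁱ`. -/
def pderiv (i : Fin 3) (f : E3 → ℝ) (y : E3) : ℝ := fderiv ℝ f y (coordVec i)

/-- A metric in coordinates, `y ↦ (g_{ij}(y))`. -/
abbrev CoordMetric : Type := E3 → Matrix (Fin 3) (Fin 3) ℝ

/-- Christoffel symbols `Γᵏ_{ij}` of the Levi-Civita connection of `g`. -/
def christoffel (g : CoordMetric) (k i j : Fin 3) (y : E3) : ℝ :=
  (1 / 2 : ℝ) * ∑ l, (g y)⁻¹ k l *
    (pderiv i (fun z => g z j l) y + pderiv j (fun z => g z i l) y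
      - pderiv l (fun z => g z i j) y)

/-- The curvature `Rᵏ_{lij}`, where `R(∂_i, ∂_j) ∂_l = Rᵏ_{lij} ∂_k`. -/
def riemannUp (g : CoordMetric) (k l i j : Fin 3) (y : E3) : ℝ :=
  pderiv i (christoffel g k j l) y - pderiv j (christoffel g k i l) y
    + ∑ m, (christoffel g k i m y * christoffel g m j l y
      - christoffel g k j m y * christoffel g m i l y)

/-- The components of a covariant tensor of rank `m`. -/
abbrev Tensor (m : ℕ) : Type := (Fin m → Fin 3) → ℝ

/-- The Riemann tensor `R_{abcd} = g_{ak} Rᵏ_{bcd}`. -/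
def riemann (g : CoordMetric) (y : E3) : Tensor 4 := fun a =>
  ∑ k, g y (a 0) k * riemannUp g k (a 1) (a 2) (a 3) y

/-- The covariant derivative `S_{a₁…a_m;c}` of a covariant tensor field; the index `c` of
differentiation is put last. -/
def covDeriv (g : CoordMetric) {m : ℕ} (S : E3 → Tensor m) (y : E3) : Tensor (m + 1) := fun a =>
  pderiv (a (Fin.last m)) (fun z => S z (Fin.init a)) y
    - ∑ s : Fin m, ∑ k : Fin 3, christoffel g k (a (Fin.last m)) (a s.castSucc) y
        * S y (Function.update (Fin.init a) s k)

/-- The `p`-th covariant derivative of the Riemann tensor, `R_{abcd;e₁…e_p}`. -/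
def curv (g : CoordMetric) : (p : ℕ) → E3 → Tensor (4 + p)
  | 0 => riemann g
  | p + 1 => covDeriv g (curv g p)

/-- The components of the tensor `S` (given by its coordinate components) with respect to the
vectors `e 0, e 1, e 2`. -/
def frameComp {m : ℕ} (S : Tensor m) (e : Fin 3 → E3) : Tensor m := fun a =>
  ∑ i : Fin m → Fin 3, S i * ∏ s, e (a s) (i s)

/-- `𝓡ᵖ = ⊗⁴V* ⊕ ⋯ ⊕ ⊗⁴⁺ᵖV*`. -/
abbrev CurvSpace (p : ℕ) : Type := (k : Fin (p + 1)) → Tensor (4 + (k : ℕ))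

/-- The components `(R_{abcd}, …, R_{abcd;e₁…e_p})` at `y` with respect to the frame `e`. As a
function of both `y` and the frame this is the canonical map on the frame bundle. -/
def curvMap (g : CoordMetric) (p : ℕ) (y : E3) (e : Fin 3 → E3) : CurvSpace p := fun k =>
  frameComp (curv g k y) e

/-! ### The Lorentz group and null triads -/

/-- The Lorentzian inner product on `V = ℝ³` in a null triad `(ℓ, m, n)`:
`ℓ·n = -1`, `m·m = 1/2`, the other products are zero. -/
def eta : Matrix (Fin 3) (Fin 3) ℝ := !![0, 0, -1; 0, 1 / 2, 0; -1, 0, 0]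

/-- The group `O(η)`. -/
def lorentzGroup : Subgroup (Matrix (Fin 3) (Fin 3) ℝ)ˣ where
  carrier := {X | (X : Matrix (Fin 3) (Fin 3) ℝ).transpose * eta * X = eta}
  mul_mem' := by
    intro X Y hX hY
    simp only [Set.mem_ofPred_eq, Units.val_mul, Matrix.transpose_mul] at *
    calc Y.val.transpose * X.val.transpose * eta * (X.val * Y.val)
        = Y.val.transpose * (X.val.transpose * eta * X.val) * Y.val := by
          simp only [Matrix.mul_assoc]
      _ = eta := by rw [hX, hY]
  one_mem' := by simp
  inv_mem' := by
    intro X hX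
    simp only [Set.mem_ofPred_eq] at *
    have h1 : X.val * (X⁻¹).val = 1 := by rw [← Units.val_mul]; simp
    have h2 : (X⁻¹).val.transpose * X.val.transpose = 1 := by
      rw [← Matrix.transpose_mul, h1, Matrix.transpose_one]
    calc (X⁻¹).val.transpose * eta * (X⁻¹).val
        = (X⁻¹).val.transpose * (X.val.transpose * eta * X.val) * (X⁻¹).val := by rw [hX]
      _ = ((X⁻¹).val.transpose * X.val.transpose) * eta * (X.val * (X⁻¹).val) := by
          simp only [Matrix.mul_assoc]
      _ = eta := by rw [h1, h2]; simp

/-- The natural action of a linear transformation `X` of `V` on covariant tensors. -/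
def actTensor {m : ℕ} (X : (Matrix (Fin 3) (Fin 3) ℝ)ˣ) (S : Tensor m) : Tensor m := fun a =>
  ∑ b : Fin m → Fin 3, S b * ∏ s, (X⁻¹).val (b s) (a s)

/-- The action of `X` on `𝓡ᵖ`. -/
def actCurv {p : ℕ} (X : (Matrix (Fin 3) (Fin 3) ℝ)ˣ) (S : CurvSpace p) : CurvSpace p :=
  fun k => actTensor X (S k)

/-- The dimension of a (closed) linear group `G`: the dimension of its Lie algebra, which consists
of all `A` with `exp (tA) ∈ G` for all `t`. -/
def groupDim (G : Subgroup (Matrix (Fin 3) (Fin 3) ℝ)ˣ) : ℕ :=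
  Module.finrank ℝ (Submodule.span ℝ
    {A : Matrix (Fin 3) (Fin 3) ℝ | ∀ t : ℝ, ∃ X ∈ G, X.val = NormedSpace.exp (t • A)})

/-- The vectors `e 0, e 1, e 2` form an `η`-orthogonal frame of `g` at `y`. -/
def IsEtaFrame (g : CoordMetric) (y : E3) (e : Fin 3 → E3) : Prop :=
  ∀ a b, ∑ i, ∑ j, g y i j * e a i * e b j = eta a b

/-- An `η`-orthogonal moving coframe on the open set `V`, given by its dual frame. -/
structure IsMovingFrame (g : CoordMetric) (V : Set E3) (e : E3 → Fin 3 → E3) : Prop where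
  isOpen : IsOpen V
  smooth : ContDiffOn ℝ ∞ e V
  orthogonal : ∀ y ∈ V, IsEtaFrame g y (e y)

/-- Embedded smooth submanifolds of a normed space, described by slice charts. -/
def IsSubmanifold {F : Type*} [NormedAddCommGroup F] [NormedSpace ℝ F] (S : Set F) : Prop :=
  ∃ d : ℕ, ∀ x ∈ S, ∃ (φ : OpenPartialHomeomorph F F) (L : Submodule ℝ F),
    x ∈ φ.source ∧ ContDiffOn ℝ ∞ φ φ.source ∧ ContDiffOn ℝ ∞ φ.symm φ.target ∧
    Module.finrank ℝ L = d ∧ ∀ y ∈ φ.source, (y ∈ S ↔ φ y ∈ L)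

/-! ### The lifted curvature and its rank -/

/-- The tangent space at the `η`-orthogonal frame `e` over `y` to the bundle of all such frames,
which is a level set of `(y, e) ↦ (g_y(e_a, e_b))_{a,b}`. -/
def frameBundleTangent (g : CoordMetric) (y : E3) (e : Fin 3 → E3) :
    Submodule ℝ (E3 × (Fin 3 → E3)) :=
  LinearMap.ker (fderiv ℝ (fun (q : E3 × (Fin 3 → E3)) (a b : Fin 3) =>
    ∑ i, ∑ j, g q.1 i j * q.2 a i * q.2 b j) (y, e) :
      (E3 × (Fin 3 → E3)) →ₗ[ℝ] (Fin 3 → Fin 3 → ℝ))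

/-- The rank at `(y, e)` of the lift of `(R_{abcd}, …, R_{abcd;e₁…e_p})` to the bundle of
`η`-orthogonal frames. -/
def liftedRankAt (g : CoordMetric) (p : ℕ) (y : E3) (e : Fin 3 → E3) : ℕ :=
  Module.finrank ℝ ((frameBundleTangent g y e).map
    (fderiv ℝ (fun q : E3 × (Fin 3 → E3) => curvMap g p q.1 q.2) (y, e) :
      (E3 × (Fin 3 → E3)) →ₗ[ℝ] CurvSpace p))

/-! ### Lorentzian three-manifolds -/

section Manifold

variable {M : Type*} [TopologicalSpace M] [ChartedSpace E3 M]

/-- The differential at `y` of the inverse of the chart at `x₀`. -/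
def chartDiff (x₀ : M) (y : E3) :
    E3 →L[ℝ] TangentSpace 𝓘(ℝ, E3) ((chartAt E3 x₀).symm y) :=
  mfderiv 𝓘(ℝ, E3) 𝓘(ℝ, E3) (chartAt E3 x₀).symm y

variable (M) in
/-- A field of (arbitrary) real-valued functions of two tangent vectors, for instance a metric. -/
abbrev TensorField2 : Type _ :=
  (x : M) → TangentSpace 𝓘(ℝ, E3) x → TangentSpace 𝓘(ℝ, E3) x → ℝ

variable (M) in
/-- Triples of 1-forms on `M`. -/
abbrev Coframe : Type _ := (x : M) → Fin 3 → (TangentSpace 𝓘(ℝ, E3) x →L[ℝ] ℝ)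

/-- The components of `g` in the chart at `x₀`; they are of interest on the target of the chart. -/
def inChart (g : TensorField2 M) (x₀ : M) : CoordMetric := fun y =>
  Matrix.of fun i j => g ((chartAt E3 x₀).symm y)
    (chartDiff x₀ y (coordVec i)) (chartDiff x₀ y (coordVec j))

/-- `S` is a `p`-th order normalizing cross-section for `(M, g)`, with group `G = G_p`. -/
structure IsNormalizingCrossSection (g : TensorField2 M) (p : ℕ) (S : Set (CurvSpace p))
    (G : Subgroup (Matrix (Fin 3) (Fin 3) ℝ)ˣ) : Prop where
  submanifold : IsSubmanifold S
  le_lorentzGroup : G ≤ lorentzGroup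
  fixes : ∀ X ∈ G, ∀ R ∈ S, actCurv X R = R
  maximal : ∀ X ∈ lorentzGroup, (actCurv X '' S ∩ S).Nonempty → X ∈ G
  cover : ∀ x₀ : M, ∃ (V : Set E3) (e : E3 → Fin 3 → E3),
    chartAt E3 x₀ x₀ ∈ V ∧ V ⊆ (chartAt E3 x₀).target ∧ IsMovingFrame (inChart g x₀) V e ∧
    ∀ y ∈ V, curvMap (inChart g x₀) p y (e y) ∈ S

/-- `(M, g)` admits a `p`-th order normalizing cross-section, and relative to it the degree of frame
freedom is `s_p = s` and the horizontal rank (the rank of the normalized curvature components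
`R⁽ᵖ⁾` as functions on `M`) is everywhere `t_p = t`. In particular, `(M, g)` is curvature regular
if this holds for every `p` with some `s` and `t`. -/
def HasFrameFreedomAndHorizontalRank (g : TensorField2 M) (p s t : ℕ) : Prop :=
  ∃ (S : Set (CurvSpace p)) (G : Subgroup (Matrix (Fin 3) (Fin 3) ℝ)ˣ),
    IsNormalizingCrossSection g p S G ∧ groupDim G = s ∧
    ∀ (x₀ : M) (V : Set E3) (e : E3 → Fin 3 → E3),
      V ⊆ (chartAt E3 x₀).target → IsMovingFrame (inChart g x₀) V e →
      (∀ y ∈ V, curvMap (inChart g x₀) p y (e y) ∈ S) →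
      ∀ y ∈ V, Module.finrank ℝ (LinearMap.range
        (fderiv ℝ (fun z => curvMap (inChart g x₀) p z (e z)) y : E3 →ₗ[ℝ] CurvSpace p)) = t

/-- The lift of `(R_{abcd}, …, R_{abcd;e₁…e_p})` to the bundle of `η`-orthogonal frames has constant
rank `r_p = r`. -/
def HasLiftedRank (g : TensorField2 M) (p r : ℕ) : Prop :=
  ∀ x₀ : M, ∀ y ∈ (chartAt E3 x₀).target, ∀ e : Fin 3 → E3,
    IsEtaFrame (inChart g x₀) y e → liftedRankAt (inChart g x₀) p y e = r

/-- `(M, g)` is fully regular and `q` is the least integer with `r_{q-1} = r_q`, where `r_{-1} = 0`.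
The metric is then said to be of order `q - 1`, and to be classified by `q`-th order invariants. -/
def IsClassifiedByOrder (g : TensorField2 M) (q : ℕ) : Prop :=
  ∃ r : ℕ → ℕ, (∀ p, HasLiftedRank g p (r p)) ∧
    IsLeast {k : ℕ | (if k = 0 then 0 else r (k - 1)) = r k} q

/-- The curvature is everywhere of Petrov type D: at every point there is a null triad in which the
only components of the trace-free Ricci tensor `S_{ab} = R_{ab} - R g_{ab}/3` are
`S_{02} = S_{11} = S_{20} = Ψ₂`, with `Ψ₂ ≠ 0`. Here `R_{ab} = R^c_{acb}` and `R = R^a_a`. -/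
def IsTypeD (g : TensorField2 M) : Prop :=
  ∀ x₀ : M, ∀ y ∈ (chartAt E3 x₀).target, ∃ e : Fin 3 → E3, IsEtaFrame (inChart g x₀) y e ∧
    ∃ Ψ₂ : ℝ, Ψ₂ ≠ 0 ∧
      let ric : Matrix (Fin 3) (Fin 3) ℝ := Matrix.of fun a b =>
        ∑ c, ∑ d, eta⁻¹ c d * frameComp (riemann (inChart g x₀) y) e ![c, a, d, b]
      let R : ℝ := ∑ a, ∑ b, eta⁻¹ a b * ric a b
      ric - (R / 3) • eta = !![0, 0, Ψ₂; 0, Ψ₂, 0; Ψ₂, 0, 0]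

/-- The Lorentzian metric `½ (θ¹)² - 2 θ⁰ θ²` for which `θ` is an `η`-orthogonal coframe. -/
def coframeMetric (θ : Coframe M) : TensorField2 M := fun x v w =>
  ∑ a, ∑ b, eta a b * θ x a v * θ x b w

end Manifold

/-! ### The structure equations -/

/-- The exterior derivative `dα(v, w)` of a 1-form. -/
def dForm (α : E3 → E3 →L[ℝ] ℝ) (y v w : E3) : ℝ := fderiv ℝ α y v w - fderiv ℝ α y w v

/-- The wedge product `(α ∧ β)(v, w)` of two covectors. -/
def wedge (α β : E3 →L[ℝ] ℝ) (v w : E3) : ℝ := α v * β w - α w * β v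

/-- The frame `e_0, e_1, e_2` dual to the coframe `θ`: `θᵃ(e_b) = δᵃ_b`. -/
def dualFrame (θ : E3 → Fin 3 → E3 →L[ℝ] ℝ) (y : E3) (b : Fin 3) : E3 :=
  WithLp.toLp 2 fun i => (Matrix.of fun a j => θ y a (coordVec j))⁻¹ i b

/-- The derivative `D f = e_0(f)`. -/
def opD (θ : E3 → Fin 3 → E3 →L[ℝ] ℝ) (f : E3 → ℝ) (y : E3) : ℝ :=
  fderiv ℝ f y (dualFrame θ y 0)

/-- The coframe `θ⁰, θ¹, θ²` and the function `ε > 0` solve on the open set `U` the structure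
equations
`dθ⁰ = -T θ⁰∧θ¹`, `dθ¹ = -4T θ⁰∧θ²`, `dθ² = θ⁰∧θ¹ + 2ε θ⁰∧θ² - T θ¹∧θ²`,
`dε = P θ⁰ - Tε θ¹ + C θ²` with `P = Dε`. -/
structure SolvesStructureEqs (T C : ℝ) (U : Set E3) (θ : E3 → Fin 3 → E3 →L[ℝ] ℝ)
    (ε : E3 → ℝ) : Prop where
  smooth_coframe : ContDiffOn ℝ ∞ θ U
  smooth_epsilon : ContDiffOn ℝ ∞ ε U
  coframe : ∀ y ∈ U, LinearIndependent ℝ (θ y)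
  epsilon_pos : ∀ y ∈ U, 0 < ε y
  d_omega0 : ∀ y ∈ U, ∀ v w, dForm (fun z => θ z 0) y v w = -T * wedge (θ y 0) (θ y 1) v w
  d_omega1 : ∀ y ∈ U, ∀ v w, dForm (fun z => θ z 1) y v w = -4 * T * wedge (θ y 0) (θ y 2) v w
  d_omega2 : ∀ y ∈ U, ∀ v w, dForm (fun z => θ z 2) y v w =
    wedge (θ y 0) (θ y 1) v w + 2 * ε y * wedge (θ y 0) (θ y 2) v w
      - T * wedge (θ y 1) (θ y 2) v w
  d_epsilon : ∀ y ∈ U, fderiv ℝ ε y = opD θ ε y • θ y 0 - (T * ε y) • θ y 1 + C • θ y 2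

/-- `ε`, `Dε`, `D²ε` are functionally independent at `y`: `dε ∧ d(Dε) ∧ d(D²ε) ≠ 0`. -/
def FunctionallyIndependentAt (θ : E3 → Fin 3 → E3 →L[ℝ] ℝ) (ε : E3 → ℝ) (y : E3) : Prop :=
  LinearIndependent ℝ ![fderiv ℝ ε y, fderiv ℝ (opD θ ε) y, fderiv ℝ (opD θ (opD θ ε)) y]

/-- The space of all solutions of the structure equations on `U`. -/
def SolutionSpace (T C : ℝ) (U : Set E3) : Type :=
  {σ : (E3 → Fin 3 → E3 →L[ℝ] ℝ) × (E3 → ℝ) // SolvesStructureEqs T C U σ.1 σ.2}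

/-- The coframe of a solution. -/
def SolutionSpace.omega {T C : ℝ} {U : Set E3} (σ : SolutionSpace T C U) :
    E3 → Fin 3 → E3 →L[ℝ] ℝ := σ.1.1

/-- The function `ε` of a solution. -/
def SolutionSpace.eps {T C : ℝ} {U : Set E3} (σ : SolutionSpace T C U) : E3 → ℝ := σ.1.2

/-- The `C^∞` topology: uniform convergence of all derivatives on the compact subsets of `U`. -/
instance SolutionSpace.instTopologicalSpace (T C : ℝ) (U : Set E3) :
    TopologicalSpace (SolutionSpace T C U) :=
  (⨅ j : ℕ, TopologicalSpace.induced (fun σ : SolutionSpace T C U =>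
      UniformOnFun.ofFun {K : Set E3 | IsCompact K ∧ K ⊆ U} (iteratedFDeriv ℝ j σ.omega))
      inferInstance) ⊓
  (⨅ j : ℕ, TopologicalSpace.induced (fun σ : SolutionSpace T C U =>
      UniformOnFun.ofFun {K : Set E3 | IsCompact K ∧ K ⊆ U} (iteratedFDeriv ℝ j σ.eps))
      inferInstance)

section Manifold

variable {M : Type*} [TopologicalSpace M] [ChartedSpace E3 M]

/-- The coframe `θ` in the chart at `x₀`. -/
def coframeInChart (θ : Coframe M) (x₀ : M) : E3 → Fin 3 → E3 →L[ℝ] ℝ := fun y a =>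
  (θ ((chartAt E3 x₀).symm y) a).comp (chartDiff x₀ y)

/-- The function `f` in the chart at `x₀`. -/
def funInChart (f : M → ℝ) (x₀ : M) : E3 → ℝ := fun y => f ((chartAt E3 x₀).symm y)

/-- The coframe `θ` and the function `ε > 0` solve the structure equations on `M`. -/
def SolvesStructureEqsOn (T C : ℝ) (θ : Coframe M) (ε : M → ℝ) : Prop :=
  ∀ x₀ : M, SolvesStructureEqs T C (chartAt E3 x₀).target (coframeInChart θ x₀) (funInChart ε x₀)

/-- `ε`, `Dε`, `D²ε` are functionally independent at every point of `M`. -/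
def FunctionallyIndependent (θ : Coframe M) (ε : M → ℝ) : Prop :=
  ∀ x₀ : M, ∀ y ∈ (chartAt E3 x₀).target,
    FunctionallyIndependentAt (coframeInChart θ x₀) (funInChart ε x₀) y

end Manifold

/-- The degrees of frame freedom `s = (1, 0, 0, …)`. -/
def sSeq : ℕ → ℕ
  | 0 => 1
  | _ => 0

/-- The horizontal ranks `t = (0, 0, 1, 2, 3, 3, …)`. -/
def tSeq : ℕ → ℕ
  | 0 => 0
  | 1 => 0
  | 2 => 1
  | 3 => 2
  | _ => 3

/-- The ranks `r = (2, 3, 4, 5, 6, 6, …)`. -/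
def rSeq : ℕ → ℕ
  | 0 => 2
  | 1 => 3
  | 2 => 4
  | 3 => 5
  | _ => 6

end Lorentz3

end

open Lorentz3

/-! Classification. In the given coframe the Levi-Civita connection matrices `conn T ε c` are
constant except for one term: along e₀ they contain 2ε times the generator of boosts (`conn_eq`). By
the second structure equation, in which dε contributes only through its coefficient C of ω², the
curvature has constant components (`SolvesStructureEqs.riemann_eq`): a constant-curvature part plus
-2(C+2T²) times the square of ω⁰∧ω². Covariant differentiation in the frame is "differentiate the
components along e_c, subtract the action of `conn T ε c`" (`SolvesStructureEqs.covDeriv_eq`), so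
the invariants can be followed order by order. Order 0: constant components; since C+2T² ≠ 0, the
stabilizer consists of boosts up to discrete symmetries, which gives s₀ = 1 and type D. Order 1: the
term with ε drops out, because boosts preserve the curvature (`frameCurv_one`). The components are
again constant, but they break the boosts: only the identity and diag(-1,1,-1) survive
(`eq_of_fixes_curvZero_curvOne`). Order 2: affine in ε, with one component equal to 8(C+2T²)ε. It
changes sign under diag(-1,1,-1), so positivity of ε removes the last symmetry. Orders 3 and 4:
since e₁ε = -Tε and e₂ε = C, order 3 brings in only Dε as a new function; order 4 yields D²ε. Modulo
earlier ones, each order thus yields one new differential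
(`SolvesStructureEqs.frameCurv_kills_iff`), until three independent ones exhaust the cotangent
space. This gives t_p. On the frame bundle the kernel of the lifted map is the product of the
horizontal kernel (dimension 3 - t_p) and the isotropy algebra (dimension s_p), so r_p = 6 - (3 -
t_p) - s_p (`SolvesStructureEqs.ker_lift`).

Existence and genericity. Solutions exist globally on ℝ³ in explicit triangular form
(`exists_solves_univ`). To perturb a solution, replace ω² by ω² + hω⁰ and keep ε; this preserves the
equations as soon as dh = (Dh)ω⁰ - 2Th ω¹ (`SolvesStructureEqs.shift`). By d² = 0, the determinant
that tests independence of ε, Dε, D²ε is a polynomial in ε, Dε, D²ε, D³ε. After a shift it becomes a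
polynomial in the values of h, Dh, D²h, and it never vanishes identically
(`exists_shiftDet_ne_zero`). On a convex set the Poincaré lemma supplies h = w²(k₀+k₁u+k₂u²), whose
jets at any point are arbitrary (`quadShiftJet_surjective`). So independence at a given point holds
for an open dense set of parameters k ∈ ℝ³. Baire's theorem in ℝ³ handles countably many points
simultaneously, and k → 0 returns to the original solution. Openness holds because the determinant
depends continuously on finitely many derivatives of the solution at the point. -/

noncomputable section

namespace Lorentz3

/-! ### Tensor algebra -/

/-- The derivation of the tensor algebra induced by `A`, on components with respect to a frame. -/
def derAct {m : ℕ} (A : Matrix (Fin 3) (Fin 3) ℝ) (S : Tensor m) : Tensor m := fun a =>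
  ∑ s, ∑ k, A k (a s) * S (Function.update a s k)

theorem prod_sum_fin {m : ℕ} (f : Fin m → Fin 3 → ℝ) :
    ∏ s, ∑ c, f s c = ∑ i : Fin m → Fin 3, ∏ s, f s (i s) := by
  rw [Finset.prod_univ_sum, Fintype.piFinset_univ]

/-- Components with respect to vectors that are themselves given in terms of a frame. -/
theorem frameComp_frameComp {m : ℕ} (S : Tensor m) (e x : Fin 3 → E3) :
    frameComp (frameComp S e) x =
      frameComp S (fun a => WithLp.toLp 2 fun j => ∑ c, x a c * e c j) := by
  funext a
  simp only [frameComp, Finset.sum_mul]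
  rw [Finset.sum_comm]
  refine Finset.sum_congr rfl fun j _ => ?_
  rw [prod_sum_fin, Finset.mul_sum]
  refine Finset.sum_congr rfl fun i _ => ?_
  rw [mul_assoc, ← Finset.prod_mul_distrib]
  congr 1
  exact Finset.prod_congr rfl fun s _ => mul_comm _ _

theorem frameComp_single {m : ℕ} (S : Tensor m) : frameComp S coordVec = S := by
  funext a
  simp only [frameComp]
  rw [Finset.sum_eq_single a]
  · simp [coordVec]
  · intro b _ hb
    obtain ⟨s, hs⟩ := Function.ne_iff.1 hb
    rw [Finset.prod_eq_zero (Finset.mem_univ s), mul_zero]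
    simp [coordVec, hs]
  · simp

theorem prod_mul_prod_erase_update {m : ℕ} (z : Fin m → Fin 3 → ℝ) (i : Fin m → Fin 3)
    (s : Fin m) (k : Fin 3) :
    z s k * ∏ t ∈ Finset.univ.erase s, z t (i t) = ∏ t, z t (Function.update i s k t) := by
  rw [← Finset.mul_prod_erase _ _ (Finset.mem_univ s)]
  congr 1
  · simp
  · refine Finset.prod_congr rfl fun t ht => ?_
    rw [Function.update_of_ne (Finset.ne_of_mem_erase ht)]

/-- Transposition of a derivation from the arguments to the components of a tensor. -/
theorem sum_mul_sum_prod_erase {m : ℕ} (S : Tensor m) (A : Matrix (Fin 3) (Fin 3) ℝ)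
    (z : Fin m → Fin 3 → ℝ) :
    ∑ i : Fin m → Fin 3, S i * ∑ s, (∑ c, A (i s) c * z s c) *
        ∏ t ∈ Finset.univ.erase s, z t (i t)
      = ∑ i : Fin m → Fin 3, derAct A S i * ∏ t, z t (i t) := by
  simp only [derAct, Finset.mul_sum, Finset.sum_mul]
  rw [Finset.sum_comm]
  conv_rhs => rw [Finset.sum_comm]
  refine Finset.sum_congr rfl fun s _ => ?_
  have h1 := Fintype.sum_prod_type' (fun (i : Fin m → Fin 3) (c : Fin 3) =>
      S i * (A (i s) c * z s c * ∏ t ∈ Finset.univ.erase s, z t (i t)))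
  have h2 := Fintype.sum_prod_type' (fun (i : Fin m → Fin 3) (c : Fin 3) =>
      A c (i s) * S (Function.update i s c) * ∏ t, z t (i t))
  refine h1.symm.trans (Eq.trans ?_ h2)
  -- The reindexing exchanges the s-th entry of the multi-index with the summation index; it is an
  -- involution, hence its own inverse.
  refine Finset.sum_nbij' (fun p => (Function.update p.1 s p.2, p.1 s))
    (fun p => (Function.update p.1 s p.2, p.1 s)) (by simp) (by simp) (by simp) (by simp) ?_
  rintro ⟨i, c⟩ _
  simp only [Function.update_self, Function.update_idem, Function.update_eq_self]
  rw [← prod_mul_prod_erase_update z i s c]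
  ring

theorem derAct_add_matrix {m : ℕ} (A A' : Matrix (Fin 3) (Fin 3) ℝ) (S : Tensor m) :
    derAct (A + A') S = derAct A S + derAct A' S := by
  funext a
  simp [derAct, add_mul, Finset.sum_add_distrib]

theorem derAct_smul_matrix {m : ℕ} (c : ℝ) (A : Matrix (Fin 3) (Fin 3) ℝ) (S : Tensor m) :
    derAct (c • A) S = c • derAct A S := by
  funext a
  simp [derAct, Finset.mul_sum, mul_assoc]

theorem derAct_add {m : ℕ} (A : Matrix (Fin 3) (Fin 3) ℝ) (S S' : Tensor m) :
    derAct A (S + S') = derAct A S + derAct A S' := by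
  funext a
  simp [derAct, mul_add, Finset.sum_add_distrib]

theorem derAct_smul {m : ℕ} (c : ℝ) (A : Matrix (Fin 3) (Fin 3) ℝ) (S : Tensor m) :
    derAct A (c • S) = c • derAct A S := by
  funext a
  simp only [derAct, Pi.smul_apply, smul_eq_mul, Finset.mul_sum]
  exact Finset.sum_congr rfl fun s _ => Finset.sum_congr rfl fun k _ => by ring

/-- A diagonal derivation multiplies a component by the sum of the weights of its indices. -/
theorem derAct_diagonal {m : ℕ} (w : Fin 3 → ℝ) (S : Tensor m) (a : Fin m → Fin 3) :
    derAct (Matrix.diagonal w) S a = (∑ s, w (a s)) * S a := by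
  simp only [derAct, Finset.sum_mul]
  refine Finset.sum_congr rfl fun s _ => ?_
  rw [Finset.sum_eq_single (a s)]
  · simp
  · intro k _ hk
    rw [Matrix.diagonal_apply_ne _ hk, zero_mul]
  · simp

theorem actTensor_eq_frameComp {m : ℕ} (X : (Matrix (Fin 3) (Fin 3) ℝ)ˣ) (S : Tensor m) :
    actTensor X S = frameComp S (fun a => WithLp.toLp 2 fun b => (X⁻¹).val b a) := rfl

theorem actTensor_one {m : ℕ} (S : Tensor m) : actTensor 1 S = S := by
  rw [actTensor_eq_frameComp]
  conv_rhs => rw [← frameComp_single S]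
  congr 1
  funext a
  ext b
  simp [coordVec, Matrix.one_apply]

theorem actTensor_mul {m : ℕ} (X Y : (Matrix (Fin 3) (Fin 3) ℝ)ˣ) (S : Tensor m) :
    actTensor (X * Y) S = actTensor X (actTensor Y S) := by
  rw [actTensor_eq_frameComp, actTensor_eq_frameComp X, actTensor_eq_frameComp Y,
    frameComp_frameComp]
  congr 1
  funext a
  ext b
  simp only [mul_inv_rev, Units.val_mul, Matrix.mul_apply]
  exact Finset.sum_congr rfl fun c _ => mul_comm _ _

/-- The stabilizer of `R` in `O(η)`. -/
def isotropy {p : ℕ} (R : CurvSpace p) : Subgroup (Matrix (Fin 3) (Fin 3) ℝ)ˣ where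
  carrier := {X | X ∈ lorentzGroup ∧ actCurv X R = R}
  one_mem' := ⟨one_mem _, funext fun _ => actTensor_one _⟩
  mul_mem' := by
    rintro X Y ⟨hX, hX'⟩ ⟨hY, hY'⟩
    refine ⟨mul_mem hX hY, funext fun k => ?_⟩
    have h1 := congrFun hX' k
    have h2 := congrFun hY' k
    simp only [actCurv] at *
    rw [actTensor_mul, h2, h1]
  inv_mem' := by
    rintro X ⟨hX, hX'⟩
    refine ⟨inv_mem hX, funext fun k => ?_⟩
    have h1 := congrFun hX' k
    simp only [actCurv] at *
    conv_lhs => rw [← h1]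
    rw [← actTensor_mul, inv_mul_cancel, actTensor_one]

theorem mem_isotropy {p : ℕ} {R : CurvSpace p} {X : (Matrix (Fin 3) (Fin 3) ℝ)ˣ} :
    X ∈ isotropy R ↔ X ∈ lorentzGroup ∧ actCurv X R = R := Iff.rfl

theorem mem_lorentzGroup {X : (Matrix (Fin 3) (Fin 3) ℝ)ˣ} :
    X ∈ lorentzGroup ↔ X.val.transpose * eta * X.val = eta := Iff.rfl

/-! ### The curvature of order zero and one -/

/-- The bivector `ω⁰ ∧ ω²`. -/
def bivec : Matrix (Fin 3) (Fin 3) ℝ := !![0, 0, 1; 0, 0, 0; -1, 0, 0]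

/-- The components of the curvature tensor. -/
def curvZero (T C : ℝ) : Tensor 4 := fun a =>
  -2 * T ^ 2 * (eta (a 0) (a 2) * eta (a 1) (a 3) - eta (a 0) (a 3) * eta (a 1) (a 2))
    - 2 * (C + 2 * T ^ 2) * (bivec (a 0) (a 1) * bivec (a 2) (a 3))

/-- The matrix of the connection forms on the `c`-th frame vector. -/
def conn (T ε : ℝ) : Fin 3 → Matrix (Fin 3) (Fin 3) ℝ :=
  ![!![2 * ε, T, 0; -2, 0, 2 * T; 0, -1, -2 * ε], 0, !![0, 0, 0; -2 * T, 0, 0; 0, -T, 0]]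

/-- The generator of the boosts. -/
def boostGen : Matrix (Fin 3) (Fin 3) ℝ := Matrix.diagonal ![1, 0, -1]

/-- The components `∇_e (ω⁰ ∧ ω²)_{ab}`. -/
def bivecDeriv (T : ℝ) : Fin 3 → Matrix (Fin 3) (Fin 3) ℝ :=
  ![!![0, 1, 0; -1, 0, -T; 0, T, 0], 0, !![0, T, 0; -T, 0, 0; 0, 0, 0]]

/-- The components of the first covariant derivative of the curvature. -/
def curvOne (T C : ℝ) : Tensor 5 := fun a =>
  -2 * (C + 2 * T ^ 2) * (bivecDeriv T (a 4) (a 0) (a 1) * bivec (a 2) (a 3) +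
    bivec (a 0) (a 1) * bivecDeriv T (a 4) (a 2) (a 3))

/-- This splitting is why ε appears so late: it enters only through boosts, and those preserve the
curvature, so ε is invisible until the second derivative. -/
theorem conn_eq (T ε : ℝ) (c : Fin 3) :
    conn T ε c = conn T 0 c + (if c = 0 then 2 * ε else 0) • boostGen := by
  fin_cases c <;> ext i j <;> fin_cases i <;> fin_cases j <;> simp [conn, boostGen]

/-- Under the boost the indices 0, 1, 2 have weights 1, 0, -1, and both `eta` and `bivec` have
nonzero entries only where the two weights cancel. -/
theorem derAct_boostGen_curvZero (T C : ℝ) : derAct boostGen (curvZero T C) = 0 := by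
  funext a
  have hη : ∀ x y : Fin 3,
      ((![1, 0, -1] : Fin 3 → ℝ) x + (![1, 0, -1] : Fin 3 → ℝ) y) * eta x y = 0 := by
    intro x y
    fin_cases x <;> fin_cases y <;> simp [eta]
  have hB : ∀ x y : Fin 3,
      ((![1, 0, -1] : Fin 3 → ℝ) x + (![1, 0, -1] : Fin 3 → ℝ) y) * bivec x y = 0 := by
    intro x y
    fin_cases x <;> fin_cases y <;> simp [bivec]
  rw [boostGen, derAct_diagonal, Fin.sum_univ_four]
  simp only [curvZero, Pi.zero_apply]
  linear_combination (-2 * T ^ 2) * (eta (a 1) (a 3) * hη (a 0) (a 2)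
    + eta (a 0) (a 2) * hη (a 1) (a 3) - eta (a 1) (a 2) * hη (a 0) (a 3)
    - eta (a 0) (a 3) * hη (a 1) (a 2)) - 2 * (C + 2 * T ^ 2) *
    (bivec (a 2) (a 3) * hB (a 0) (a 1) + bivec (a 0) (a 1) * hB (a 2) (a 3))

/-- `curvOne` is minus the derivation of `curvZero` along the connection matrices. -/
theorem derAct_conn_curvZero (T C ε : ℝ) (a : Fin 5 → Fin 3) :
    -derAct (conn T ε (a 4)) (curvZero T C) (Fin.init a) = curvOne T C a := by
  rw [conn_eq, derAct_add_matrix, derAct_smul_matrix, derAct_boostGen_curvZero, smul_zero,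
    add_zero]
  -- The connection matrices are η-skew, so the constant-curvature part contributes nothing; only
  -- the derivative of the bivector remains.
  have hη : ∀ c x y : Fin 3,
      ∑ k, conn T 0 c k x * eta k y + ∑ k, conn T 0 c k y * eta x k = 0 := by
    intro c x y
    fin_cases c <;> fin_cases x <;> fin_cases y <;>
      simp [eta, conn, Fin.sum_univ_three] <;> ring
  have hB : ∀ c x y : Fin 3,
      ∑ k, conn T 0 c k x * bivec k y + ∑ k, conn T 0 c k y * bivec x k
        = - bivecDeriv T c x y := by
    intro c x y
    fin_cases c <;> fin_cases x <;> fin_cases y <;>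
      simp [bivec, bivecDeriv, conn, Fin.sum_univ_three]
  simp only [Fin.sum_univ_three] at hη hB
  simp only [derAct, Fin.sum_univ_four, Fin.sum_univ_three, curvZero, curvOne, Fin.init_def,
    Function.update_apply]
  simp only [Fin.isValue, if_true, if_false, Fin.reduceEq,
    show Fin.castSucc (0 : Fin 4) = 0 from rfl, show Fin.castSucc (1 : Fin 4) = 1 from rfl,
    show Fin.castSucc (2 : Fin 4) = 2 from rfl, show Fin.castSucc (3 : Fin 4) = 3 from rfl]
  linear_combination (2 * T ^ 2) * (eta (a 1) (a 3) * hη (a 4) (a 0) (a 2)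
    + eta (a 0) (a 2) * hη (a 4) (a 1) (a 3) - eta (a 1) (a 2) * hη (a 4) (a 0) (a 3)
    - eta (a 0) (a 3) * hη (a 4) (a 1) (a 2)) + 2 * (C + 2 * T ^ 2) *
    (bivec (a 2) (a 3) * hB (a 4) (a 0) (a 1) + bivec (a 0) (a 1) * hB (a 4) (a 2) (a 3))

end Lorentz3

end

/-! ### Pointwise symmetry: which Lorentz transformations fix the curvature and its first derivative
-/

noncomputable section

namespace Lorentz3

/-! ### Stabilizers -/

theorem sum_fin_four_fun (f : Fin 3 → Fin 3 → Fin 3 → Fin 3 → ℝ) :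
    ∑ b : Fin 4 → Fin 3, f (b 0) (b 1) (b 2) (b 3) = ∑ x, ∑ y, ∑ z, ∑ w, f x y z w := by
  have h : ∀ (n : ℕ) (F : (Fin (n + 1) → Fin 3) → ℝ),
      ∑ b, F b = ∑ x, ∑ b', F (Fin.cons x b') := by
    intro n F
    rw [← (Fin.consEquiv fun _ : Fin (n + 1) => Fin 3).sum_comp, Fintype.sum_prod_type]
    rfl
  simp only [h, Fintype.sum_unique, Fin.cons_zero]
  rfl

/-- The transform of the curvature under a change of frame. -/
theorem sum_curvZero_mul_prod (T C : ℝ) (Y : Matrix (Fin 3) (Fin 3) ℝ) (a : Fin 4 → Fin 3) :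
    ∑ b : Fin 4 → Fin 3, curvZero T C b * ∏ s, Y (b s) (a s) =
      -2 * T ^ 2 * ((Y.transpose * eta * Y) (a 0) (a 2) * (Y.transpose * eta * Y) (a 1) (a 3)
        - (Y.transpose * eta * Y) (a 0) (a 3) * (Y.transpose * eta * Y) (a 1) (a 2))
      - 2 * (C + 2 * T ^ 2) * ((Y.transpose * bivec * Y) (a 0) (a 1)
        * (Y.transpose * bivec * Y) (a 2) (a 3)) := by
  simp only [Fin.prod_univ_four, curvZero]
  rw [sum_fin_four_fun (fun x y z w => (-2 * T ^ 2 * (eta x z * eta y w - eta x w * eta y z)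
    - 2 * (C + 2 * T ^ 2) * (bivec x y * bivec z w)) *
    (Y x (a 0) * Y y (a 1) * Y z (a 2) * Y w (a 3)))]
  simp [Fin.sum_univ_three, eta, bivec, Matrix.mul_apply]
  ring

/-- An element of `O(η)` that fixes the curvature is a boost up to discrete symmetries. -/
theorem entries_of_fixes_curvZero {T C : ℝ} (hTC : C + 2 * T ^ 2 ≠ 0)
    {X : (Matrix (Fin 3) (Fin 3) ℝ)ˣ} (hX : X ∈ lorentzGroup)
    (h0 : actTensor X (curvZero T C) = curvZero T C) :
    ∀ Y : Matrix (Fin 3) (Fin 3) ℝ, Y = (X⁻¹).val →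
    Y 0 1 = 0 ∧ Y 2 1 = 0 ∧ Y 1 0 = 0 ∧ Y 1 2 = 0 ∧ Y 1 1 * Y 1 1 = 1 ∧ Y 0 0 * Y 2 0 = 0 ∧
      Y 0 2 * Y 2 2 = 0 ∧ Y 0 0 * Y 2 2 + Y 0 2 * Y 2 0 = 1 := by
  intro Y hY
  have hη : Y.transpose * eta * Y = eta := hY ▸ mem_lorentzGroup.1 (inv_mem hX)
  have hB : ∀ a b c d : Fin 3, (Y.transpose * bivec * Y) a b * (Y.transpose * bivec * Y) c d
      = bivec a b * bivec c d := by
    intro a b c d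
    have h := congrFun h0 ![a, b, c, d]
    simp only [actTensor] at h
    rw [← hY, sum_curvZero_mul_prod, hη] at h
    simp only [curvZero] at h
    simp only [Matrix.cons_val_zero, Matrix.cons_val_one, Matrix.cons_val] at h
    have h' : (C + 2 * T ^ 2) * ((Y.transpose * bivec * Y) a b * (Y.transpose * bivec * Y) c d
      - bivec a b * bivec c d) = 0 := by linear_combination (-1 / 2) * h
    linarith [(mul_eq_zero.1 h').resolve_left hTC]
  have e : ∀ i j, (Y.transpose * eta * Y) i j = eta i j := fun i j => by rw [hη]
  -- The matrix YᵗBY equals B up to sign. The component 0202 makes its entry 02 nonzero; the other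
  -- two then force its entries 01 and 12 to vanish, so Y preserves the kernel of B, which is the
  -- line of m.
  have b1 := hB 0 2 0 2
  have b2 := hB 0 1 0 2
  have b3 := hB 1 2 0 2
  have e00 := e 0 0
  have e01 := e 0 1
  have e02 := e 0 2
  have e11 := e 1 1
  have e12 := e 1 2
  have e22 := e 2 2
  simp [Matrix.mul_apply, Fin.sum_univ_three, bivec] at b1 b2 b3
  simp [Matrix.mul_apply, Fin.sum_univ_three, eta] at e00 e01 e02 e11 e12 e22
  have hD : Y 0 0 * Y 2 2 - Y 2 0 * Y 0 2 ≠ 0 := by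
    intro h
    have : (-(Y 2 0 * Y 0 2) + Y 0 0 * Y 2 2) = 0 := by linear_combination h
    rw [this] at b1
    norm_num at b1
  have b2' : Y 0 0 * Y 2 1 - Y 2 0 * Y 0 1 = 0 := by
    rcases b2 with h | h
    · linear_combination h
    · exact absurd (by linear_combination h) hD
  have b3' : Y 0 1 * Y 2 2 - Y 2 1 * Y 0 2 = 0 := by
    rcases b3 with h | h
    · linear_combination h
    · exact absurd (by linear_combination h) hD
  have h01 : Y 0 1 = 0 := (mul_eq_zero.1 (show Y 0 1 * (Y 0 0 * Y 2 2 - Y 2 0 * Y 0 2) = 0 by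
    linear_combination Y 0 0 * b3' + Y 0 2 * b2')).resolve_right hD
  have h21 : Y 2 1 = 0 := (mul_eq_zero.1 (show Y 2 1 * (Y 0 0 * Y 2 2 - Y 2 0 * Y 0 2) = 0 by
    linear_combination Y 2 2 * b2' + Y 2 0 * b3')).resolve_right hD
  simp only [h01, h21] at *
  have h11 : Y 1 1 * Y 1 1 = 1 := by linear_combination 2 * e11
  have h11' : Y 1 1 ≠ 0 := by
    intro h
    rw [h] at h11
    norm_num at h11
  have h10 : Y 1 0 = 0 := (mul_eq_zero.1 (show Y 1 0 * Y 1 1 = 0 by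
    linear_combination 2 * e01)).resolve_right h11'
  have h12 : Y 1 2 = 0 := (mul_eq_zero.1 (show Y 1 2 * Y 1 1 = 0 by
    linear_combination 2 * e12)).resolve_right h11'
  simp only [h10, h12] at *
  refine ⟨trivial, trivial, trivial, trivial, h11, ?_, ?_, ?_⟩
  · linear_combination (-1 / 2) * e00
  · linear_combination (-1 / 2) * e22
  · linear_combination -e02

/-- When each column of Y has at most one nonzero entry, only one multi-index contributes to the
transformed component. This covers the boosts with signs (τ = id) and the exchange of ℓ and n. -/
theorem sum_mul_prod_monomial {m : ℕ} (S : Tensor m) (Y : Matrix (Fin 3) (Fin 3) ℝ)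
    (τ : Fin 3 → Fin 3) (hY : ∀ c x, c ≠ τ x → Y c x = 0) (a : Fin m → Fin 3) :
    ∑ b : Fin m → Fin 3, S b * ∏ s, Y (b s) (a s) =
      S (τ ∘ a) * ∏ s, Y (τ (a s)) (a s) := by
  refine Finset.sum_eq_single (τ ∘ a) ?_ (by simp)
  intro b _ hb
  obtain ⟨s, hs⟩ := Function.ne_iff.1 hb
  rw [Finset.prod_eq_zero (Finset.mem_univ s) (hY _ _ hs), mul_zero]

/-- The elements of `O(η)` that fix the curvature and its first derivative. -/
theorem eq_of_fixes_curvZero_curvOne {T C : ℝ} (hTC : C + 2 * T ^ 2 ≠ 0)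
    {X : (Matrix (Fin 3) (Fin 3) ℝ)ˣ} (hX : X ∈ lorentzGroup)
    (h0 : actTensor X (curvZero T C) = curvZero T C)
    (h1 : actTensor X (curvOne T C) = curvOne T C) :
    (X⁻¹).val = 1 ∨ (X⁻¹).val = Matrix.diagonal ![-1, 1, -1] := by
  obtain ⟨Y, hY⟩ : ∃ Y, Y = (X⁻¹).val := ⟨_, rfl⟩
  obtain ⟨h01, h21, h10, h12, h11, h00, h22, h02⟩ := entries_of_fixes_curvZero hTC hX h0 Y hY
  -- This component of `curvOne` equals -2(C+2T²), and it has boost weight 2, so it detects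
  -- rescaling of ℓ.
  have h := congrFun h1 ![0, 2, 0, 1, 0]
  simp only [actTensor] at h
  rw [← hY] at h ⊢
  clear hY h1 h0 hX
  by_cases hY0 : Y 0 0 = 0
  · have hY2 : Y 2 2 = 0 := by
      rw [hY0, zero_mul, zero_add] at h02
      rcases mul_eq_zero.1 h22 with h' | h'
      · rw [h', zero_mul] at h02
        norm_num at h02
      · exact h'
    -- Exchanging ℓ and n would move the component to the position 2,0,2,1,2, where `curvOne`
    -- vanishes.
    rw [sum_mul_prod_monomial _ _ ![2, 1, 0]] at h
    · simp [curvOne, bivecDeriv, bivec] at h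
      exact absurd h hTC
    · intro c x hcx
      fin_cases c <;> fin_cases x <;> simp_all
  · have hY20 : Y 2 0 = 0 := (mul_eq_zero.1 h00).resolve_left hY0
    rw [hY20, mul_zero, add_zero] at h02
    have hY2 : Y 2 2 ≠ 0 := right_ne_zero_of_mul_eq_one h02
    have hY02 : Y 0 2 = 0 := (mul_eq_zero.1 h22).resolve_right hY2
    rw [sum_mul_prod_monomial _ _ id] at h
    · simp [curvOne, bivecDeriv, bivec, Fin.prod_univ_five] at h
      -- With Y₀₀Y₂₂ = 1 this becomes Y₀₀²Y₁₁ = 1. Since Y₁₁ = ±1, it follows that Y₁₁ = 1 and Y₀₀ =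
      -- ±1.
      have h3 : Y 0 0 * Y 2 2 * Y 0 0 * Y 1 1 * Y 0 0 = 1 :=
        mul_left_cancel₀ hTC (by linear_combination h / 2)
      have h4 : Y 0 0 * Y 0 0 * Y 1 1 = 1 := by
        linear_combination h3 - Y 0 0 * Y 0 0 * Y 1 1 * h02
      have h5 : Y 1 1 = 1 := by
        rcases mul_self_eq_one_iff.1 h11 with h5 | h5
        · exact h5
        · rw [h5] at h4
          nlinarith [mul_self_nonneg (Y 0 0)]
      rw [h5, mul_one] at h4
      rcases mul_self_eq_one_iff.1 h4 with h6 | h6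
      · left
        have h7 : Y 2 2 = 1 := by rw [h6] at h02; linarith
        ext i j
        fin_cases i <;> fin_cases j <;> simp [*]
      · right
        have h7 : Y 2 2 = -1 := by rw [h6] at h02; linarith
        ext i j
        fin_cases i <;> fin_cases j <;> simp [*]
    · intro c x hcx
      fin_cases c <;> fin_cases x <;> simp_all

/-! ### Dimensions of the stabilizers -/

section Exp

open scoped Matrix.Norms.Operator

theorem hasDerivAt_exp_smul_entry (A : Matrix (Fin 3) (Fin 3) ℝ) (i j : Fin 3) :
    HasDerivAt (fun t : ℝ => (NormedSpace.exp (t • A)) i j) (A i j) 0 := by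
  have h := hasDerivAt_exp_smul_const (𝕂 := ℝ) A (0 : ℝ)
  rw [zero_smul, NormedSpace.exp_zero, one_mul] at h
  exact ((Matrix.entryLinearMap ℝ ℝ i j).toContinuousLinearMap.hasFDerivAt.comp_hasDerivAt 0 h)

theorem exp_smul_eq_sq (A : Matrix (Fin 3) (Fin 3) ℝ) (t : ℝ) :
    NormedSpace.exp (t • A) = NormedSpace.exp ((t / 2) • A) * NormedSpace.exp ((t / 2) • A) := by
  rw [← Matrix.exp_add_of_commute _ _ (Commute.refl _), ← add_smul, add_halves]

end Exp

/-- A one-parameter group of involutions is trivial, since exp(tA) is the square of exp(tA/2);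
differentiating at 0 then gives A = 0. -/
theorem groupDim_eq_zero {G : Subgroup (Matrix (Fin 3) (Fin 3) ℝ)ˣ}
    (hG : ∀ X ∈ G, X.val * X.val = 1) : groupDim G = 0 := by
  have : {A : Matrix (Fin 3) (Fin 3) ℝ | ∀ t : ℝ, ∃ X ∈ G, X.val = NormedSpace.exp (t • A)}
      ⊆ {0} := by
    intro A hA
    ext i j
    have h : ∀ t : ℝ, NormedSpace.exp (t • A) = 1 := by
      intro t
      obtain ⟨X, hX, hX'⟩ := hA (t / 2)
      rw [exp_smul_eq_sq, ← hX', hG X hX]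
    have h1 := hasDerivAt_exp_smul_entry A i j
    simp only [h] at h1
    exact h1.unique (hasDerivAt_const _ _)
  rw [groupDim, Submodule.span_eq_bot.2 (fun x hx => this hx), finrank_bot]

/-- The boost with rapidity `t`. -/
def boost (t : ℝ) : (Matrix (Fin 3) (Fin 3) ℝ)ˣ where
  val := Matrix.diagonal ![Real.exp t, 1, Real.exp (-t)]
  inv := Matrix.diagonal ![Real.exp (-t), 1, Real.exp t]
  val_inv := by
    rw [Matrix.diagonal_mul_diagonal, ← Matrix.diagonal_one]
    congr 1
    funext i
    fin_cases i <;> simp [← Real.exp_add]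
  inv_val := by
    rw [Matrix.diagonal_mul_diagonal, ← Matrix.diagonal_one]
    congr 1
    funext i
    fin_cases i <;> simp [← Real.exp_add]

theorem boost_inv_val (t : ℝ) :
    ((boost t)⁻¹).val = Matrix.diagonal ![Real.exp (-t), 1, Real.exp t] := rfl

theorem boost_val (t : ℝ) :
    (boost t).val = Matrix.diagonal ![Real.exp t, 1, Real.exp (-t)] := rfl

theorem exp_smul_boostGen (t : ℝ) : NormedSpace.exp (t • boostGen) = (boost t).val := by
  rw [boostGen, ← Matrix.diagonal_smul, Matrix.exp_diagonal, boost_val]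
  congr 1
  funext i
  rw [Pi.coe_exp]
  fin_cases i <;> simp [Real.exp_eq_exp_ℝ]

theorem boost_mem_lorentzGroup (t : ℝ) : boost t ∈ lorentzGroup := by
  rw [mem_lorentzGroup, boost_val]
  ext i j
  fin_cases i <;> fin_cases j <;>
    simp [eta, Matrix.mul_apply, Fin.sum_univ_three, ← Real.exp_add]

theorem actTensor_boost_curvZero (T C t : ℝ) :
    actTensor (boost t) (curvZero T C) = curvZero T C := by
  have h1 := mem_lorentzGroup.1 (inv_mem (boost_mem_lorentzGroup t))
  have h2 : ((boost t)⁻¹).val.transpose * bivec * ((boost t)⁻¹).val = bivec := by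
    rw [boost_inv_val]
    ext i j
    fin_cases i <;> fin_cases j <;>
      simp [bivec, Matrix.mul_apply, Fin.sum_univ_three, ← Real.exp_add]
  funext a
  simp only [actTensor]
  rw [sum_curvZero_mul_prod, h1, h2]
  rfl

/-- The Lie algebra is exactly the line of the boost generator: differentiating at t = 0 the
relations of `entries_of_fixes_curvZero` along exp(tA) leaves only A = A₀₀ · diag(1,0,-1), and
conversely every boost fixes the curvature. -/
theorem groupDim_isotropy_zero {T C : ℝ} (hTC : C + 2 * T ^ 2 ≠ 0) {R : CurvSpace 0}
    (hR : R 0 = curvZero T C) : groupDim (isotropy R) = 1 := by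
  have hset : Submodule.span ℝ {A : Matrix (Fin 3) (Fin 3) ℝ |
      ∀ t : ℝ, ∃ X ∈ isotropy R, X.val = NormedSpace.exp (t • A)} = ℝ ∙ boostGen := by
    apply le_antisymm
    · rw [Submodule.span_le]
      intro A hA
      rw [SetLike.mem_coe, Submodule.mem_span_singleton]
      have key : ∀ t : ℝ, ∀ Y : Matrix (Fin 3) (Fin 3) ℝ, Y = NormedSpace.exp (t • A) →
          Y 0 1 = 0 ∧ Y 2 1 = 0 ∧ Y 1 0 = 0 ∧ Y 1 2 = 0 ∧ Y 1 1 * Y 1 1 = 1 ∧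
          Y 0 0 * Y 2 0 = 0 ∧ Y 0 2 * Y 2 2 = 0 ∧ Y 0 0 * Y 2 2 + Y 0 2 * Y 2 0 = 1 := by
        intro t Y hY
        obtain ⟨X, hX, hX'⟩ := hA t
        obtain ⟨h1, h2⟩ := mem_isotropy.1 (inv_mem hX)
        have h3 : actTensor X⁻¹ (curvZero T C) = curvZero T C := by
          rw [← hR]
          exact congrFun h2 0
        exact entries_of_fixes_curvZero hTC h1 h3 Y (by rw [hY, ← hX', inv_inv])
      have d := hasDerivAt_exp_smul_entry A
      have z : ∀ {f : ℝ → ℝ} {c f' : ℝ}, (∀ t, f t = c) → HasDerivAt f f' 0 → f' = 0 := by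
        intro f c f' hf hd
        rw [funext hf] at hd
        exact hd.unique (hasDerivAt_const _ _)
      have a01 := z (fun t => (key t _ rfl).1) (d 0 1)
      have a21 := z (fun t => (key t _ rfl).2.1) (d 2 1)
      have a10 := z (fun t => (key t _ rfl).2.2.1) (d 1 0)
      have a12 := z (fun t => (key t _ rfl).2.2.2.1) (d 1 2)
      have a11 := z (fun t => (key t _ rfl).2.2.2.2.1) ((d 1 1).mul (d 1 1))
      have a20 := z (fun t => (key t _ rfl).2.2.2.2.2.1) ((d 0 0).mul (d 2 0))
      have a02 := z (fun t => (key t _ rfl).2.2.2.2.2.2.1) ((d 0 2).mul (d 2 2))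
      have a22 := z (fun t => (key t _ rfl).2.2.2.2.2.2.2)
        (((d 0 0).mul (d 2 2)).add ((d 0 2).mul (d 2 0)))
      simp at a11 a20 a02 a22
      refine ⟨A 0 0, ?_⟩
      ext i j
      fin_cases i <;> fin_cases j <;> simp [boostGen, *]
      linarith
    · rw [Submodule.span_singleton_le_iff_mem]
      refine Submodule.subset_span fun t => ⟨boost t, ?_, (exp_smul_boostGen t).symm⟩
      refine ⟨boost_mem_lorentzGroup t, funext fun k => ?_⟩
      obtain rfl : k = 0 := Fin.fin_one_eq_zero k
      simp only [actCurv]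
      rw [hR]
      exact actTensor_boost_curvZero T C t
  rw [groupDim, hset, finrank_span_singleton]
  intro h
  have := congrFun (congrFun h 0) 0
  simp [boostGen] at this

/-! ### Affine submanifolds -/

/-- An open subset of an affine subspace is an embedded submanifold. -/
theorem isSubmanifold_affine {F : Type*} [NormedAddCommGroup F] [NormedSpace ℝ F]
    (x₀ : F) (L : Submodule ℝ F) {O : Set F} (hO : IsOpen O) :
    IsSubmanifold {x | x - x₀ ∈ L ∧ x ∈ O} := by
  refine ⟨Module.finrank ℝ L, fun x hx => ?_⟩
  refine ⟨(Homeomorph.addRight (-x₀)).toOpenPartialHomeomorph.restrOpen O hO, L, ?_, ?_, ?_,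
    rfl, ?_⟩
  · simpa using hx.2
  · exact (contDiff_id.add contDiff_const).contDiffOn
  · exact (contDiff_id.add contDiff_const).contDiffOn
  · intro y hy
    have hy' : y ∈ O := by simpa using hy
    simp [hy', sub_eq_add_neg]

end Lorentz3

end

/-! ### Local geometry: from coordinate Christoffel symbols to curvature components in the coframe
-/

noncomputable section

namespace Lorentz3

/-! ### Partial derivatives -/

section Calculus

variable {U : Set E3}

theorem differentiableAt_of_smooth {F : Type*} [NormedAddCommGroup F] [NormedSpace ℝ F]
    (hU : IsOpen U) {f : E3 → F} (hf : ContDiffOn ℝ ∞ f U)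
    {y : E3} (hy : y ∈ U) : DifferentiableAt ℝ f y :=
  ((hf.contDiffAt (hU.mem_nhds hy)).differentiableAt (by simp))

theorem contDiffOn_fderiv_apply (hU : IsOpen U) {f : E3 → ℝ} (hf : ContDiffOn ℝ ∞ f U)
    {v : E3 → E3} (hv : ContDiffOn ℝ ∞ v U) :
    ContDiffOn ℝ ∞ (fun y => fderiv ℝ f y (v y)) U :=
  (hf.fderiv_of_isOpen hU (by simp)).clm_apply hv

theorem contDiffOn_pderiv (hU : IsOpen U) {f : E3 → ℝ} (hf : ContDiffOn ℝ ∞ f U) (i : Fin 3) :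
    ContDiffOn ℝ ∞ (pderiv i f) U :=
  contDiffOn_fderiv_apply hU hf contDiffOn_const

theorem pderiv_congr (hU : IsOpen U) {f f' : E3 → ℝ} (h : ∀ z ∈ U, f z = f' z) {y : E3}
    (hy : y ∈ U) (i : Fin 3) : pderiv i f y = pderiv i f' y := by
  have : f =ᶠ[𝓝 y] f' := Filter.eventually_of_mem (hU.mem_nhds hy) h
  rw [pderiv, pderiv, this.fderiv_eq]

theorem pderiv_const (i : Fin 3) (c : ℝ) (y : E3) : pderiv i (fun _ => c) y = 0 := by
  simp [pderiv]

theorem pderiv_add {f f' : E3 → ℝ} {y : E3} (hf : DifferentiableAt ℝ f y)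
    (hf' : DifferentiableAt ℝ f' y) (i : Fin 3) :
    pderiv i (fun z => f z + f' z) y = pderiv i f y + pderiv i f' y := by
  simp only [pderiv]
  rw [fderiv_fun_add hf hf']
  rfl

theorem pderiv_mul {f f' : E3 → ℝ} {y : E3} (hf : DifferentiableAt ℝ f y)
    (hf' : DifferentiableAt ℝ f' y) (i : Fin 3) :
    pderiv i (fun z => f z * f' z) y = pderiv i f y * f' y + f y * pderiv i f' y := by
  simp only [pderiv]
  rw [fderiv_fun_mul hf hf']
  simp
  ring

theorem pderiv_sum {ι : Type*} {s : Finset ι} {f : ι → E3 → ℝ} {y : E3}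
    (hf : ∀ k ∈ s, DifferentiableAt ℝ (f k) y) (i : Fin 3) :
    pderiv i (fun z => ∑ k ∈ s, f k z) y = ∑ k ∈ s, pderiv i (f k) y := by
  simp only [pderiv]
  rw [fderiv_fun_sum hf]
  simp

theorem pderiv_comm (hU : IsOpen U) {f : E3 → ℝ} (hf : ContDiffOn ℝ ∞ f U) {y : E3}
    (hy : y ∈ U) (i j : Fin 3) : pderiv i (pderiv j f) y = pderiv j (pderiv i f) y := by
  have hd : DifferentiableAt ℝ (fderiv ℝ f) y :=
    differentiableAt_of_smooth hU (hf.fderiv_of_isOpen hU (by simp)) hy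
  have h : ∀ i j, pderiv i (pderiv j f) y = fderiv ℝ (fderiv ℝ f) y (coordVec i) (coordVec j) := by
    intro i j
    have : HasFDerivAt (fun z => fderiv ℝ f z (coordVec j))
        ((ContinuousLinearMap.apply ℝ ℝ (coordVec j)).comp (fderiv ℝ (fderiv ℝ f) y)) y :=
      (ContinuousLinearMap.apply ℝ ℝ (coordVec j)).hasFDerivAt.comp y hd.hasFDerivAt
    have h2 : pderiv j f = fun z => fderiv ℝ f z (coordVec j) := rfl
    rw [h2, pderiv, this.fderiv]
    rfl
  rw [h, h]
  have hs : IsSymmSndFDerivAt ℝ f y :=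
    (hf.contDiffAt (hU.mem_nhds hy)).isSymmSndFDerivAt
      (by rw [minSmoothness_of_isRCLikeNormedField]; exact WithTop.coe_le_coe.2 le_top)
  exact hs _ _

/-- Entrywise partial derivatives of a matrix. -/
def mpderiv (i : Fin 3) (A : E3 → Matrix (Fin 3) (Fin 3) ℝ) (y : E3) :
    Matrix (Fin 3) (Fin 3) ℝ := Matrix.of fun a b => pderiv i (fun z => A z a b) y

/-- A matrix of functions that are smooth on `U`. -/
def SmoothMat (U : Set E3) (A : E3 → Matrix (Fin 3) (Fin 3) ℝ) : Prop :=
  ∀ a b, ContDiffOn ℝ ∞ (fun z => A z a b) U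

theorem SmoothMat.add {A B : E3 → Matrix (Fin 3) (Fin 3) ℝ} (hA : SmoothMat U A)
    (hB : SmoothMat U B) : SmoothMat U (fun z => A z + B z) := fun a b => (hA a b).add (hB a b)

theorem SmoothMat.mul {A B : E3 → Matrix (Fin 3) (Fin 3) ℝ} (hA : SmoothMat U A)
    (hB : SmoothMat U B) : SmoothMat U (fun z => A z * B z) := by
  intro a b
  simp only [Matrix.mul_apply]
  exact ContDiffOn.sum fun c _ => (hA a c).mul (hB c b)

theorem SmoothMat.mpderiv (hU : IsOpen U) {A : E3 → Matrix (Fin 3) (Fin 3) ℝ}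
    (hA : SmoothMat U A) (i : Fin 3) : SmoothMat U (mpderiv i A) := fun a b =>
  contDiffOn_pderiv hU (hA a b) i

theorem SmoothMat.det {A : E3 → Matrix (Fin 3) (Fin 3) ℝ}
    (hA : SmoothMat U A) : ContDiffOn ℝ ∞ (fun z => (A z).det) U := by
  simp only [Matrix.det_apply]
  refine ContDiffOn.sum fun σ _ => ?_
  simp only [Units.smul_def, zsmul_eq_mul]
  exact contDiffOn_const.mul (contDiffOn_prod fun i _ => hA _ _)

theorem SmoothMat.inv {A : E3 → Matrix (Fin 3) (Fin 3) ℝ}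
    (hA : SmoothMat U A) (hdet : ∀ y ∈ U, (A y).det ≠ 0) :
    SmoothMat U (fun z => (A z)⁻¹) := by
  intro a b
  simp only [Matrix.inv_def, Matrix.smul_apply, Ring.inverse_eq_inv', smul_eq_mul,
    Matrix.adjugate_apply]
  refine (hA.det.inv hdet).mul (SmoothMat.det (A := fun z => (A z).updateRow b (Pi.single a 1)) ?_)
  intro c d
  by_cases h : c = b
  · subst h
    simp only [Matrix.updateRow_self]
    exact contDiffOn_const
  · simp only [Matrix.updateRow_ne h]
    exact hA c d

theorem SmoothMat.congr {A B : E3 → Matrix (Fin 3) (Fin 3) ℝ} (hA : SmoothMat U A)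
    (h : ∀ z ∈ U, B z = A z) : SmoothMat U B := fun a b =>
  (hA a b).congr fun z hz => by rw [h z hz]

theorem mpderiv_congr (hU : IsOpen U) {A B : E3 → Matrix (Fin 3) (Fin 3) ℝ}
    (h : ∀ z ∈ U, A z = B z) {y : E3} (hy : y ∈ U) (i : Fin 3) :
    mpderiv i A y = mpderiv i B y := by
  ext a b
  exact pderiv_congr hU (fun z hz => by rw [h z hz]) hy i

theorem mpderiv_add (hU : IsOpen U) {A B : E3 → Matrix (Fin 3) (Fin 3) ℝ} (hA : SmoothMat U A)
    (hB : SmoothMat U B) {y : E3} (hy : y ∈ U) (i : Fin 3) :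
    mpderiv i (fun z => A z + B z) y = mpderiv i A y + mpderiv i B y := by
  ext a b
  exact pderiv_add (differentiableAt_of_smooth hU (hA a b) hy)
    (differentiableAt_of_smooth hU (hB a b) hy) i

theorem mpderiv_mul (hU : IsOpen U) {A B : E3 → Matrix (Fin 3) (Fin 3) ℝ} (hA : SmoothMat U A)
    (hB : SmoothMat U B) {y : E3} (hy : y ∈ U) (i : Fin 3) :
    mpderiv i (fun z => A z * B z) y = mpderiv i A y * B y + A y * mpderiv i B y := by
  ext a b
  simp only [mpderiv, Matrix.of_apply, Matrix.mul_apply, Matrix.add_apply]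
  have h : ∀ c, DifferentiableAt ℝ (fun z => A z a c) y := fun c =>
    differentiableAt_of_smooth hU (hA a c) hy
  have h' : ∀ c, DifferentiableAt ℝ (fun z => B z c b) y := fun c =>
    differentiableAt_of_smooth hU (hB c b) hy
  rw [pderiv_sum (f := fun c z => A z a c * B z c b) (fun c _ => (h c).mul (h' c)),
    ← Finset.sum_add_distrib]
  exact Finset.sum_congr rfl fun c _ => pderiv_mul (h c) (h' c) i

theorem mpderiv_comm (hU : IsOpen U) {A : E3 → Matrix (Fin 3) (Fin 3) ℝ} (hA : SmoothMat U A)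
    {y : E3} (hy : y ∈ U) (i j : Fin 3) :
    mpderiv i (mpderiv j A) y = mpderiv j (mpderiv i A) y := by
  ext a b
  exact pderiv_comm hU (hA a b) hy i j

end Calculus

/-! ### Coframes -/

/-- The matrix `θᵃ(∂_j)`. -/
def cofMat (θ : E3 → Fin 3 → E3 →L[ℝ] ℝ) (y : E3) : Matrix (Fin 3) (Fin 3) ℝ :=
  Matrix.of fun a j => θ y a (coordVec j)

/-- The components of `v` in the coframe. -/
def frameCoord (θ : E3 → Fin 3 → E3 →L[ℝ] ℝ) (y : E3) (v : E3) : E3 :=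
  WithLp.toLp 2 fun a => θ y a v

/-- The metric of a coframe, in coordinates. -/
def cofMetric (θ : E3 → Fin 3 → E3 →L[ℝ] ℝ) : CoordMetric := fun y =>
  Matrix.of fun i j => ∑ a, ∑ b, eta a b * θ y a (coordVec i) * θ y b (coordVec j)

theorem cofMetric_eq (θ : E3 → Fin 3 → E3 →L[ℝ] ℝ) (y : E3) :
    cofMetric θ y = (cofMat θ y).transpose * eta * cofMat θ y := by
  ext i j
  simp only [cofMetric, Matrix.mul_apply, Matrix.of_apply, Matrix.transpose_apply, cofMat,
    Finset.sum_mul]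
  rw [Finset.sum_comm]
  refine Finset.sum_congr rfl fun a _ => Finset.sum_congr rfl fun b _ => by ring

theorem sum_smul_coordVec (v : E3) : v = ∑ j, v j • coordVec j := by
  ext i
  fin_cases i <;> simp [coordVec, Fin.sum_univ_three]

theorem clm_apply_eq_sum {F : Type*} [NormedAddCommGroup F] [NormedSpace ℝ F]
    (φ : E3 →L[ℝ] F) (v : E3) : φ v = ∑ j, v j • φ (coordVec j) := by
  conv_lhs => rw [sum_smul_coordVec v]
  simp

theorem det_cofMat_ne_zero {θ : E3 → Fin 3 → E3 →L[ℝ] ℝ} {y : E3}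
    (h : LinearIndependent ℝ (θ y)) : (cofMat θ y).det ≠ 0 := by
  rw [← isUnit_iff_ne_zero, ← Matrix.isUnit_iff_isUnit_det,
    ← Matrix.linearIndependent_rows_iff_isUnit]
  let L : (E3 →L[ℝ] ℝ) →ₗ[ℝ] (Fin 3 → ℝ) :=
    { toFun := fun φ j => φ (coordVec j)
      map_add' := fun _ _ => rfl
      map_smul' := fun _ _ => rfl }
  refine h.map' L (LinearMap.ker_eq_bot.2 fun φ ψ hφ => ?_)
  ext v
  rw [clm_apply_eq_sum φ, clm_apply_eq_sum ψ]
  exact Finset.sum_congr rfl fun j _ => by rw [show φ (coordVec j) = ψ (coordVec j) from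
    congrFun hφ j]

theorem apply_dualFrame {θ : E3 → Fin 3 → E3 →L[ℝ] ℝ} {y : E3}
    (h : LinearIndependent ℝ (θ y)) (a b : Fin 3) :
    θ y a (dualFrame θ y b) = if a = b then 1 else 0 := by
  have h1 := congrFun (congrFun (Matrix.mul_nonsing_inv (cofMat θ y)
    (isUnit_iff_ne_zero.2 (det_cofMat_ne_zero h))) a) b
  rw [Matrix.mul_apply, Matrix.one_apply] at h1
  rw [clm_apply_eq_sum, ← h1]
  exact Finset.sum_congr rfl fun j _ => mul_comm _ _

theorem sum_apply_smul_dualFrame {θ : E3 → Fin 3 → E3 →L[ℝ] ℝ} {y : E3}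
    (h : LinearIndependent ℝ (θ y)) (v : E3) : ∑ b, θ y b v • dualFrame θ y b = v := by
  have h1 := Matrix.nonsing_inv_mul (cofMat θ y) (isUnit_iff_ne_zero.2 (det_cofMat_ne_zero h))
  have h2 : ∀ j, ∑ b, θ y b (coordVec j) • dualFrame θ y b = coordVec j := by
    intro j
    ext i
    have h3 := congrFun (congrFun h1 i) j
    rw [Matrix.mul_apply, Matrix.one_apply] at h3
    rw [WithLp.ofLp_sum, Finset.sum_apply]
    have h4 : coordVec j i = if i = j then 1 else 0 := by simp [coordVec]
    rw [h4, ← h3]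
    exact Finset.sum_congr rfl fun b _ => mul_comm _ _
  conv_rhs => rw [sum_smul_coordVec v]
  rw [Finset.sum_congr rfl fun j _ => congrArg (v j • ·) (h2 j).symm]
  simp only [Finset.smul_sum, smul_smul]
  rw [Finset.sum_comm]
  refine Finset.sum_congr rfl fun b _ => ?_
  rw [← Finset.sum_smul, clm_apply_eq_sum]
  rfl

theorem SolvesStructureEqs.smoothMat {T C : ℝ} {U : Set E3} {θ : E3 → Fin 3 → E3 →L[ℝ] ℝ}
    {ε : E3 → ℝ} (h : SolvesStructureEqs T C U θ ε) : SmoothMat U (cofMat θ) := fun a _ =>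
  ((contDiffOn_pi.1 h.smooth_coframe a).clm_apply contDiffOn_const)

theorem SolvesStructureEqs.det_ne_zero {T C : ℝ} {U : Set E3} {θ : E3 → Fin 3 → E3 →L[ℝ] ℝ}
    {ε : E3 → ℝ} (h : SolvesStructureEqs T C U θ ε) :
    ∀ y ∈ U, (cofMat θ y).det ≠ 0 := fun y hy => det_cofMat_ne_zero (h.coframe y hy)

theorem SolvesStructureEqs.contDiffOn_dualFrame {T C : ℝ} {U : Set E3}
    {θ : E3 → Fin 3 → E3 →L[ℝ] ℝ} {ε : E3 → ℝ} (h : SolvesStructureEqs T C U θ ε) (b : Fin 3) :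
    ContDiffOn ℝ ∞ (fun y => dualFrame θ y b) U := by
  rw [contDiffOn_euclidean]
  intro i
  exact h.smoothMat.inv h.det_ne_zero i b

theorem fderiv_coframe_apply {U : Set E3} (hU : IsOpen U) {θ : E3 → Fin 3 → E3 →L[ℝ] ℝ}
    (hθ : ContDiffOn ℝ ∞ θ U) {y : E3} (hy : y ∈ U) (a i j : Fin 3) :
    fderiv ℝ (fun z => θ z a) y (coordVec i) (coordVec j) =
      pderiv i (fun z => cofMat θ z a j) y := by
  have hd : DifferentiableAt ℝ (fun z => θ z a) y :=
    differentiableAt_of_smooth hU (contDiffOn_pi.1 hθ a) hy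
  have : HasFDerivAt (fun z => θ z a (coordVec j))
      ((ContinuousLinearMap.apply ℝ ℝ (coordVec j)).comp (fderiv ℝ (fun z => θ z a) y)) y :=
    (ContinuousLinearMap.apply ℝ ℝ (coordVec j)).hasFDerivAt.comp y hd.hasFDerivAt
  simp only [pderiv, cofMat, Matrix.of_apply]
  rw [this.fderiv]
  rfl

end Lorentz3

end

noncomputable section

namespace Lorentz3

/-! ### The Levi-Civita connection in a coframe -/

/-- The matrix of connection forms, evaluated on the `i`-th coordinate vector. -/
def connForm (T : ℝ) (θ : E3 → Fin 3 → E3 →L[ℝ] ℝ) (ε : E3 → ℝ) (i : Fin 3) (y : E3) :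
    Matrix (Fin 3) (Fin 3) ℝ := ∑ c, cofMat θ y c i • conn T (ε y) c

theorem connForm_eq (T : ℝ) (θ : E3 → Fin 3 → E3 →L[ℝ] ℝ) (ε : E3 → ℝ) (i : Fin 3) (y : E3) :
    connForm T θ ε i y = !![2 * ε y * cofMat θ y 0 i, T * cofMat θ y 0 i, 0;
      -2 * cofMat θ y 0 i - 2 * T * cofMat θ y 2 i, 0, 2 * T * cofMat θ y 0 i;
      0, -cofMat θ y 0 i - T * cofMat θ y 2 i, -2 * ε y * cofMat θ y 0 i] := by
  ext a b
  fin_cases a <;> fin_cases b <;>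
    simp [connForm, conn, Fin.sum_univ_three, Matrix.add_apply] <;> ring

/-- The Christoffel symbols `Γᵏ_{ij}` as matrices with indices `k, j`. -/
def chrMat (g : CoordMetric) (i : Fin 3) (y : E3) : Matrix (Fin 3) (Fin 3) ℝ :=
  Matrix.of fun k j => christoffel g k i j y

/-- The matrix of curvature forms in a coframe, evaluated on the coordinate vectors `i, j`. -/
def curvForm (T C : ℝ) (A : Matrix (Fin 3) (Fin 3) ℝ) (i j : Fin 3) : Matrix (Fin 3) (Fin 3) ℝ :=
  !![-2 * (C + T ^ 2) * (A 0 i * A 2 j - A 2 i * A 0 j),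
      -T ^ 2 * (A 0 i * A 1 j - A 1 i * A 0 j), 0;
    2 * T ^ 2 * (A 1 i * A 2 j - A 2 i * A 1 j), 0,
      -2 * T ^ 2 * (A 0 i * A 1 j - A 1 i * A 0 j);
    0, T ^ 2 * (A 1 i * A 2 j - A 2 i * A 1 j),
      2 * (C + T ^ 2) * (A 0 i * A 2 j - A 2 i * A 0 j)]

section

variable {T C : ℝ} {U : Set E3} {θ : E3 → Fin 3 → E3 →L[ℝ] ℝ} {ε : E3 → ℝ}

theorem SolvesStructureEqs.d_omega_coord (hU : IsOpen U) (h : SolvesStructureEqs T C U θ ε)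
    {y : E3} (hy : y ∈ U) (i j : Fin 3) :
    mpderiv i (cofMat θ) y 0 j - mpderiv j (cofMat θ) y 0 i =
      -T * (cofMat θ y 0 i * cofMat θ y 1 j - cofMat θ y 0 j * cofMat θ y 1 i) ∧
    mpderiv i (cofMat θ) y 1 j - mpderiv j (cofMat θ) y 1 i =
      -4 * T * (cofMat θ y 0 i * cofMat θ y 2 j - cofMat θ y 0 j * cofMat θ y 2 i) ∧
    mpderiv i (cofMat θ) y 2 j - mpderiv j (cofMat θ) y 2 i =
      (cofMat θ y 0 i * cofMat θ y 1 j - cofMat θ y 0 j * cofMat θ y 1 i)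
      + 2 * ε y * (cofMat θ y 0 i * cofMat θ y 2 j - cofMat θ y 0 j * cofMat θ y 2 i)
      - T * (cofMat θ y 1 i * cofMat θ y 2 j - cofMat θ y 1 j * cofMat θ y 2 i) := by
  have h0 := h.d_omega0 y hy (coordVec i) (coordVec j)
  have h1 := h.d_omega1 y hy (coordVec i) (coordVec j)
  have h2 := h.d_omega2 y hy (coordVec i) (coordVec j)
  simp only [dForm, fderiv_coframe_apply hU h.smooth_coframe hy] at h0 h1 h2
  exact ⟨h0, h1, h2⟩

/-- The connection is torsion-free. -/
theorem SolvesStructureEqs.torsion_free (hU : IsOpen U) (h : SolvesStructureEqs T C U θ ε)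
    {y : E3} (hy : y ∈ U) (a i j : Fin 3) :
    (connForm T θ ε i y * cofMat θ y + mpderiv i (cofMat θ) y) a j =
      (connForm T θ ε j y * cofMat θ y + mpderiv j (cofMat θ) y) a i := by
  obtain ⟨h0, h1, h2⟩ := h.d_omega_coord hU hy i j
  rw [connForm_eq, connForm_eq, Matrix.add_apply, Matrix.add_apply, Matrix.mul_apply,
    Matrix.mul_apply, Fin.sum_univ_three, Fin.sum_univ_three]
  fin_cases a <;> simp
  · linear_combination h0
  · linear_combination h1
  · linear_combination h2

/-- Metric compatibility: the product rule on ΘᵗηΘ gives the terms with ∂Θ, and the connection terms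
may be inserted freely because the connection form is η-skew. In this form the derivative of the
metric is expressed by the matrices that `torsion_free` shows to be symmetric. -/
theorem SolvesStructureEqs.pderiv_metric (hU : IsOpen U) (h : SolvesStructureEqs T C U θ ε)
    {y : E3} (hy : y ∈ U) (i j l : Fin 3) :
    pderiv l (fun z => cofMetric θ z i j) y =
      ((cofMat θ y).transpose * eta *
        (connForm T θ ε l y * cofMat θ y + mpderiv l (cofMat θ) y)) j i +
      ((cofMat θ y).transpose * eta *
        (connForm T θ ε l y * cofMat θ y + mpderiv l (cofMat θ) y)) i j := by
  have hd : ∀ a b, DifferentiableAt ℝ (fun z => cofMat θ z a b) y := fun a b =>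
    differentiableAt_of_smooth hU (h.smoothMat a b) hy
  have h1 : ∀ a b, pderiv l (fun z => eta a b * cofMat θ z a i * cofMat θ z b j) y =
      eta a b * (pderiv l (fun z => cofMat θ z a i) y * cofMat θ y b j +
        cofMat θ y a i * pderiv l (fun z => cofMat θ z b j) y) := by
    intro a b
    rw [pderiv_mul ((hd a i).const_mul _) (hd b j), pderiv_mul (differentiableAt_const _) (hd a i),
      pderiv_const]
    ring
  have h2 : (fun z => cofMetric θ z i j) =
      fun z => ∑ a, ∑ b, eta a b * cofMat θ z a i * cofMat θ z b j := rfl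
  rw [h2, pderiv_sum (f := fun a z => ∑ b, eta a b * cofMat θ z a i * cofMat θ z b j)
    fun a _ => DifferentiableAt.fun_sum fun b _ => ((hd a i).const_mul _).mul (hd b j)]
  have h3 : ∀ a, pderiv l (fun z => ∑ b, eta a b * cofMat θ z a i * cofMat θ z b j) y =
      ∑ b, eta a b * (pderiv l (fun z => cofMat θ z a i) y * cofMat θ y b j +
        cofMat θ y a i * pderiv l (fun z => cofMat θ z b j) y) := by
    intro a
    rw [pderiv_sum (f := fun b z => eta a b * cofMat θ z a i * cofMat θ z b j)
      fun b _ => ((hd a i).const_mul _).mul (hd b j)]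
    exact Finset.sum_congr rfl fun b _ => h1 a b
  rw [Finset.sum_congr rfl fun a _ => h3 a, connForm_eq]
  simp only [Matrix.mul_apply, Fin.sum_univ_three, Matrix.add_apply, mpderiv, Matrix.of_apply,
    Matrix.transpose_apply]
  simp [eta]
  ring

/-- The gauge transformation Γ = Θ⁻¹WΘ + Θ⁻¹∂Θ. The right-hand side is torsion-free and metric, so
it is the Levi-Civita connection; concretely, the Koszul combination of the ∂g collapses by
symmetry. -/
theorem SolvesStructureEqs.cofMat_mul_chrMat (hU : IsOpen U) (h : SolvesStructureEqs T C U θ ε)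
    {y : E3} (hy : y ∈ U) (i : Fin 3) :
    cofMat θ y * chrMat (cofMetric θ) i y =
      connForm T θ ε i y * cofMat θ y + mpderiv i (cofMat θ) y := by
  have hdet := h.det_ne_zero y hy
  set V : Fin 3 → Matrix (Fin 3) (Fin 3) ℝ :=
    fun i => connForm T θ ε i y * cofMat θ y + mpderiv i (cofMat θ) y with hV
  have hsymm : ∀ a i j, V i a j = V j a i := fun a i j => h.torsion_free hU hy a i j
  set A := (cofMat θ y).transpose * eta with hA
  have hsymm' : ∀ a i j, (A * V i) a j = (A * V j) a i := by
    intro a i j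
    simp only [Matrix.mul_apply]
    exact Finset.sum_congr rfl fun k _ => by rw [hsymm]
  have h1 : chrMat (cofMetric θ) i y = (cofMetric θ y)⁻¹ * (A * V i) := by
    ext k j
    simp only [chrMat, christoffel, Matrix.of_apply]
    rw [Matrix.mul_apply, Finset.mul_sum]
    refine Finset.sum_congr rfl fun l _ => ?_
    rw [h.pderiv_metric hU hy, h.pderiv_metric hU hy, h.pderiv_metric hU hy]
    change _ * (_ * ((A * V i) l j + (A * V i) j l + ((A * V j) l i + (A * V j) i l) -
      ((A * V l) j i + (A * V l) i j))) = _
    -- After these exchanges four of the six terms cancel and the other two coincide, which absorbs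
    -- the factor 1/2.
    rw [hsymm' l j i, hsymm' i j l, hsymm' j i l]
    ring
  have h2 : cofMetric θ y = A * cofMat θ y := cofMetric_eq θ y
  have hAdet : IsUnit A.det := by
    rw [hA, Matrix.det_mul, Matrix.det_transpose, isUnit_iff_ne_zero]
    have : eta.det ≠ 0 := by simp [eta, Matrix.det_fin_three]
    positivity
  rw [h1, h2, Matrix.mul_inv_rev, Matrix.mul_assoc, ← Matrix.mul_assoc A⁻¹,
    Matrix.nonsing_inv_mul _ hAdet, Matrix.one_mul, ← Matrix.mul_assoc,
    Matrix.mul_nonsing_inv _ (isUnit_iff_ne_zero.2 hdet), Matrix.one_mul]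

theorem SolvesStructureEqs.smoothMat_connForm (h : SolvesStructureEqs T C U θ ε) (i : Fin 3) :
    SmoothMat U (connForm T θ ε i) := by
  have h0 := h.smoothMat 0 i
  have h2 := h.smoothMat 2 i
  have he := h.smooth_epsilon
  intro a b
  simp only [connForm_eq]
  fin_cases a <;> fin_cases b <;> simp <;> fun_prop

theorem SolvesStructureEqs.smoothMat_chrMat (hU : IsOpen U) (h : SolvesStructureEqs T C U θ ε)
    (i : Fin 3) : SmoothMat U (chrMat (cofMetric θ) i) := by
  have h1 := (h.smoothMat.inv h.det_ne_zero).mul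
    (((h.smoothMat_connForm i).mul h.smoothMat).add (h.smoothMat.mpderiv hU i))
  refine h1.congr fun z hz => ?_
  rw [← h.cofMat_mul_chrMat hU hz, ← Matrix.mul_assoc,
    Matrix.nonsing_inv_mul _ (isUnit_iff_ne_zero.2 (h.det_ne_zero z hz)), Matrix.one_mul]

/-- The derivatives of `ε` in coordinates. -/
theorem SolvesStructureEqs.pderiv_epsilon (h : SolvesStructureEqs T C U θ ε) {y : E3}
    (hy : y ∈ U) (i : Fin 3) :
    pderiv i ε y = opD θ ε y * cofMat θ y 0 i - T * ε y * cofMat θ y 1 i + C * cofMat θ y 2 i := by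
  rw [pderiv, h.d_epsilon y hy]
  simp [cofMat]

/-- Cartan's second structure equation. In d(2εω⁰) the coefficient Dε drops out because ω⁰∧ω⁰ = 0,
the term -Tε of dε cancels against 2ε dω⁰, and C survives; in the remaining entries the terms with ε
cancel between dω² and W∧W. -/
theorem SolvesStructureEqs.curvForm_eq (hU : IsOpen U) (h : SolvesStructureEqs T C U θ ε)
    {y : E3} (hy : y ∈ U) (i j : Fin 3) :
    mpderiv i (connForm T θ ε j) y - mpderiv j (connForm T θ ε i) y +
      (connForm T θ ε i y * connForm T θ ε j y - connForm T θ ε j y * connForm T θ ε i y) =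
      curvForm T C (cofMat θ y) i j := by
  obtain ⟨h0, h1, h2⟩ := h.d_omega_coord hU hy i j
  have hei := h.pderiv_epsilon hy i
  have hej := h.pderiv_epsilon hy j
  have hd : ∀ a b, DifferentiableAt ℝ (fun z => cofMat θ z a b) y := fun a b =>
    differentiableAt_of_smooth hU (h.smoothMat a b) hy
  have he : DifferentiableAt ℝ ε y := differentiableAt_of_smooth hU h.smooth_epsilon hy
  have c1 : ∀ (c : ℝ) (a l k : Fin 3), pderiv k (fun z => c * cofMat θ z a l) y =
      c * pderiv k (fun z => cofMat θ z a l) y := by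
    intro c a l k
    rw [pderiv_mul (differentiableAt_const _) (hd a l), pderiv_const]
    ring
  have c2 : ∀ (c : ℝ) (a l k : Fin 3), pderiv k (fun z => c * ε z * cofMat θ z a l) y =
      c * (pderiv k ε y * cofMat θ y a l + ε y * pderiv k (fun z => cofMat θ z a l) y) := by
    intro c a l k
    rw [pderiv_mul (he.const_mul _) (hd a l), pderiv_mul (differentiableAt_const _) he,
      pderiv_const]
    ring
  have c3 : ∀ (c c' : ℝ) (l k : Fin 3),
      pderiv k (fun z => c * cofMat θ z 0 l - c' * cofMat θ z 2 l) y =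
      c * pderiv k (fun z => cofMat θ z 0 l) y - c' * pderiv k (fun z => cofMat θ z 2 l) y := by
    intro c c' l k
    have e : (fun z => c * cofMat θ z 0 l - c' * cofMat θ z 2 l) =
      fun z => c * cofMat θ z 0 l + (-c') * cofMat θ z 2 l := by funext z; ring
    rw [e, pderiv_add ((hd 0 l).const_mul _) ((hd 2 l).const_mul _), c1, c1]
    ring
  have c4 : ∀ (l k : Fin 3),
      pderiv k (fun z => -cofMat θ z 0 l - T * cofMat θ z 2 l) y =
      -pderiv k (fun z => cofMat θ z 0 l) y - T * pderiv k (fun z => cofMat θ z 2 l) y := by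
    intro l k
    have e : (fun z => -cofMat θ z 0 l - T * cofMat θ z 2 l) =
      fun z => (-1) * cofMat θ z 0 l - T * cofMat θ z 2 l := by funext z; ring
    rw [e, c3]
    ring
  simp only [mpderiv, Matrix.of_apply] at h0 h1 h2
  ext a b
  simp only [mpderiv, Matrix.of_apply, Matrix.add_apply, Matrix.sub_apply, connForm_eq, curvForm]
  fin_cases a <;> fin_cases b <;>
    simp only [Matrix.of_apply, Matrix.cons_val', Matrix.cons_val_zero, Matrix.cons_val_one,
      Matrix.cons_val, Matrix.mul_apply, Fin.sum_univ_three, pderiv_const, c1, c2, c3, c4,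
      hei, hej, Fin.zero_eta, Fin.mk_one, Fin.reduceFinMk, Matrix.cons_val_fin_one]
  · linear_combination 2 * ε y * h0
  · linear_combination T * h0
  · ring
  · linear_combination -2 * h0 - 2 * T * h2
  · ring
  · linear_combination 2 * T * h0
  · ring
  · linear_combination -h0 - T * h2
  · linear_combination -2 * ε y * h0

/-- The coordinate components of the curvature, as matrices. -/
theorem SolvesStructureEqs.cofMat_mul_riemannUp (hU : IsOpen U)
    (h : SolvesStructureEqs T C U θ ε) {y : E3} (hy : y ∈ U) (i j : Fin 3) :
    cofMat θ y * (Matrix.of fun k l => riemannUp (cofMetric θ) k l i j y) =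
      curvForm T C (cofMat θ y) i j * cofMat θ y := by
  rw [← h.curvForm_eq hU hy]
  have hR : (Matrix.of fun k l => riemannUp (cofMetric θ) k l i j y) =
      mpderiv i (chrMat (cofMetric θ) j) y - mpderiv j (chrMat (cofMetric θ) i) y +
      (chrMat (cofMetric θ) i y * chrMat (cofMetric θ) j y -
        chrMat (cofMetric θ) j y * chrMat (cofMetric θ) i y) := by
    ext k l
    simp only [riemannUp, Matrix.of_apply, mpderiv, Matrix.add_apply, Matrix.sub_apply,
      Matrix.mul_apply, chrMat, Finset.sum_sub_distrib]
  have hΘ := h.smoothMat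
  have hΓ := h.smoothMat_chrMat hU
  have hW := h.smoothMat_connForm
  -- The derivative of the gauge relation. On antisymmetrizing in i, j the second derivatives of Θ
  -- cancel, which leaves the covariant transformation law of the curvature.
  have key : ∀ i j, mpderiv i (cofMat θ) y * chrMat (cofMetric θ) j y +
      cofMat θ y * mpderiv i (chrMat (cofMetric θ) j) y =
      mpderiv i (connForm T θ ε j) y * cofMat θ y +
        connForm T θ ε j y * mpderiv i (cofMat θ) y + mpderiv i (mpderiv j (cofMat θ)) y := by
    intro i j
    rw [← mpderiv_mul hU hΘ (hΓ j) hy, ← mpderiv_mul hU (hW j) hΘ hy,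
      ← mpderiv_add hU ((hW j).mul hΘ) (hΘ.mpderiv hU j) hy]
    exact mpderiv_congr hU (fun z hz => h.cofMat_mul_chrMat hU hz j) hy i
  have k1 := key i j
  have k2 := key j i
  rw [mpderiv_comm hU hΘ hy j i] at k2
  have e1 := h.cofMat_mul_chrMat hU hy i
  have e2 := h.cofMat_mul_chrMat hU hy j
  rw [hR]
  -- What remains is an identity in the noncommutative ring of matrices.
  generalize cofMat θ y = Θ at *
  generalize chrMat (cofMetric θ) i y = Γi at *
  generalize chrMat (cofMetric θ) j y = Γj at *
  generalize mpderiv i (chrMat (cofMetric θ) j) y = Γij at *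
  generalize mpderiv j (chrMat (cofMetric θ) i) y = Γji at *
  generalize mpderiv i (mpderiv j (cofMat θ)) y = Θij at *
  generalize mpderiv i (cofMat θ) y = Θi at *
  generalize mpderiv j (cofMat θ) y = Θj at *
  generalize connForm T θ ε i y = Wi at *
  generalize connForm T θ ε j y = Wj at *
  generalize mpderiv i (connForm T θ ε j) y = Wij at *
  generalize mpderiv j (connForm T θ ε i) y = Wji at *
  have k1' : Θ * Γij = Wij * Θ + Wj * Θi + Θij - Θi * Γj := by rw [← k1]; abel
  have k2' : Θ * Γji = Wji * Θ + Wi * Θj + Θij - Θj * Γi := by rw [← k2]; abel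
  have e3 : Θ * (Γi * Γj) = Wi * (Wj * Θ + Θj) + Θi * Γj := by
    rw [← Matrix.mul_assoc, e1, Matrix.add_mul, Matrix.mul_assoc, e2]
  have e4 : Θ * (Γj * Γi) = Wj * (Wi * Θ + Θi) + Θj * Γi := by
    rw [← Matrix.mul_assoc, e2, Matrix.add_mul, Matrix.mul_assoc, e1]
  rw [Matrix.mul_add, Matrix.mul_sub, Matrix.mul_sub, k1', k2', e3, e4]
  noncomm_ring

/-- The curvature has constant components in the frame. -/
theorem SolvesStructureEqs.riemann_eq (hU : IsOpen U)
    (h : SolvesStructureEqs T C U θ ε) {y : E3} (hy : y ∈ U) :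
    riemann (cofMetric θ) y =
      frameComp (curvZero T C) (fun i => frameCoord θ y (coordVec i)) := by
  funext a
  have h1 : riemann (cofMetric θ) y a = (cofMetric θ y *
      (Matrix.of fun k l => riemannUp (cofMetric θ) k l (a 2) (a 3) y)) (a 0) (a 1) := by
    simp only [riemann, Matrix.mul_apply, Matrix.of_apply]
  rw [h1, cofMetric_eq, Matrix.mul_assoc, h.cofMat_mul_riemannUp hU hy]
  have h2 : frameComp (curvZero T C) (fun i => frameCoord θ y (coordVec i)) a =
    ∑ b : Fin 4 → Fin 3, curvZero T C b * ∏ s, cofMat θ y (b s) (a s) := rfl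
  rw [h2, sum_curvZero_mul_prod]
  simp only [Matrix.mul_apply, Fin.sum_univ_three, Matrix.transpose_apply]
  simp [curvForm, eta, bivec]
  ring

end

end Lorentz3

end

noncomputable section

namespace Lorentz3

/-! ### Covariant derivatives in a coframe -/

/-- The covariant derivative, in terms of components with respect to the coframe. -/
def frameDeriv (T : ℝ) (θ : E3 → Fin 3 → E3 →L[ℝ] ℝ) (ε : E3 → ℝ) {m : ℕ} (S : E3 → Tensor m)
    (y : E3) : Tensor (m + 1) := fun a =>
  fderiv ℝ (fun z => S z (Fin.init a)) y (dualFrame θ y (a (Fin.last m)))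
    - derAct (conn T (ε y) (a (Fin.last m))) (S y) (Fin.init a)

/-- The components of the `k`-th derivative of the curvature with respect to the coframe. -/
def frameCurv (T C : ℝ) (θ : E3 → Fin 3 → E3 →L[ℝ] ℝ) (ε : E3 → ℝ) :
    (k : ℕ) → E3 → Tensor (4 + k)
  | 0 => fun _ => curvZero T C
  | k + 1 => frameDeriv T θ ε (frameCurv T C θ ε k)

theorem sum_fin_succ_fun {m : ℕ} (F : (Fin (m + 1) → Fin 3) → ℝ) :
    ∑ b, F b = ∑ b' : Fin m → Fin 3, ∑ c, F (Fin.snoc b' c) := by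
  rw [Finset.sum_comm, ← (Fin.snocEquiv fun _ : Fin (m + 1) => Fin 3).sum_comp,
    Fintype.sum_prod_type]
  rfl

theorem derAct_sum_smul {m : ℕ} {ι : Type*} (s : Finset ι) (c : ι → ℝ)
    (A : ι → Matrix (Fin 3) (Fin 3) ℝ) (S : Tensor m) (a : Fin m → Fin 3) :
    derAct (∑ i ∈ s, c i • A i) S a = ∑ i ∈ s, c i * derAct (A i) S a := by
  classical
  induction s using Finset.induction_on with
  | empty => simp [derAct]
  | insert i s hi ih =>
    rw [Finset.sum_insert hi, Finset.sum_insert hi, derAct_add_matrix, derAct_smul_matrix,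
      Pi.add_apply, ih]
    rfl

section

variable {T C : ℝ} {U : Set E3} {θ : E3 → Fin 3 → E3 →L[ℝ] ℝ} {ε : E3 → ℝ}

theorem pderiv_frameComp (hU : IsOpen U) (h : SolvesStructureEqs T C U θ ε) {m : ℕ}
    {S : E3 → Tensor m} (hS : ∀ a, ContDiffOn ℝ ∞ (fun z => S z a) U) {y : E3} (hy : y ∈ U)
    (l : Fin 3) (i : Fin m → Fin 3) :
    pderiv l (fun z => frameComp (S z) (fun j => frameCoord θ z (coordVec j)) i) y =
      ∑ b : Fin m → Fin 3, (pderiv l (fun z => S z b) y * ∏ s, cofMat θ y (b s) (i s) +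
        S y b * ∑ s, mpderiv l (cofMat θ) y (b s) (i s) *
          ∏ t ∈ Finset.univ.erase s, cofMat θ y (b t) (i t)) := by
  have hd : ∀ a b, DifferentiableAt ℝ (fun z => cofMat θ z a b) y := fun a b =>
    differentiableAt_of_smooth hU (h.smoothMat a b) hy
  have hSd : ∀ a, DifferentiableAt ℝ (fun z => S z a) y := fun a =>
    differentiableAt_of_smooth hU (hS a) hy
  have hp : ∀ b : Fin m → Fin 3, HasFDerivAt (fun z => ∏ s, cofMat θ z (b s) (i s))
      (∑ s, (∏ t ∈ Finset.univ.erase s, cofMat θ y (b t) (i t)) •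
        fderiv ℝ (fun z => cofMat θ z (b s) (i s)) y) y := fun b =>
    HasFDerivAt.finsetProd fun s _ => (hd (b s) (i s)).hasFDerivAt
  change pderiv l (fun z => ∑ b : Fin m → Fin 3, S z b * ∏ s, cofMat θ z (b s) (i s)) y = _
  rw [pderiv_sum (f := fun b z => S z b * ∏ s, cofMat θ z (b s) (i s))
    fun b _ => (hSd b).mul (hp b).differentiableAt]
  refine Finset.sum_congr rfl fun b _ => ?_
  rw [pderiv_mul (hSd b) (hp b).differentiableAt]
  congr 2
  rw [pderiv, (hp b).fderiv]
  simp only [_root_.sum_apply, _root_.smul_apply, smul_eq_mul]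
  exact Finset.sum_congr rfl fun s _ => mul_comm _ _

/-- Differentiating S in terms of coframe components produces ∂Θ in every slot; by
`cofMat_mul_chrMat` the Christoffel correction contains the same terms, and only the connection
matrices are left. -/
theorem SolvesStructureEqs.covDeriv_eq (hU : IsOpen U) (h : SolvesStructureEqs T C U θ ε) {m : ℕ}
    {S : E3 → Tensor m} (hS : ∀ a, ContDiffOn ℝ ∞ (fun z => S z a) U) {R : E3 → Tensor m}
    (hR : ∀ z ∈ U, R z = frameComp (S z) (fun j => frameCoord θ z (coordVec j)))
    {y : E3} (hy : y ∈ U) :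
    covDeriv (cofMetric θ) R y =
      frameComp (frameDeriv T θ ε S y) (fun j => frameCoord θ y (coordVec j)) := by
  funext a
  obtain ⟨i, hi⟩ : ∃ i, i = Fin.init a := ⟨_, rfl⟩
  obtain ⟨l, hl⟩ : ∃ l, l = a (Fin.last m) := ⟨_, rfl⟩
  have e1 : pderiv l (fun z => R z i) y = _ :=
    (pderiv_congr hU (fun z hz => by rw [hR z hz]) hy l).trans (pderiv_frameComp hU h hS hy l i)
  have e2 : ∑ s : Fin m, ∑ k : Fin 3, christoffel (cofMetric θ) k l (i s) y *
      R y (Function.update i s k) = ∑ b : Fin m → Fin 3, S y b * ∑ s,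
        (connForm T θ ε l y * cofMat θ y + mpderiv l (cofMat θ) y) (b s) (i s) *
          ∏ t ∈ Finset.univ.erase s, cofMat θ y (b t) (i t) := by
    rw [← h.cofMat_mul_chrMat hU hy, hR y hy]
    simp only [frameComp, Finset.mul_sum, Matrix.mul_apply, Finset.sum_mul]
    conv_rhs => rw [Finset.sum_comm]
    refine Finset.sum_congr rfl fun s _ => ?_
    conv_lhs => rw [Finset.sum_comm]
    refine Finset.sum_congr rfl fun b _ => Finset.sum_congr rfl fun k _ => ?_
    have := prod_mul_prod_erase_update (fun t j => cofMat θ y (b t) j) i s k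
    change _ * (_ * ∏ t, cofMat θ y (b t) (Function.update i s k t)) = _
    rw [← this]
    simp only [chrMat, Matrix.of_apply]
    ring
  -- Moves the connection matrix from the coframe factors onto the tensor, where it acts as a
  -- derivation.
  have e3 := sum_mul_sum_prod_erase (S y) (connForm T θ ε l y) (fun s c => cofMat θ y c (i s))
  have e4 : frameComp (frameDeriv T θ ε S y) (fun j => frameCoord θ y (coordVec j)) a =
      ∑ b : Fin m → Fin 3, (pderiv l (fun z => S z b) y - derAct (connForm T θ ε l y) (S y) b) *
        ∏ s, cofMat θ y (b s) (i s) := by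
    change ∑ b : Fin (m + 1) → Fin 3, frameDeriv T θ ε S y b * ∏ s, cofMat θ y (b s) (a s) = _
    rw [sum_fin_succ_fun]
    refine Finset.sum_congr rfl fun b _ => ?_
    simp only [Fin.prod_univ_castSucc, Fin.snoc_castSucc, Fin.snoc_last]
    have e5 : ∀ s : Fin m, a s.castSucc = i s := fun s => by rw [hi]; rfl
    simp only [e5, ← hl, frameDeriv, Fin.init_snoc, Fin.snoc_last]
    rw [connForm, derAct_sum_smul]
    have e6 : pderiv l (fun z => S z b) y =
        ∑ c, cofMat θ y c l * fderiv ℝ (fun z => S z b) y (dualFrame θ y c) := by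
      conv_lhs => rw [pderiv, ← sum_apply_smul_dualFrame (h.coframe y hy) (coordVec l)]
      simp only [map_sum, map_smul, smul_eq_mul]
      rfl
    rw [e6, ← Finset.sum_sub_distrib, Finset.sum_mul]
    exact Finset.sum_congr rfl fun c _ => by ring
  rw [e4, covDeriv, ← hi, ← hl, e1]
  change _ - ∑ s : Fin m, ∑ k : Fin 3, christoffel (cofMetric θ) k l (a s.castSucc) y *
      R y (Function.update i s k) = _
  have e5 : ∀ s : Fin m, a s.castSucc = i s := fun s => by rw [hi]; rfl
  simp only [e5]
  rw [e2]
  simp only [Matrix.add_apply, Matrix.mul_apply, add_mul, sub_mul, Finset.sum_add_distrib,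
    Finset.sum_sub_distrib, mul_add]
  rw [← e3]
  ring

theorem SolvesStructureEqs.contDiffOn_frameCurv (hU : IsOpen U) (h : SolvesStructureEqs T C U θ ε)
    (k : ℕ) : ∀ a, ContDiffOn ℝ ∞ (fun z => frameCurv T C θ ε k z a) U := by
  induction k with
  | zero => exact fun a => contDiffOn_const
  | succ k ih =>
    intro a
    simp only [frameCurv, frameDeriv]
    refine (contDiffOn_fderiv_apply hU (ih _) (h.contDiffOn_dualFrame _)).sub ?_
    simp only [derAct]
    refine ContDiffOn.sum fun s _ => ContDiffOn.sum fun c _ => ContDiffOn.mul ?_ (ih _)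
    simp only [conn_eq T (ε _)]
    simp only [Matrix.add_apply, Matrix.smul_apply, smul_eq_mul]
    refine contDiffOn_const.add (ContDiffOn.mul ?_ contDiffOn_const)
    split_ifs
    · exact contDiffOn_const.mul h.smooth_epsilon
    · exact contDiffOn_const

theorem SolvesStructureEqs.curv_eq (hU : IsOpen U) (h : SolvesStructureEqs T C U θ ε)
    (k : ℕ) : ∀ y ∈ U, curv (cofMetric θ) k y =
      frameComp (frameCurv T C θ ε k y) (fun j => frameCoord θ y (coordVec j)) := by
  induction k with
  | zero => exact fun y hy => h.riemann_eq hU hy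
  | succ k ih => exact fun y hy => h.covDeriv_eq hU (h.contDiffOn_frameCurv hU k) ih hy

/-- The components of the curvature with respect to arbitrary vectors. -/
theorem SolvesStructureEqs.curvMap_eq (hU : IsOpen U) (h : SolvesStructureEqs T C U θ ε)
    (p : ℕ) {y : E3} (hy : y ∈ U) (e : Fin 3 → E3) :
    curvMap (cofMetric θ) p y e =
      fun k : Fin (p + 1) =>
        frameComp (frameCurv T C θ ε (k : ℕ) y) (fun a => frameCoord θ y (e a)) := by
  funext k
  rw [curvMap, h.curv_eq hU k y hy, frameComp_frameComp]
  congr 1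
  funext a
  ext b
  simp only [frameCoord]
  rw [clm_apply_eq_sum (θ y b) (e a)]
  rfl

theorem SolvesStructureEqs.curvMap_dualFrame (hU : IsOpen U) (h : SolvesStructureEqs T C U θ ε)
    (p : ℕ) {y : E3} (hy : y ∈ U) :
    curvMap (cofMetric θ) p y (dualFrame θ y) =
      fun k : Fin (p + 1) => frameCurv T C θ ε (k : ℕ) y := by
  rw [h.curvMap_eq hU p hy]
  funext k
  conv_rhs => rw [← frameComp_single (frameCurv T C θ ε k y)]
  congr 1
  funext a
  ext b
  simp [frameCoord, apply_dualFrame (h.coframe y hy), coordVec]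

end

end Lorentz3

end

/-! ### Invariants by order, normal forms and ranks -/

noncomputable section

namespace Lorentz3

/-! ### The curvature up to order four in terms of the invariants -/

/-- The differentials of `ε`, `Dε`, `D²ε`. -/
def invDiff (θ : E3 → Fin 3 → E3 →L[ℝ] ℝ) (ε : E3 → ℝ) (y : E3) : Fin 3 → E3 →L[ℝ] ℝ :=
  ![fderiv ℝ ε y, fderiv ℝ (opD θ ε) y, fderiv ℝ (opD θ (opD θ ε)) y]

/-- The differential of `f` at `y` vanishes on `v`. -/
def Kills (y v : E3) (f : E3 → ℝ) : Prop := DifferentiableAt ℝ f y ∧ fderiv ℝ f y v = 0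

theorem Kills.const (y v : E3) (c : ℝ) : Kills y v fun _ => c :=
  ⟨differentiableAt_const _, by simp⟩

theorem Kills.add {y v : E3} {f f' : E3 → ℝ} (h : Kills y v f) (h' : Kills y v f') :
    Kills y v fun z => f z + f' z :=
  ⟨h.1.add h'.1, by rw [fderiv_fun_add h.1 h'.1]; simp [h.2, h'.2]⟩

theorem Kills.mul {y v : E3} {f f' : E3 → ℝ} (h : Kills y v f) (h' : Kills y v f') :
    Kills y v fun z => f z * f' z :=
  ⟨h.1.mul h'.1, by rw [fderiv_fun_mul h.1 h'.1]; simp [h.2, h'.2]⟩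

theorem Kills.sum {ι : Type*} {s : Finset ι} {y v : E3} {f : ι → E3 → ℝ}
    (h : ∀ i ∈ s, Kills y v (f i)) : Kills y v fun z => ∑ i ∈ s, f i z :=
  ⟨DifferentiableAt.fun_sum fun i hi => (h i hi).1, by
    rw [fderiv_fun_sum fun i hi => (h i hi).1, _root_.sum_apply]
    exact Finset.sum_eq_zero fun i hi => (h i hi).2⟩

theorem Kills.congr {U : Set E3} (hU : IsOpen U) {y v : E3} (hy : y ∈ U) {f f' : E3 → ℝ}
    (h : Kills y v f) (hf : ∀ z ∈ U, f' z = f z) : Kills y v f' := by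
  have : f' =ᶠ[𝓝 y] f := Filter.eventually_of_mem (hU.mem_nhds hy) hf
  exact ⟨this.differentiableAt_iff.2 h.1, by rw [this.fderiv_eq, h.2]⟩

/-- Along a direction that annihilates dε and the components of one order, the connection term of
the next order is stationary too, so new differentials can come only from differentiated components.
-/
theorem Kills.derAct_conn {y v : E3} {ε : E3 → ℝ} (hε : Kills y v ε) {m : ℕ} {S : E3 → Tensor m}
    (hS : ∀ a, Kills y v fun z => S z a) (T : ℝ) (c : Fin 3) (a : Fin m → Fin 3) :
    Kills y v fun z => derAct (conn T (ε z) c) (S z) a := by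
  simp only [derAct]
  refine Kills.sum fun s _ => Kills.sum fun k _ => Kills.mul ?_ (hS _)
  simp only [conn_eq T (ε _)]
  simp only [Matrix.add_apply, Matrix.smul_apply, smul_eq_mul]
  refine (Kills.const _ _ _).add (Kills.mul ?_ (Kills.const _ _ _))
  split_ifs
  · exact (Kills.const _ _ _).mul hε
  · exact Kills.const _ _ _

theorem eq_zero_of_forall_apply_eq_zero {Φ : Fin 3 → E3 →L[ℝ] ℝ} (hΦ : LinearIndependent ℝ Φ)
    {v : E3} (hv : ∀ i, Φ i v = 0) : v = 0 := by
  -- Any basis of covectors is treated as a constant coframe; `dualFrame` is then the dual basis,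
  -- and the base point is irrelevant.
  rw [← sum_apply_smul_dualFrame (θ := fun _ => Φ) (y := 0) hΦ v]
  simp [hv]

/-- The joint zero set of the first `t` functionals. -/
def commonKer (Φ : Fin 3 → E3 →L[ℝ] ℝ) (t : ℕ) : Submodule ℝ E3 :=
  LinearMap.ker (LinearMap.pi fun i : {i : Fin 3 // (i : ℕ) < t} =>
    (Φ i.1 : E3 →ₗ[ℝ] ℝ))

theorem mem_commonKer {Φ : Fin 3 → E3 →L[ℝ] ℝ} {t : ℕ} {v : E3} :
    v ∈ commonKer Φ t ↔ ∀ i : Fin 3, (i : ℕ) < t → Φ i v = 0 := by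
  simp [commonKer, funext_iff]

theorem finrank_commonKer {Φ : Fin 3 → E3 →L[ℝ] ℝ} (hΦ : LinearIndependent ℝ Φ) {t : ℕ}
    (ht : t ≤ 3) : Module.finrank ℝ (commonKer Φ t) + t = 3 := by
  have h := LinearMap.finrank_range_add_finrank_ker
    (LinearMap.pi fun i : {i : Fin 3 // (i : ℕ) < t} => (Φ i.1 : E3 →ₗ[ℝ] ℝ))
  have hsurj : Function.Surjective
      (LinearMap.pi fun i : {i : Fin 3 // (i : ℕ) < t} => (Φ i.1 : E3 →ₗ[ℝ] ℝ)) := by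
    intro x
    refine ⟨∑ i, x i • dualFrame (fun _ => Φ) 0 i.1, ?_⟩
    funext j
    have : ∀ i : {i : Fin 3 // (i : ℕ) < t}, Φ j.1 (dualFrame (fun _ => Φ) 0 i.1) =
        if j = i then 1 else 0 := fun i => by
      rw [apply_dualFrame (θ := fun _ => Φ) (y := 0) hΦ]
      simp [Subtype.ext_iff]
    simp [this]
  rw [LinearMap.range_eq_top.2 hsurj, finrank_top, Module.finrank_fintype_fun_eq_card,
    finrank_euclideanSpace_fin] at h
  have hcard : Fintype.card {i : Fin 3 // (i : ℕ) < t} = t := by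
    rw [Fintype.card_subtype]
    interval_cases t <;> decide
  rw [hcard] at h
  rw [commonKer, add_comm]
  exact h

/-- The curvature has constant components, so only the connection term contributes, and its part
with ε is a boost. -/
theorem frameCurv_one (T C : ℝ) (θ : E3 → Fin 3 → E3 →L[ℝ] ℝ) (ε : E3 → ℝ) (y : E3) :
    frameCurv T C θ ε 1 y = curvOne T C := by
  funext a
  rw [← derAct_conn_curvZero T C (ε y) a]
  simp [frameCurv, frameDeriv]

/-- The part of the second derivative of the curvature that does not involve `ε`. -/
def curvTwoConst (T C : ℝ) : Tensor 6 := fun a =>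
  -derAct (conn T 0 (a (Fin.last 5))) (curvOne T C) (Fin.init a)

/-- The coefficient of `ε` in the second derivative of the curvature. -/
def curvTwoSlope (T C : ℝ) : Tensor 6 := fun a =>
  -((if a (Fin.last 5) = 0 then 2 else 0) * derAct boostGen (curvOne T C) (Fin.init a))

theorem frameCurv_two (T C : ℝ) (θ : E3 → Fin 3 → E3 →L[ℝ] ℝ) (ε : E3 → ℝ) (y : E3) :
    frameCurv T C θ ε 2 y = curvTwoConst T C + ε y • curvTwoSlope T C := by
  funext a
  have h1 : (fun z => frameCurv T C θ ε 1 z (Fin.init a)) = fun _ => curvOne T C (Fin.init a) :=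
    funext fun z => by rw [frameCurv_one]
  change fderiv ℝ (fun z => frameCurv T C θ ε 1 z (Fin.init a)) y _ -
    derAct (conn T (ε y) (a (Fin.last 5))) (frameCurv T C θ ε 1 y) (Fin.init a) = _
  rw [h1, frameCurv_one, conn_eq, derAct_add_matrix, derAct_smul_matrix]
  simp only [fderiv_fun_const, Pi.zero_apply, _root_.zero_apply, Pi.add_apply,
    Pi.smul_apply, smul_eq_mul, curvTwoConst, curvTwoSlope]
  split_ifs <;> ring

/-- The multi-index of the component used to normalize the second derivative of the curvature. -/
def idxTwo : Fin 6 → Fin 3 := ![0, 1, 0, 2, 0, 0]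

theorem init_idxTwo : (Fin.init idxTwo : Fin 5 → Fin 3) = ![0, 1, 0, 2, 0] := by
  funext i
  fin_cases i <;> rfl

theorem curvTwoConst_idxTwo (T C : ℝ) : curvTwoConst T C idxTwo = 0 := by
  rw [curvTwoConst, init_idxTwo, show idxTwo (Fin.last 5) = 0 from rfl]
  simp [derAct, Fin.sum_univ_five, Fin.sum_univ_three, conn, curvOne, bivec, bivecDeriv,
    Function.update_apply]

/-- The component 0,1,0,2,0 of `curvOne` is -2(C+2T²) and has boost weight 1+0+1-1+1 = 2; with the
factor -2 from the connection term this gives 8(C+2T²). Being nonzero, it lets ε be recovered from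
the curvature. -/
theorem curvTwoSlope_idxTwo (T C : ℝ) : curvTwoSlope T C idxTwo = 8 * (C + 2 * T ^ 2) := by
  rw [curvTwoSlope, init_idxTwo, show idxTwo (Fin.last 5) = 0 from rfl, boostGen,
    derAct_diagonal]
  simp [Fin.sum_univ_five, curvOne, bivec, bivecDeriv]
  ring

theorem frameCurv_two_idxTwo (T C : ℝ) (θ : E3 → Fin 3 → E3 →L[ℝ] ℝ) (ε : E3 → ℝ) (y : E3) :
    frameCurv T C θ ε 2 y idxTwo = 8 * (C + 2 * T ^ 2) * ε y := by
  have := congrFun (frameCurv_two T C θ ε y) idxTwo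
  rw [Pi.add_apply, Pi.smul_apply, curvTwoConst_idxTwo, curvTwoSlope_idxTwo] at this
  rw [this, smul_eq_mul]
  ring

section

variable {T C : ℝ} {U : Set E3} {θ : E3 → Fin 3 → E3 →L[ℝ] ℝ} {ε : E3 → ℝ}

/-- Differentiating an affine function of ε gives its slope times e_c(ε); a connection affine in ε
acting on a tensor affine in ε gives a quadratic polynomial. -/
theorem frameCurv_three (hε : ContDiffOn ℝ ∞ ε U) (hU : IsOpen U) (b : Fin 6 → Fin 3) (c : Fin 3) :
    ∃ q₀ q₁ q₂ : ℝ, ∀ y ∈ U, frameCurv T C θ ε 3 y (Fin.snoc b c : Fin 7 → Fin 3) =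
      curvTwoSlope T C b * fderiv ℝ ε y (dualFrame θ y c) + (q₀ + q₁ * ε y + q₂ * ε y ^ 2) := by
  set k : ℝ := if c = 0 then 2 else 0 with hk
  refine ⟨-derAct (conn T 0 c) (curvTwoConst T C) b,
    -(derAct (conn T 0 c) (curvTwoSlope T C) b + k * derAct boostGen (curvTwoConst T C) b),
    -(k * derAct boostGen (curvTwoSlope T C) b), fun y hy => ?_⟩
  have hd : DifferentiableAt ℝ ε y := differentiableAt_of_smooth hU hε hy
  have h1 : (fun z => frameCurv T C θ ε 2 z b) =
      fun z => curvTwoConst T C b + ε z * curvTwoSlope T C b :=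
    funext fun z => by rw [frameCurv_two]; rfl
  change fderiv ℝ (fun z => frameCurv T C θ ε 2 z
      (Fin.init (Fin.snoc b c : Fin 7 → Fin 3))) y
      (dualFrame θ y ((Fin.snoc b c : Fin 7 → Fin 3) (Fin.last 6))) -
    derAct (conn T (ε y) ((Fin.snoc b c : Fin 7 → Fin 3) (Fin.last 6))) (frameCurv T C θ ε 2 y)
      (Fin.init (Fin.snoc b c : Fin 7 → Fin 3)) = _
  rw [Fin.init_snoc, Fin.snoc_last, h1, frameCurv_two, conn_eq, derAct_add_matrix,
    derAct_smul_matrix, derAct_add, derAct_add, derAct_smul, derAct_smul,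
    fderiv_const_add, fderiv_mul_const hd]
  have h2 : (if c = 0 then 2 * ε y else 0) = ε y * k := by
    rw [hk]; split_ifs <;> ring
  simp only [h2, Pi.add_apply, Pi.smul_apply, smul_eq_mul, _root_.smul_apply]
  ring

theorem SolvesStructureEqs.fderiv_epsilon_dualFrame (h : SolvesStructureEqs T C U θ ε) {y : E3}
    (hy : y ∈ U) (c : Fin 3) :
    fderiv ℝ ε y (dualFrame θ y c) = (![opD θ ε y, -T * ε y, C] : Fin 3 → ℝ) c := by
  rw [h.d_epsilon y hy]
  fin_cases c <;> simp [apply_dualFrame (h.coframe y hy)]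

theorem SolvesStructureEqs.contDiffOn_opD (hU : IsOpen U) (h : SolvesStructureEqs T C U θ ε)
    {f : E3 → ℝ} (hf : ContDiffOn ℝ ∞ f U) : ContDiffOn ℝ ∞ (opD θ f) U :=
  contDiffOn_fderiv_apply hU hf (h.contDiffOn_dualFrame 0)

theorem snoc_init_last {m : ℕ} (a : Fin (m + 1) → Fin 3) :
    a = Fin.snoc (α := fun _ => Fin 3) (Fin.init a) (a (Fin.last m)) :=
  (Fin.snoc_init_self a).symm

/-- The common kernel of the differentials of the curvature components up to order `p`. -/
theorem SolvesStructureEqs.frameCurv_kills_iff (hTC : C + 2 * T ^ 2 ≠ 0) (hU : IsOpen U)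
    (h : SolvesStructureEqs T C U θ ε) {y : E3} (hy : y ∈ U)
    (hFI : FunctionallyIndependentAt θ ε y) (p : ℕ) (v : E3) :
    (∀ k ≤ p, ∀ a, fderiv ℝ (fun z => frameCurv T C θ ε k z a) y v = 0) ↔
      ∀ i : Fin 3, (i : ℕ) < tSeq p → invDiff θ ε y i v = 0 := by
  have hRd : ∀ k a, DifferentiableAt ℝ (fun z => frameCurv T C θ ε k z a) y := fun k a =>
    differentiableAt_of_smooth hU (h.contDiffOn_frameCurv hU k a) hy
  have hεd : DifferentiableAt ℝ ε y := differentiableAt_of_smooth hU h.smooth_epsilon hy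
  have hP := h.contDiffOn_opD hU h.smooth_epsilon
  have hPd : DifferentiableAt ℝ (opD θ ε) y := differentiableAt_of_smooth hU hP hy
  have hQd : DifferentiableAt ℝ (opD θ (opD θ ε)) y :=
    differentiableAt_of_smooth hU (h.contDiffOn_opD hU hP) hy
  have hc : 8 * (C + 2 * T ^ 2) ≠ 0 := mul_ne_zero (by norm_num) hTC
  -- One component is a nonzero multiple of ε, and every component is affine in ε.
  have two : (∀ a, Kills y v fun z => frameCurv T C θ ε 2 z a) ↔ Kills y v ε := by
    constructor
    · intro hk
      refine ((Kills.const y v (8 * (C + 2 * T ^ 2))⁻¹).mul (hk idxTwo)).congr hU hy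
        fun z _ => ?_
      rw [frameCurv_two_idxTwo, inv_mul_cancel_left₀ hc]
    · intro hk a
      refine ((Kills.const y v (curvTwoConst T C a)).add
        (hk.mul (Kills.const y v (curvTwoSlope T C a)))).congr hU hy fun z _ => ?_
      rw [frameCurv_two]
      rfl
  have poly : Kills y v ε → ∀ q₀ q₁ q₂ : ℝ, Kills y v fun z => q₀ + q₁ * ε z + q₂ * ε z ^ 2 := by
    intro hk q₀ q₁ q₂
    simp only [pow_two]
    exact ((Kills.const _ _ _).add ((Kills.const _ _ _).mul hk)).add
      ((Kills.const _ _ _).mul (hk.mul hk))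
  -- Extending the normalizing index by 0 means differentiating along e₀, so this component contains
  -- Dε with the nonzero coefficient 8(C+2T²).
  obtain ⟨q₀, q₁, q₂, hq⟩ := frameCurv_three (T := T) (C := C) (θ := θ) h.smooth_epsilon hU
    idxTwo 0
  have hq' : ∀ z ∈ U, opD θ ε z = (8 * (C + 2 * T ^ 2))⁻¹ *
      (frameCurv T C θ ε 3 z (Fin.snoc idxTwo 0 : Fin 7 → Fin 3) +
        (-1) * (q₀ + q₁ * ε z + q₂ * ε z ^ 2)) := by
    intro z hz
    rw [hq z hz, curvTwoSlope_idxTwo]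
    have e : fderiv ℝ ε z (dualFrame θ z 0) = opD θ ε z := rfl
    rw [e]
    field_simp
    ring
  have three : Kills y v ε →
      ((∀ a, Kills y v fun z => frameCurv T C θ ε 3 z a) ↔ Kills y v (opD θ ε)) := by
    intro hk
    constructor
    · intro hk3
      exact ((Kills.const _ _ _).mul ((hk3 _).add ((Kills.const _ _ _).mul
        (poly hk q₀ q₁ q₂)))).congr hU hy hq'
    · intro hkP a
      obtain ⟨r₀, r₁, r₂, hr⟩ := frameCurv_three (T := T) (C := C) (θ := θ) h.smooth_epsilon hU
        (Fin.init a : Fin 6 → Fin 3) (a (Fin.last 6))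
      have hd : Kills y v fun z => (![opD θ ε z, -T * ε z, C] : Fin 3 → ℝ) (a (Fin.last 6)) := by
        generalize a (Fin.last 6) = c
        fin_cases c
        · exact hkP
        · exact (Kills.const _ _ _).mul hk
        · exact Kills.const _ _ _
      refine (((Kills.const y v (curvTwoSlope T C (Fin.init a : Fin 6 → Fin 3))).mul hd).add
        (poly hk r₀ r₁ r₂)).congr hU hy fun z hz => ?_
      rw [← h.fderiv_epsilon_dualFrame hz, ← hr z hz]
      exact congrArg _ (snoc_init_last a)
  -- Differentiating the same component along e₀ once more isolates D²ε. One implication suffices: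
  -- once all three differentials vanish on v, v itself is zero.
  have four : Kills y v ε → Kills y v (opD θ ε) →
      (∀ a, Kills y v fun z => frameCurv T C θ ε 3 z a) →
      (∀ a, Kills y v fun z => frameCurv T C θ ε 4 z a) → Kills y v (opD θ (opD θ ε)) := by
    intro hk hkP hk3 hk4
    refine ((Kills.const y v (8 * (C + 2 * T ^ 2))⁻¹).mul
      (((hk4 (Fin.snoc (Fin.snoc idxTwo 0 : Fin 7 → Fin 3) 0 : Fin 8 → Fin 3)).add
        (hk.derAct_conn hk3 T 0 (Fin.snoc idxTwo 0 : Fin 7 → Fin 3))).add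
      ((Kills.const y v (-1)).mul (((Kills.const y v q₁).add
        ((Kills.const y v (2 * q₂)).mul hk)).mul hkP)))).congr hU hy fun z hz => ?_
    have hεz : DifferentiableAt ℝ ε z := differentiableAt_of_smooth hU h.smooth_epsilon hz
    have hPz : DifferentiableAt ℝ (opD θ ε) z := differentiableAt_of_smooth hU hP hz
    have e4 : frameCurv T C θ ε 4 z (Fin.snoc (Fin.snoc idxTwo 0 : Fin 7 → Fin 3) 0 :
        Fin 8 → Fin 3) = fderiv ℝ (fun x => frameCurv T C θ ε 3 x
          (Fin.snoc idxTwo 0 : Fin 7 → Fin 3)) z (dualFrame θ z 0) -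
        derAct (conn T (ε z) 0) (frameCurv T C θ ε 3 z) (Fin.snoc idxTwo 0 : Fin 7 → Fin 3) := by
      change fderiv ℝ (fun x => frameCurv T C θ ε 3 x (Fin.init (Fin.snoc
        (Fin.snoc idxTwo 0 : Fin 7 → Fin 3) 0 : Fin 8 → Fin 3))) z
        (dualFrame θ z ((Fin.snoc (Fin.snoc idxTwo 0 : Fin 7 → Fin 3) 0 : Fin 8 → Fin 3)
          (Fin.last 7))) - derAct (conn T (ε z) ((Fin.snoc (Fin.snoc idxTwo 0 : Fin 7 → Fin 3) 0 :
          Fin 8 → Fin 3) (Fin.last 7))) (frameCurv T C θ ε 3 z) (Fin.init (Fin.snoc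
        (Fin.snoc idxTwo 0 : Fin 7 → Fin 3) 0 : Fin 8 → Fin 3)) = _
      rw [Fin.init_snoc, Fin.snoc_last]
    have e5 : fderiv ℝ (fun x => frameCurv T C θ ε 3 x (Fin.snoc idxTwo 0 : Fin 7 → Fin 3)) z
        (dualFrame θ z 0) = 8 * (C + 2 * T ^ 2) * opD θ (opD θ ε) z +
          (q₁ + 2 * q₂ * ε z) * opD θ ε z := by
      have e6 : (fun x => frameCurv T C θ ε 3 x (Fin.snoc idxTwo 0 : Fin 7 → Fin 3)) =ᶠ[𝓝 z]
          fun x => 8 * (C + 2 * T ^ 2) * opD θ ε x + (q₀ + q₁ * ε x + q₂ * ε x ^ 2) :=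
        Filter.eventually_of_mem (hU.mem_nhds hz) fun x hx => by
          refine (hq x hx).trans ?_
          rw [curvTwoSlope_idxTwo]
          rfl
      have e7 := ((hPz.hasFDerivAt.const_mul (8 * (C + 2 * T ^ 2))).add
        (((hεz.hasFDerivAt.const_mul q₁).const_add q₀).add
          ((hεz.hasFDerivAt.pow 2).const_mul q₂)))
      rw [e6.fderiv_eq]
      refine (congrArg (fun φ : E3 →L[ℝ] ℝ => φ (dualFrame θ z 0)) e7.fderiv).trans ?_
      simp [opD]
      ring
    rw [e4, e5]
    field_simp
    ring
  have zero : ∀ a, fderiv ℝ (fun z => frameCurv T C θ ε 0 z a) y v = 0 := fun a => by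
    simp [frameCurv]
  have one : ∀ a, fderiv ℝ (fun z => frameCurv T C θ ε 1 z a) y v = 0 := fun a => by
    simp only [frameCurv_one]
    simp
  have k2 : (∀ a, fderiv ℝ (fun z => frameCurv T C θ ε 2 z a) y v = 0) ↔ fderiv ℝ ε y v = 0 :=
    ⟨fun hk => (two.1 fun a => ⟨hRd 2 a, hk a⟩).2, fun hk a => (two.2 ⟨hεd, hk⟩ a).2⟩
  have k3 : fderiv ℝ ε y v = 0 → ((∀ a, fderiv ℝ (fun z => frameCurv T C θ ε 3 z a) y v = 0) ↔
      fderiv ℝ (opD θ ε) y v = 0) := fun hk0 =>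
    ⟨fun hk => ((three ⟨hεd, hk0⟩).1 fun a => ⟨hRd 3 a, hk a⟩).2,
      fun hk a => ((three ⟨hεd, hk0⟩).2 ⟨hPd, hk⟩ a).2⟩
  match p with
  | 0 =>
    refine ⟨fun _ i hi => absurd hi (Nat.not_lt_zero _), fun _ k hk a => ?_⟩
    obtain rfl : k = 0 := by omega
    exact zero a
  | 1 =>
    refine ⟨fun _ i hi => absurd hi (Nat.not_lt_zero _), fun _ k hk a => ?_⟩
    interval_cases k
    · exact zero a
    · exact one a
  | 2 =>
    constructor
    · intro hk i hi
      obtain rfl : i = 0 := Fin.ext (by simpa [tSeq] using hi)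
      exact k2.1 (hk 2 le_rfl)
    · intro hk k hk' a
      interval_cases k
      · exact zero a
      · exact one a
      · exact k2.2 (hk 0 (by simp [tSeq])) a
  | 3 =>
    constructor
    · intro hk i hi
      have h0 := k2.1 (hk 2 (by norm_num))
      have h1 := (k3 h0).1 (hk 3 le_rfl)
      fin_cases i
      · exact h0
      · exact h1
      · exact absurd hi (by simp [tSeq])
    · intro hk k hk' a
      have h0 := hk 0 (by simp [tSeq])
      have h1 := hk 1 (by simp [tSeq])
      interval_cases k
      · exact zero a
      · exact one a
      · exact k2.2 h0 a
      · exact (k3 h0).2 h1 a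
  | p + 4 =>
    constructor
    · intro hk i hi
      have h0 := k2.1 (hk 2 (by omega))
      have h1 := (k3 h0).1 (hk 3 (by omega))
      fin_cases i
      · exact h0
      · exact h1
      · exact (four ⟨hεd, h0⟩ ⟨hPd, h1⟩ (fun a => ⟨hRd 3 a, hk 3 (by omega) a⟩)
          (fun a => ⟨hRd 4 a, hk 4 (by omega) a⟩)).2
    · intro hk k _ a
      -- From order four on the converse needs no formula for the components, since the three
      -- independent differentials leave only the zero vector.
      have hv : v = 0 := by
        have hli : LinearIndependent ℝ (invDiff θ ε y) := hFI
        exact eq_zero_of_forall_apply_eq_zero hli fun i => hk i (by simp [tSeq])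
      rw [hv, map_zero]

end

end Lorentz3

end

noncomputable section

namespace Lorentz3

/-! ### Normalizing cross-sections -/

/-- The components of the curvature and its derivatives up to order `p` in the coframe. -/
def frameCurvMap (T C : ℝ) (θ : E3 → Fin 3 → E3 →L[ℝ] ℝ) (ε : E3 → ℝ) (p : ℕ) (y : E3) :
    CurvSpace p := fun k => frameCurv T C θ ε (k : ℕ) y

/-- The common value of the normalized curvature components up to order one. -/
def curvConst (T C : ℝ) (p : ℕ) : CurvSpace p := frameCurvMap T C 0 0 p 0

/-- Cross-sections that normalize the curvature of all solutions. -/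
def crossSection (T C : ℝ) : (p : ℕ) → Set (CurvSpace p)
  | 0 => {curvConst T C 0}
  | 1 => {curvConst T C 1}
  | p + 2 => {R | R ⟨0, by omega⟩ = curvZero T C ∧ R ⟨1, by omega⟩ = curvOne T C ∧
      0 < R ⟨2, by omega⟩ idxTwo / (8 * (C + 2 * T ^ 2))}

/-- The group of the cross-section. -/
def crossGroup (T C : ℝ) : ℕ → Subgroup (Matrix (Fin 3) (Fin 3) ℝ)ˣ
  | 0 => isotropy (curvConst T C 0)
  | 1 => isotropy (curvConst T C 1)
  | _ + 2 => ⊥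

theorem isSubmanifold_of_linear_eq {F H : Type*} [NormedAddCommGroup F] [NormedSpace ℝ F]
    [AddCommGroup H] [Module ℝ H] (A : F →ₗ[ℝ] H) (c : H) {O : Set F} (hO : IsOpen O) :
    IsSubmanifold {x | A x = c ∧ x ∈ O} := by
  rcases Set.eq_empty_or_nonempty {x | A x = c ∧ x ∈ O} with h | ⟨x₀, hx₀, -⟩
  · rw [h]
    -- The empty set needs no charts, so any dimension serves; otherwise a point of the set is the
    -- origin of the affine subspace.
    exact ⟨0, fun x hx => hx.elim⟩
  · have := isSubmanifold_affine x₀ (LinearMap.ker A) hO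
    convert this using 4 with x
    rw [LinearMap.mem_ker, map_sub, hx₀, sub_eq_zero]

theorem isSubmanifold_crossSection (T C : ℝ) (p : ℕ) : IsSubmanifold (crossSection T C p) := by
  match p with
  | 0 =>
    convert isSubmanifold_of_linear_eq (LinearMap.id (R := ℝ) (M := CurvSpace 0))
      (curvConst T C 0) isOpen_univ using 1
    ext R
    simp [crossSection]
  | 1 =>
    convert isSubmanifold_of_linear_eq (LinearMap.id (R := ℝ) (M := CurvSpace 1))
      (curvConst T C 1) isOpen_univ using 1
    ext R
    simp [crossSection]
  | p + 2 =>
    have hO : IsOpen {R : CurvSpace (p + 2) |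
        0 < R ⟨2, by omega⟩ idxTwo / (8 * (C + 2 * T ^ 2))} := by
      refine isOpen_lt continuous_const (Continuous.div_const ?_ _)
      exact (continuous_apply idxTwo).comp
        (continuous_apply (A := fun k : Fin (p + 2 + 1) => Tensor (4 + (k : ℕ))) ⟨2, by omega⟩)
    convert isSubmanifold_of_linear_eq
      ((LinearMap.proj (R := ℝ) (φ := fun k : Fin (p + 2 + 1) => Tensor (4 + (k : ℕ)))
        ⟨0, by omega⟩).prod (LinearMap.proj (R := ℝ)
        (φ := fun k : Fin (p + 2 + 1) => Tensor (4 + (k : ℕ))) ⟨1, by omega⟩))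
      (curvZero T C, curvOne T C) hO using 1
    ext R
    simp only [crossSection, Set.mem_ofPred_eq, LinearMap.prod_apply, Function.prod_apply,
      LinearMap.proj_apply, Prod.mk.injEq, and_assoc]

section

variable {T C : ℝ}

/-- The given coframe is already normalized: orders 0 and 1 do not depend on the solution, so the
zero coframe and zero function in `curvConst` serve as placeholders, and from order 2 on the sign
condition says ε > 0. -/
theorem frameCurvMap_mem_crossSection (hTC : C + 2 * T ^ 2 ≠ 0) (θ : E3 → Fin 3 → E3 →L[ℝ] ℝ)
    {ε : E3 → ℝ} (p : ℕ) {y : E3} (hε : 0 < ε y) :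
    frameCurvMap T C θ ε p y ∈ crossSection T C p := by
  match p with
  | 0 =>
    funext k
    obtain rfl : k = 0 := Fin.fin_one_eq_zero k
    rfl
  | 1 =>
    funext k
    fin_cases k
    · rfl
    · exact (frameCurv_one T C θ ε y).trans (frameCurv_one T C _ _ _).symm
  | p + 2 =>
    refine ⟨rfl, frameCurv_one T C θ ε y, ?_⟩
    change 0 < frameCurv T C θ ε 2 y idxTwo / _
    rw [frameCurv_two_idxTwo, mul_div_cancel_left₀ _ (mul_ne_zero (by norm_num) hTC)]
    exact hε

theorem crossGroup_le (p : ℕ) : crossGroup T C p ≤ lorentzGroup := by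
  match p with
  | 0 => exact fun X hX => hX.1
  | 1 => exact fun X hX => hX.1
  | p + 2 => exact bot_le

theorem crossGroup_fixes (p : ℕ) :
    ∀ X ∈ crossGroup T C p, ∀ R ∈ crossSection T C p, actCurv X R = R := by
  match p with
  | 0 =>
    rintro X hX R rfl
    exact hX.2
  | 1 =>
    rintro X hX R rfl
    exact hX.2
  | p + 2 =>
    intro X hX R _
    obtain rfl : X = 1 := Subgroup.mem_bot.1 hX
    exact funext fun k => actTensor_one _

/-- For p ≤ 1 the section is one point and its stabilizer is the group. For larger p, orders 0 and 1
leave at most diag(-1,1,-1), which violates the sign condition. -/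
theorem crossGroup_maximal (hTC : C + 2 * T ^ 2 ≠ 0) (p : ℕ) :
    ∀ X ∈ lorentzGroup, ∀ R ∈ crossSection T C p, actCurv X R ∈ crossSection T C p →
      X ∈ crossGroup T C p := by
  match p with
  | 0 =>
    rintro X hX R rfl hR
    exact ⟨hX, hR⟩
  | 1 =>
    rintro X hX R rfl hR
    exact ⟨hX, hR⟩
  | p + 2 =>
    rintro X hX R ⟨h0, h1, h2⟩ ⟨h0', h1', h2'⟩
    simp only [actCurv] at h0' h1' h2'
    rw [h0] at h0'
    rw [h1] at h1'
    refine Subgroup.mem_bot.2 (inv_eq_one.1 (Units.ext ?_))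
    rcases eq_of_fixes_curvZero_curvOne hTC hX h0' h1' with h | h
    · exact h
    · exfalso
      -- Five of the six indices in `idxTwo` are 0 or 2, each contributing a factor -1.
      have h3 : actTensor X (R ⟨2, by omega⟩) idxTwo = -R ⟨2, by omega⟩ idxTwo := by
        simp only [actTensor]
        rw [h, sum_mul_prod_monomial _ _ id]
        · have : (∏ s : Fin 6, (Matrix.diagonal ![-1, 1, -1] : Matrix (Fin 3) (Fin 3) ℝ)
              (id (idxTwo s)) (idxTwo s)) = -1 := by
            simp [Fin.prod_univ_six, idxTwo]
          rw [Function.id_comp, this]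
          ring
        · intro c x hcx
          exact Matrix.diagonal_apply_ne _ hcx
      rw [h3, neg_div] at h2'
      linarith

theorem groupDim_crossGroup (hTC : C + 2 * T ^ 2 ≠ 0) (p : ℕ) :
    groupDim (crossGroup T C p) = sSeq p := by
  match p with
  | 0 => exact groupDim_isotropy_zero hTC rfl
  | 1 =>
    refine groupDim_eq_zero fun X hX => ?_
    have h0 : actTensor X (curvZero T C) = curvZero T C := congrFun hX.2 0
    have h1 : actTensor X (curvOne T C) = curvOne T C := by
      rw [← frameCurv_one T C 0 0 0]
      exact congrFun hX.2 1
    have h2 : (X⁻¹).val * (X⁻¹).val = 1 := by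
      rcases eq_of_fixes_curvZero_curvOne hTC hX.1 h0 h1 with h | h
      · rw [h, one_mul]
      · rw [h, Matrix.diagonal_mul_diagonal, ← Matrix.diagonal_one]
        congr 1
        funext i
        fin_cases i <;> simp
    have h3 : X⁻¹ * X⁻¹ = 1 := Units.ext h2
    have h4 : X * X = 1 := by rw [← inv_inj, mul_inv_rev, h3, inv_one]
    exact congrArg Units.val h4
  | p + 2 =>
    refine groupDim_eq_zero fun X hX => ?_
    obtain rfl : X = 1 := Subgroup.mem_bot.1 hX
    simp

/-! ### Changes of frame and the horizontal rank -/

variable {U : Set E3} {θ : E3 → Fin 3 → E3 →L[ℝ] ℝ} {ε : E3 → ℝ}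

theorem cofMetric_apply (θ : E3 → Fin 3 → E3 →L[ℝ] ℝ) (y v w : E3) :
    ∑ i, ∑ j, cofMetric θ y i j * v i * w j = ∑ a, ∑ b, eta a b * θ y a v * θ y b w := by
  simp only [clm_apply_eq_sum _ v, clm_apply_eq_sum _ w, cofMetric, Matrix.of_apply,
    Fin.sum_univ_three, smul_eq_mul]
  ring

theorem isEtaFrame_iff {y : E3} {e : Fin 3 → E3} :
    IsEtaFrame (cofMetric θ) y e ↔ ∀ a b, ∑ c, ∑ d, eta c d * θ y c (e a) * θ y d (e b) =
      eta a b := by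
  simp only [IsEtaFrame, cofMetric_apply]

theorem isEtaFrame_dualFrame {y : E3} (h : LinearIndependent ℝ (θ y)) :
    IsEtaFrame (cofMetric θ) y (dualFrame θ y) := by
  rw [isEtaFrame_iff]
  intro a b
  simp [apply_dualFrame h]

theorem IsEtaFrame.exists_lorentz {y : E3} {e : Fin 3 → E3} (he : IsEtaFrame (cofMetric θ) y e) :
    ∃ X ∈ lorentzGroup, ∀ b a, (X⁻¹).val b a = θ y b (e a) := by
  rw [isEtaFrame_iff] at he
  set A : Matrix (Fin 3) (Fin 3) ℝ := Matrix.of fun b a => θ y b (e a) with hA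
  have h1 : A.transpose * eta * A = eta := by
    ext a b
    rw [← he a b]
    simp only [Matrix.mul_apply, Matrix.transpose_apply, hA, Matrix.of_apply, Finset.sum_mul]
    rw [Finset.sum_comm]
    exact Finset.sum_congr rfl fun c _ => Finset.sum_congr rfl fun d _ => by ring
  have hdet : IsUnit A.det := by
    have h2 : eta.det ≠ 0 := by simp [eta, Matrix.det_fin_three]
    have h3 := congrArg Matrix.det h1
    rw [Matrix.det_mul, Matrix.det_mul, Matrix.det_transpose] at h3
    rw [isUnit_iff_ne_zero]
    intro h4
    rw [h4, mul_zero] at h3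
    exact h2 h3.symm
  obtain ⟨X, hX⟩ := (Matrix.isUnit_iff_isUnit_det A).2 hdet
  refine ⟨X⁻¹, inv_mem (mem_lorentzGroup.2 (by rw [hX, h1])), fun b a => ?_⟩
  rw [inv_inv, hX]
  rfl

theorem SolvesStructureEqs.exists_actCurv (hU : IsOpen U) (h : SolvesStructureEqs T C U θ ε)
    (p : ℕ) {y : E3} (hy : y ∈ U) {e : Fin 3 → E3} (he : IsEtaFrame (cofMetric θ) y e) :
    ∃ X ∈ lorentzGroup,
      curvMap (cofMetric θ) p y e = actCurv X (frameCurvMap T C θ ε p y) := by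
  obtain ⟨X, hX, hX'⟩ := he.exists_lorentz
  refine ⟨X, hX, ?_⟩
  rw [h.curvMap_eq hU p hy]
  funext k
  rw [actCurv, actTensor_eq_frameComp]
  simp only [hX']
  rfl

theorem fderiv_curvSpace_apply {p : ℕ} {F : E3 → CurvSpace p} {y : E3}
    (hF : ∀ k a, DifferentiableAt ℝ (fun z => F z k a) y) (v : E3) (k : Fin (p + 1))
    (a : Fin (4 + (k : ℕ)) → Fin 3) : fderiv ℝ F y v k a = fderiv ℝ (fun z => F z k a) y v := by
  have h1 : ∀ k, DifferentiableAt ℝ (fun z => F z k) y := fun k =>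
    differentiableAt_pi.2 fun a => hF k a
  rw [fderiv_pi h1]
  change fderiv ℝ (fun z => F z k) y v a = _
  rw [fderiv_pi fun a => hF k a]
  rfl

theorem tSeq_le_three (p : ℕ) : tSeq p ≤ 3 := by
  match p with
  | 0 | 1 | 2 | 3 => simp [tSeq]
  | p + 4 => simp [tSeq]

theorem SolvesStructureEqs.ker_fderiv_frameCurvMap (hTC : C + 2 * T ^ 2 ≠ 0) (hU : IsOpen U)
    (h : SolvesStructureEqs T C U θ ε) {y : E3} (hy : y ∈ U)
    (hFI : FunctionallyIndependentAt θ ε y) (p : ℕ) :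
    LinearMap.ker (fderiv ℝ (frameCurvMap T C θ ε p) y : E3 →ₗ[ℝ] CurvSpace p) =
      commonKer (invDiff θ ε y) (tSeq p) := by
  have hd : ∀ (k : Fin (p + 1)) (a : Fin (4 + (k : ℕ)) → Fin 3),
      DifferentiableAt ℝ (fun z => frameCurvMap T C θ ε p z k a) y := fun k a =>
    differentiableAt_of_smooth hU (h.contDiffOn_frameCurv hU k a) hy
  ext v
  rw [mem_commonKer, ← h.frameCurv_kills_iff hTC hU hy hFI p v, LinearMap.mem_ker]
  constructor
  · intro hv k hk a
    have := congrFun (congrFun hv ⟨k, Nat.lt_succ_of_le hk⟩) a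
    change fderiv ℝ (frameCurvMap T C θ ε p) y v _ _ = _ at this
    rw [fderiv_curvSpace_apply hd] at this
    exact this
  · intro hv
    funext k a
    change fderiv ℝ (frameCurvMap T C θ ε p) y v _ _ = _
    rw [fderiv_curvSpace_apply hd]
    exact hv k (Nat.le_of_lt_succ k.2) a

/-- Any other normalized frame differs pointwise from the dual frame by an element X of O(η). By
maximality X lies in the group, which fixes the section pointwise, so the normalized components
agree with those of the given coframe; smoothness of X plays no role. The rank is then 3 minus the
dimension of the common kernel. -/
theorem SolvesStructureEqs.horizontalRank (hTC : C + 2 * T ^ 2 ≠ 0) (hU : IsOpen U)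
    (h : SolvesStructureEqs T C U θ ε) (hFI : ∀ y ∈ U, FunctionallyIndependentAt θ ε y) (p : ℕ)
    {V : Set E3} (hVU : V ⊆ U) {e : E3 → Fin 3 → E3} (he : IsMovingFrame (cofMetric θ) V e)
    (hS : ∀ y ∈ V, curvMap (cofMetric θ) p y (e y) ∈ crossSection T C p) {y : E3} (hy : y ∈ V) :
    Module.finrank ℝ (LinearMap.range (fderiv ℝ (fun z => curvMap (cofMetric θ) p z (e z)) y :
      E3 →ₗ[ℝ] CurvSpace p)) = tSeq p := by
  have h1 : ∀ z ∈ V, curvMap (cofMetric θ) p z (e z) = frameCurvMap T C θ ε p z := by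
    intro z hz
    obtain ⟨X, hX, hX'⟩ := h.exists_actCurv hU p (hVU hz) (he.orthogonal z hz)
    have hmem := frameCurvMap_mem_crossSection hTC θ (ε := ε) p (h.epsilon_pos z (hVU hz))
    have h2 := hS z hz
    rw [hX'] at h2 ⊢
    exact crossGroup_fixes p X (crossGroup_maximal hTC p X hX _ hmem h2) _ hmem
  have h2 : (fun z => curvMap (cofMetric θ) p z (e z)) =ᶠ[𝓝 y] frameCurvMap T C θ ε p :=
    Filter.eventually_of_mem (he.isOpen.mem_nhds hy) h1
  rw [h2.fderiv_eq]
  have h3 := LinearMap.finrank_range_add_finrank_ker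
    (fderiv ℝ (frameCurvMap T C θ ε p) y : E3 →ₗ[ℝ] CurvSpace p)
  rw [h.ker_fderiv_frameCurvMap hTC hU (hVU hy) (hFI y (hVU hy)) p,
    finrank_euclideanSpace_fin] at h3
  have h4 := finrank_commonKer (Φ := invDiff θ ε y) (hFI y (hVU hy)) (tSeq_le_three p)
  omega

end

end Lorentz3

end

noncomputable section

namespace Lorentz3

/-! ### The rank of the lift to the frame bundle -/

theorem finrank_submodule_prod {V W : Type*} [AddCommGroup V] [Module ℝ V] [AddCommGroup W]
    [Module ℝ W] [FiniteDimensional ℝ V] [FiniteDimensional ℝ W] (p : Submodule ℝ V)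
    (q : Submodule ℝ W) :
    Module.finrank ℝ (p.prod q) = Module.finrank ℝ p + Module.finrank ℝ q := by
  have h := LinearMap.finrank_range_of_inj (f := LinearMap.prodMap p.subtype q.subtype)
    (Prod.map_injective.2 ⟨p.injective_subtype, q.injective_subtype⟩)
  rw [LinearMap.range_prodMap, Submodule.range_subtype, Submodule.range_subtype,
    Module.finrank_prod] at h
  exact h

/-- The Lie algebra of `O(η)`. -/
def soMat : (Fin 3 → ℝ) →ₗ[ℝ] Matrix (Fin 3) (Fin 3) ℝ where
  toFun a := !![a 0, a 2 / 2, 0; a 1, 0, a 2; 0, a 1 / 2, -a 0]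
  map_add' a b := by
    ext i j
    fin_cases i <;> fin_cases j <;> simp <;> ring
  map_smul' c a := by
    ext i j
    fin_cases i <;> fin_cases j <;> simp <;> ring

theorem soMat_apply (a : Fin 3 → ℝ) :
    soMat a = !![a 0, a 2 / 2, 0; a 1, 0, a 2; 0, a 1 / 2, -a 0] := rfl

theorem soMat_skew (a : Fin 3 → ℝ) : (soMat a).transpose * eta + eta * soMat a = 0 := by
  ext i j
  fin_cases i <;> fin_cases j <;>
    simp [soMat_apply, eta, Matrix.mul_apply, Fin.sum_univ_three] <;> ring

theorem exists_soMat {A : Matrix (Fin 3) (Fin 3) ℝ} (hA : A.transpose * eta + eta * A = 0) :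
    ∃ a, soMat a = A := by
  have h : ∀ i j, (A.transpose * eta + eta * A) i j = 0 := fun i j => by rw [hA]; rfl
  have h00 := h 0 0
  have h01 := h 0 1
  have h02 := h 0 2
  have h11 := h 1 1
  have h12 := h 1 2
  have h22 := h 2 2
  simp only [Matrix.add_apply, Matrix.mul_apply, Fin.sum_univ_three,
    Matrix.transpose_apply] at h00 h01 h02 h11 h12 h22
  simp [eta] at h00 h01 h02 h11 h12 h22
  refine ⟨![A 0 0, A 1 0, A 1 2], ?_⟩
  ext i j
  fin_cases i <;> fin_cases j <;> simp [soMat_apply] <;> linarith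

theorem soMat_single (c : ℝ) : soMat (c • Pi.single 0 1) = c • boostGen := by
  ext i j
  fin_cases i <;> fin_cases j <;> simp [soMat_apply, boostGen]

/-- The isotropy algebra of the curvature up to order `p`. -/
def isotropyAlg : ℕ → Submodule ℝ (Fin 3 → ℝ)
  | 0 => ℝ ∙ (Pi.single 0 1 : Fin 3 → ℝ)
  | _ => ⊥

theorem finrank_isotropyAlg (p : ℕ) : Module.finrank ℝ (isotropyAlg p) = sSeq p := by
  match p with
  | 0 =>
    refine finrank_span_singleton fun h => ?_
    have := congrFun h 0
    simp at this
  | p + 1 => exact finrank_bot ℝ _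

/-- The constant-curvature part is invariant under O(η), so only the square of the bivector is
moved; in the two chosen components the null rotations a₁ and a₂ appear with coefficients
proportional to C+2T². -/
theorem exists_smul_of_derAct_curvZero {T C : ℝ} (hTC : C + 2 * T ^ 2 ≠ 0) {a : Fin 3 → ℝ}
    (h : derAct (soMat a) (curvZero T C) = 0) : a = a 0 • Pi.single 0 1 := by
  have h1 := congrFun h ![0, 1, 0, 2]
  have h2 := congrFun h ![2, 1, 0, 2]
  simp [derAct, Fin.sum_univ_four, Fin.sum_univ_three, soMat_apply, curvZero, eta, bivec,
    Function.update_apply] at h1 h2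
  have h1' : a 1 = 0 := (mul_eq_zero.1 (show (C + 2 * T ^ 2) * a 1 = 0 by
    linarith)).resolve_left hTC
  have h2' : a 2 = 0 := (mul_eq_zero.1 (show (C + 2 * T ^ 2) * a 2 = 0 by
    linarith)).resolve_left hTC
  funext i
  fin_cases i <;> simp [h1', h2']

theorem eq_zero_of_derAct_curvOne {T C : ℝ} (hTC : C + 2 * T ^ 2 ≠ 0) {c : ℝ}
    (h : derAct (c • boostGen) (curvOne T C) = 0) : c = 0 := by
  rw [derAct_smul_matrix] at h
  have h1 := congrFun h ![0, 1, 0, 2, 0]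
  rw [Pi.smul_apply, boostGen, derAct_diagonal] at h1
  simp [Fin.sum_univ_five, curvOne, bivec, bivecDeriv, hTC] at h1
  exact h1

section

variable {T C : ℝ} {U : Set E3} {θ : E3 → Fin 3 → E3 →L[ℝ] ℝ} {ε : E3 → ℝ}

/-- The components of the vectors of a frame with respect to the coframe. -/
def trivMap (θ : E3 → Fin 3 → E3 →L[ℝ] ℝ) (q : E3 × (Fin 3 → E3)) : E3 × (Fin 3 → E3) :=
  (q.1, fun a => frameCoord θ q.1 (q.2 a))

/-- The frame with given components with respect to the coframe. -/
def trivInv (θ : E3 → Fin 3 → E3 →L[ℝ] ℝ) (q : E3 × (Fin 3 → E3)) : E3 × (Fin 3 → E3) :=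
  (q.1, fun a => ∑ b, q.2 a b • dualFrame θ q.1 b)

theorem SolvesStructureEqs.differentiableAt_trivMap (hU : IsOpen U)
    (h : SolvesStructureEqs T C U θ ε) {q : E3 × (Fin 3 → E3)} (hq : q.1 ∈ U) :
    DifferentiableAt ℝ (trivMap θ) q := by
  refine DifferentiableAt.prodMk differentiableAt_fst (differentiableAt_pi.2 fun a => ?_)
  refine differentiableAt_euclidean.2 fun b => ?_
  have h1 : DifferentiableAt ℝ (fun z => θ z b) q.1 :=
    differentiableAt_of_smooth hU (contDiffOn_pi.1 h.smooth_coframe b) hq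
  have h2 : DifferentiableAt ℝ (fun q : E3 × (Fin 3 → E3) => θ q.1 b) q :=
    h1.comp q differentiableAt_fst
  have h3 : DifferentiableAt ℝ (fun q : E3 × (Fin 3 → E3) => q.2 a) q :=
    (differentiableAt_pi.1 differentiableAt_snd a)
  exact h2.clm_apply h3

theorem SolvesStructureEqs.differentiableAt_trivInv (hU : IsOpen U)
    (h : SolvesStructureEqs T C U θ ε) {q : E3 × (Fin 3 → E3)} (hq : q.1 ∈ U) :
    DifferentiableAt ℝ (trivInv θ) q := by
  refine DifferentiableAt.prodMk differentiableAt_fst (differentiableAt_pi.2 fun a => ?_)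
  refine DifferentiableAt.fun_sum fun b _ => ?_
  have h1 : DifferentiableAt ℝ (fun z => dualFrame θ z b) q.1 :=
    differentiableAt_of_smooth hU (h.contDiffOn_dualFrame b) hq
  have h2 : DifferentiableAt ℝ (fun q : E3 × (Fin 3 → E3) => dualFrame θ q.1 b) q :=
    h1.comp q differentiableAt_fst
  have h3 : DifferentiableAt ℝ (fun q : E3 × (Fin 3 → E3) => q.2 a) q :=
    (differentiableAt_pi.1 differentiableAt_snd a)
  exact (differentiableAt_euclidean.1 h3 b).smul h2

theorem SolvesStructureEqs.trivMap_trivInv (h : SolvesStructureEqs T C U θ ε)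
    {q : E3 × (Fin 3 → E3)} (hq : q.1 ∈ U) : trivMap θ (trivInv θ q) = q := by
  refine Prod.ext rfl (funext fun a => ?_)
  ext b
  change θ q.1 b (∑ c, q.2 a c • dualFrame θ q.1 c) = _
  simp [apply_dualFrame (h.coframe q.1 hq)]

theorem SolvesStructureEqs.trivInv_trivMap (h : SolvesStructureEqs T C U θ ε)
    {q : E3 × (Fin 3 → E3)} (hq : q.1 ∈ U) : trivInv θ (trivMap θ q) = q :=
  Prod.ext rfl (funext fun _ => sum_apply_smul_dualFrame (h.coframe q.1 hq) _)

/-- The chain rule applied to `trivMap` ∘ `trivInv` = id near the point gives a right inverse.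
Surjectivity is all that is needed to transport the tangent space of the frame bundle to the
trivialization. -/
theorem SolvesStructureEqs.fderiv_trivMap_surjective (hU : IsOpen U)
    (h : SolvesStructureEqs T C U θ ε) {q : E3 × (Fin 3 → E3)} (hq : q.1 ∈ U) :
    Function.Surjective (fderiv ℝ (trivMap θ) q) := by
  set q' := trivMap θ q with hq'
  have e : trivInv θ q' = q := h.trivInv_trivMap hq
  have h1 := (h.differentiableAt_trivInv hU (q := q') hq).hasFDerivAt
  have h2 : HasFDerivAt (trivMap θ) (fderiv ℝ (trivMap θ) q) (trivInv θ q') := by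
    rw [e]
    exact (h.differentiableAt_trivMap hU hq).hasFDerivAt
  have h3 := h2.comp q' h1
  have h4 : trivMap θ ∘ trivInv θ =ᶠ[𝓝 q'] id := by
    have : {q : E3 × (Fin 3 → E3) | q.1 ∈ U} ∈ 𝓝 q' :=
      (hU.preimage continuous_fst).mem_nhds hq
    exact Filter.eventually_of_mem this fun z hz => h.trivMap_trivInv hz
  have h5 := (h3.congr_of_eventuallyEq h4.symm).unique (hasFDerivAt_id q')
  intro w
  exact ⟨fderiv ℝ (trivInv θ) q' w, by
    simpa using congrArg (fun L : (E3 × (Fin 3 → E3)) →L[ℝ] (E3 × (Fin 3 → E3)) => L w) h5⟩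

/-- The inner products of the vectors with components `x` in the null triad. -/
def gramMap (q : E3 × (Fin 3 → E3)) (a b : Fin 3) : ℝ :=
  ∑ c, ∑ d, eta c d * q.2 a c * q.2 b d

theorem hasFDerivAt_coord (q : E3 × (Fin 3 → E3)) (a b : Fin 3) :
    HasFDerivAt (fun q : E3 × (Fin 3 → E3) => q.2 a b)
      ((EuclideanSpace.proj b : E3 →L[ℝ] ℝ).comp ((ContinuousLinearMap.proj a).comp
        (ContinuousLinearMap.snd ℝ E3 (Fin 3 → E3)))) q :=
  ((EuclideanSpace.proj b : E3 →L[ℝ] ℝ).comp ((ContinuousLinearMap.proj a).comp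
        (ContinuousLinearMap.snd ℝ E3 (Fin 3 → E3)))).hasFDerivAt

theorem differentiableAt_gramMap (q : E3 × (Fin 3 → E3)) : DifferentiableAt ℝ gramMap q := by
  refine differentiableAt_pi.2 fun a => differentiableAt_pi.2 fun b => ?_
  refine DifferentiableAt.fun_sum fun c _ => DifferentiableAt.fun_sum fun d _ => ?_
  exact ((hasFDerivAt_coord q a c).differentiableAt.const_mul _).mul
    (hasFDerivAt_coord q b d).differentiableAt

theorem fderiv_gramMap_apply (q w : E3 × (Fin 3 → E3)) (a b : Fin 3) :
    fderiv ℝ gramMap q w a b =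
      ∑ c, ∑ d, eta c d * (w.2 a c * q.2 b d + q.2 a c * w.2 b d) := by
  have h0 := differentiableAt_gramMap q
  have h1 : HasFDerivAt (fun q => gramMap q a b) _ q :=
    HasFDerivAt.fun_sum fun c _ => HasFDerivAt.fun_sum fun d _ =>
      ((hasFDerivAt_coord q a c).const_mul (eta c d)).mul (hasFDerivAt_coord q b d)
  have h2 : fderiv ℝ gramMap q w a b = fderiv ℝ (fun q => gramMap q a b) q w := by
    rw [fderiv_pi fun a => differentiableAt_pi.1 h0 a]
    change fderiv ℝ (fun z => gramMap z a) q w b = _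
    rw [fderiv_pi fun b => differentiableAt_pi.1 (differentiableAt_pi.1 h0 a) b]
    rfl
  rw [h2, h1.fderiv]
  simp only [_root_.sum_apply, _root_.add_apply, _root_.smul_apply, smul_eq_mul,
    ContinuousLinearMap.comp_apply, ContinuousLinearMap.proj_apply, ContinuousLinearMap.coe_snd',
    EuclideanSpace.coe_proj]
  exact Finset.sum_congr rfl fun c _ => Finset.sum_congr rfl fun d _ => by ring

/-- The curvature components with respect to the vectors with components `x` in the coframe. -/
def liftMap (T C : ℝ) (θ : E3 → Fin 3 → E3 →L[ℝ] ℝ) (ε : E3 → ℝ) (p : ℕ)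
    (q : E3 × (Fin 3 → E3)) : CurvSpace p :=
  fun k => frameComp (frameCurv T C θ ε (k : ℕ) q.1) q.2

theorem SolvesStructureEqs.hasFDerivAt_liftMap_apply (hU : IsOpen U)
    (h : SolvesStructureEqs T C U θ ε) {q : E3 × (Fin 3 → E3)} (hq : q.1 ∈ U) (k : ℕ)
    (a : Fin (4 + k) → Fin 3) :
    HasFDerivAt (fun q : E3 × (Fin 3 → E3) => frameComp (frameCurv T C θ ε k q.1) q.2 a)
      (∑ b : Fin (4 + k) → Fin 3, (frameCurv T C θ ε k q.1 b •
        (∑ s, (∏ t ∈ Finset.univ.erase s, q.2 (a t) (b t)) •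
          ((EuclideanSpace.proj (b s) : E3 →L[ℝ] ℝ).comp ((ContinuousLinearMap.proj (a s)).comp
        (ContinuousLinearMap.snd ℝ E3 (Fin 3 → E3))))) + (∏ s, q.2 (a s) (b s)) •
        (fderiv ℝ (fun z => frameCurv T C θ ε k z b) q.1).comp
          (ContinuousLinearMap.fst ℝ E3 (Fin 3 → E3)))) q := by
  refine HasFDerivAt.fun_sum fun b _ => HasFDerivAt.mul ?_ ?_
  · have h1 : DifferentiableAt ℝ (fun z => frameCurv T C θ ε k z b) q.1 :=
      differentiableAt_of_smooth hU (h.contDiffOn_frameCurv hU k b) hq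
    exact h1.hasFDerivAt.comp q hasFDerivAt_fst
  · exact HasFDerivAt.finsetProd fun s _ => hasFDerivAt_coord q (a s) (b s)

theorem SolvesStructureEqs.differentiableAt_liftMap (hU : IsOpen U)
    (h : SolvesStructureEqs T C U θ ε) {q : E3 × (Fin 3 → E3)} (hq : q.1 ∈ U) (p : ℕ) :
    DifferentiableAt ℝ (liftMap T C θ ε p) q :=
  differentiableAt_pi.2 fun k => differentiableAt_pi.2 fun a =>
    (h.hasFDerivAt_liftMap_apply hU hq (k : ℕ) a).differentiableAt

/-- Moving the base point differentiates the components, and moving the frame by A acts on them as a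
derivation. Both contributions are components in the same frame, so their sum can be analysed with
the frame stripped off. -/
theorem SolvesStructureEqs.fderiv_liftMap_apply (hU : IsOpen U)
    (h : SolvesStructureEqs T C U θ ε) {q : E3 × (Fin 3 → E3)} (hq : q.1 ∈ U) (p : ℕ)
    (v : E3) (A : Matrix (Fin 3) (Fin 3) ℝ) (k : Fin (p + 1)) :
    fderiv ℝ (liftMap T C θ ε p) q
      (v, fun a => WithLp.toLp 2 fun b => ∑ c, A b c * q.2 a c) k =
      frameComp (fun b => fderiv ℝ (fun z => frameCurv T C θ ε (k : ℕ) z b) q.1 v +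
        derAct A (frameCurv T C θ ε (k : ℕ) q.1) b) q.2 := by
  have h0 := h.differentiableAt_liftMap hU hq p
  funext a
  have h1 := h.hasFDerivAt_liftMap_apply hU hq (k : ℕ) a
  have h2 : ∀ w, fderiv ℝ (liftMap T C θ ε p) q w k a =
      fderiv ℝ (fun q : E3 × (Fin 3 → E3) =>
        frameComp (frameCurv T C θ ε (k : ℕ) q.1) q.2 a) q w := by
    intro w
    rw [fderiv_pi fun k => differentiableAt_pi.1 h0 k]
    change fderiv ℝ (fun z => liftMap T C θ ε p z k) q w a = _
    rw [fderiv_pi fun a => differentiableAt_pi.1 (differentiableAt_pi.1 h0 k) a]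
    rfl
  rw [h2, h1.fderiv]
  have h3 := sum_mul_sum_prod_erase (frameCurv T C θ ε (k : ℕ) q.1) A (fun s c => q.2 (a s) c)
  simp only [frameComp, add_mul, Finset.sum_add_distrib]
  rw [← h3]
  simp only [_root_.sum_apply, _root_.add_apply, _root_.smul_apply, smul_eq_mul,
    ContinuousLinearMap.comp_apply, ContinuousLinearMap.proj_apply, ContinuousLinearMap.coe_snd',
    EuclideanSpace.coe_proj, ContinuousLinearMap.coe_fst']
  refine Finset.sum_add_distrib.symm.trans
    (Eq.trans (Finset.sum_congr rfl fun b _ => ?_) Finset.sum_add_distrib)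
  have hs := Finset.sum_congr (s₁ := Finset.univ) rfl
    fun (s : Fin (4 + (k : ℕ))) (_ : s ∈ Finset.univ) =>
      mul_comm (∏ t ∈ Finset.univ.erase s, q.2 (a t) (b t)) (∑ c, A (b s) c * q.2 (a s) c)
  rw [← hs, add_comm, mul_comm (∏ s, q.2 (a s) (b s))]

/-- The parametrization of the tangent space of the frame bundle. -/
def tangentParam (x : Fin 3 → E3) : (E3 × (Fin 3 → ℝ)) →ₗ[ℝ] E3 × (Fin 3 → E3) where
  toFun q := (q.1, fun a => WithLp.toLp 2 fun b => ∑ c, soMat q.2 b c * x a c)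
  map_add' q q' := by
    refine Prod.ext rfl (funext fun a => ?_)
    ext b
    simp [add_mul, Finset.sum_add_distrib]
  map_smul' r q := by
    refine Prod.ext rfl (funext fun a => ?_)
    ext b
    simp [Finset.mul_sum, mul_assoc]

/-- A variation W of an η-orthogonal matrix X preserves the Gram matrix to first order exactly when
WX⁻¹ is η-skew; the base direction is free. -/
theorem range_tangentParam {X : (Matrix (Fin 3) (Fin 3) ℝ)ˣ} (hX : X ∈ lorentzGroup) {y : E3}
    {x : Fin 3 → E3} (hx : ∀ a b, x a b = X.val b a) :
    LinearMap.range (tangentParam x) = LinearMap.ker (fderiv ℝ gramMap (y, x) :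
      (E3 × (Fin 3 → E3)) →ₗ[ℝ] (Fin 3 → Fin 3 → ℝ)) := by
  have hη := mem_lorentzGroup.1 hX
  have hker : ∀ w : E3 × (Fin 3 → E3), w ∈ LinearMap.ker (fderiv ℝ gramMap (y, x) :
      (E3 × (Fin 3 → E3)) →ₗ[ℝ] (Fin 3 → Fin 3 → ℝ)) ↔
      (Matrix.of fun b a => w.2 a b).transpose * eta * X.val +
        X.val.transpose * eta * (Matrix.of fun b a => w.2 a b) = 0 := by
    intro w
    rw [LinearMap.mem_ker, funext_iff, ← Matrix.ext_iff]
    refine forall_congr' fun a => ?_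
    rw [funext_iff]
    refine forall_congr' fun b => ?_
    change fderiv ℝ gramMap (y, x) w a b = 0 ↔ _
    rw [fderiv_gramMap_apply]
    simp only [hx, Matrix.add_apply, Matrix.mul_apply, Matrix.transpose_apply, Matrix.of_apply,
      Finset.sum_mul, Matrix.zero_apply]
    rw [Finset.sum_comm, ← Finset.sum_add_distrib]
    have : ∀ c d : ℝ, c = d → (c = 0 ↔ d = 0) := fun c d h => by rw [h]
    refine this _ _ (Finset.sum_congr rfl fun d _ => ?_)
    rw [← Finset.sum_add_distrib]
    exact Finset.sum_congr rfl fun c _ => by ring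
  ext w
  rw [hker]
  constructor
  · rintro ⟨⟨v, a⟩, rfl⟩
    have h1 : (Matrix.of fun b c => (tangentParam x (v, a)).2 c b) = soMat a * X.val := by
      ext b c
      simp [tangentParam, Matrix.mul_apply, hx]
    rw [h1, Matrix.transpose_mul]
    calc _ = X.val.transpose * ((soMat a).transpose * eta + eta * soMat a) * X.val := by
          noncomm_ring
      _ = 0 := by rw [soMat_skew, Matrix.mul_zero, Matrix.zero_mul]
  · intro hw
    set W : Matrix (Fin 3) (Fin 3) ℝ := Matrix.of fun b a => w.2 a b with hW
    have hXX : X.val * (X⁻¹).val = 1 := by rw [← Units.val_mul]; simp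
    have hXX' : (X⁻¹).val * X.val = 1 := by rw [← Units.val_mul]; simp
    have hXt : (X⁻¹).val.transpose * X.val.transpose = 1 := by
      rw [← Matrix.transpose_mul, hXX, Matrix.transpose_one]
    have hsk : (W * (X⁻¹).val).transpose * eta + eta * (W * (X⁻¹).val) = 0 := by
      calc _ = (X⁻¹).val.transpose * (W.transpose * eta * (X.val * (X⁻¹).val)) +
            ((X⁻¹).val.transpose * X.val.transpose) * eta * W * (X⁻¹).val := by
              rw [hXX, hXt, Matrix.transpose_mul]; noncomm_ring
        _ = (X⁻¹).val.transpose * (W.transpose * eta * X.val + X.val.transpose * eta * W) *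
            (X⁻¹).val := by noncomm_ring
        _ = 0 := by rw [hw, Matrix.mul_zero, Matrix.zero_mul]
    obtain ⟨a, ha⟩ := exists_soMat hsk
    refine ⟨(w.1, a), Prod.ext rfl (funext fun c => ?_)⟩
    ext b
    have h1 : (soMat a * X.val) b c = W b c := by
      rw [ha, Matrix.mul_assoc, hXX', Matrix.mul_one]
    simp only [Matrix.mul_apply] at h1
    simp only [tangentParam, LinearMap.coe_mk, AddHom.coe_mk, hx]
    exact h1

theorem frameComp_eq_zero {m : ℕ} {X : (Matrix (Fin 3) (Fin 3) ℝ)ˣ} {x : Fin 3 → E3}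
    (hx : ∀ a b, x a b = X.val b a) {S : Tensor m} (hS : frameComp S x = 0) : S = 0 := by
  have h1 : frameComp S x = actTensor X⁻¹ S := by
    rw [actTensor_eq_frameComp, inv_inv]
    congr 1
    funext a
    ext b
    exact hx a b
  rw [h1] at hS
  have h2 := actTensor_mul X X⁻¹ S
  rw [mul_inv_cancel, actTensor_one, hS] at h2
  rw [h2]
  funext a
  simp [actTensor]

theorem rSeq_eq (p : ℕ) : rSeq p + sSeq p = tSeq p + 3 := by
  match p with
  | 0 | 1 | 2 | 3 => simp [tSeq, rSeq, sSeq]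
  | p + 4 => simp [tSeq, rSeq, sSeq]

/-- The kernel splits because orders 0 and 1 have constant components: their equations constrain
only the Lie algebra part. For p = 0 they leave the boosts; for p ≥ 1 they leave nothing, and the
higher orders then constrain only v. -/
theorem SolvesStructureEqs.ker_lift (hTC : C + 2 * T ^ 2 ≠ 0) (hU : IsOpen U)
    (h : SolvesStructureEqs T C U θ ε) {y : E3} (hy : y ∈ U)
    (hFI : FunctionallyIndependentAt θ ε y) (p : ℕ) {X : (Matrix (Fin 3) (Fin 3) ℝ)ˣ}
    {x : Fin 3 → E3} (hx : ∀ a b, x a b = X.val b a) :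
    LinearMap.ker ((fderiv ℝ (liftMap T C θ ε p) (y, x) :
      (E3 × (Fin 3 → E3)) →ₗ[ℝ] CurvSpace p) ∘ₗ tangentParam x) =
      (commonKer (invDiff θ ε y) (tSeq p)).prod (isotropyAlg p) := by
  have hkills := h.frameCurv_kills_iff hTC hU hy hFI p
  ext ⟨v, a⟩
  rw [Submodule.mem_prod, mem_commonKer, ← hkills v, LinearMap.mem_ker]
  have e : ∀ k : Fin (p + 1), ((fderiv ℝ (liftMap T C θ ε p) (y, x) :
      (E3 × (Fin 3 → E3)) →ₗ[ℝ] CurvSpace p) ∘ₗ tangentParam x) (v, a) k =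
      frameComp (fun b => fderiv ℝ (fun z => frameCurv T C θ ε (k : ℕ) z b) y v +
        derAct (soMat a) (frameCurv T C θ ε (k : ℕ) y) b) x := fun k =>
    h.fderiv_liftMap_apply hU (q := (y, x)) hy p v (soMat a) k
  have d0 : ∀ b, fderiv ℝ (fun z => frameCurv T C θ ε 0 z b) y v = 0 := fun b => by
    simp [frameCurv]
  have d1 : ∀ b, fderiv ℝ (fun z => frameCurv T C θ ε 1 z b) y v = 0 := fun b => by
    simp only [frameCurv_one]
    simp
  constructor
  · intro h0
    have h1 : ∀ k ≤ p, ∀ b, fderiv ℝ (fun z => frameCurv T C θ ε k z b) y v +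
        derAct (soMat a) (frameCurv T C θ ε k y) b = 0 := fun k hk b =>
      congrFun (frameComp_eq_zero hx ((e ⟨k, Nat.lt_succ_of_le hk⟩).symm.trans
        (congrFun h0 _))) b
    have h2 : a = a 0 • Pi.single 0 1 := by
      refine exists_smul_of_derAct_curvZero (T := T) (C := C) hTC (funext fun b => ?_)
      have := h1 0 (Nat.zero_le _) b
      rw [d0, zero_add] at this
      exact this
    match p with
    | 0 =>
      refine ⟨fun k hk b => ?_, Submodule.mem_span_singleton.2 ⟨a 0, h2.symm⟩⟩
      obtain rfl : k = 0 := by omega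
      exact d0 b
    | p + 1 =>
      have h3 : a = 0 := by
        have h4 : a 0 = 0 := by
          refine eq_zero_of_derAct_curvOne (T := T) (C := C) hTC (funext fun b => ?_)
          have := h1 1 (by omega) b
          rw [d1, zero_add, frameCurv_one, h2, soMat_single] at this
          exact this
        rw [h2, h4, zero_smul]
      refine ⟨fun k hk b => ?_, h3⟩
      have := h1 k hk b
      rw [h3, map_zero] at this
      simpa [derAct] using this
  · rintro ⟨h1, h2⟩
    funext k
    rw [e]
    have h3 : (fun b => fderiv ℝ (fun z => frameCurv T C θ ε (k : ℕ) z b) y v +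
        derAct (soMat a) (frameCurv T C θ ε (k : ℕ) y) b) = 0 := by
      funext b
      rw [h1 k (Nat.le_of_lt_succ k.2) b, zero_add]
      match p with
      | 0 =>
        obtain ⟨c, hc⟩ := Submodule.mem_span_singleton.1 h2
        obtain rfl : k = 0 := Fin.fin_one_eq_zero k
        have hc' : c • Pi.single 0 1 = a := hc
        rw [← hc', soMat_single, derAct_smul_matrix]
        change (c • derAct boostGen (curvZero T C)) b = 0
        rw [derAct_boostGen_curvZero, smul_zero]
        rfl
      | p + 1 =>
        have h4 : a = 0 := h2
        rw [h4, map_zero]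
        simp [derAct]
    rw [h3]
    funext b
    simp [frameComp]

/-- In the trivialization the tangent space is parametrized by ℝ³ × so(η), of dimension 6.
Rank-nullity and `ker_lift` give 6 - (3 - t_p) - s_p. -/
theorem SolvesStructureEqs.liftedRankAt_eq (hTC : C + 2 * T ^ 2 ≠ 0) (hU : IsOpen U)
    (h : SolvesStructureEqs T C U θ ε) {y : E3} (hy : y ∈ U)
    (hFI : FunctionallyIndependentAt θ ε y) (p : ℕ) {e : Fin 3 → E3}
    (he : IsEtaFrame (cofMetric θ) y e) : liftedRankAt (cofMetric θ) p y e = rSeq p := by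
  obtain ⟨X, hX, hX'⟩ := he.exists_lorentz
  obtain ⟨x, hx⟩ : ∃ x : Fin 3 → E3, x = fun a => frameCoord θ y (e a) := ⟨_, rfl⟩
  have hxX : ∀ a b, x a b = (X⁻¹).val b a := fun a b => by rw [hX', hx]; rfl
  have ht : trivMap θ (y, e) = (y, x) := by rw [hx]; rfl
  have hΦ := (h.differentiableAt_trivMap hU (q := (y, e)) hy)
  have hG : (fun (q : E3 × (Fin 3 → E3)) (a b : Fin 3) =>
      ∑ i, ∑ j, cofMetric θ q.1 i j * q.2 a i * q.2 b j) = gramMap ∘ trivMap θ := by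
    funext q a b
    rw [cofMetric_apply]
    rfl
  have hF : (fun q : E3 × (Fin 3 → E3) => curvMap (cofMetric θ) p q.1 q.2) =ᶠ[𝓝 (y, e)]
      liftMap T C θ ε p ∘ trivMap θ := by
    have : {q : E3 × (Fin 3 → E3) | q.1 ∈ U} ∈ 𝓝 (y, e) :=
      (hU.preimage continuous_fst).mem_nhds hy
    exact Filter.eventually_of_mem this fun q hq => h.curvMap_eq hU p hq q.2
  have hG' : fderiv ℝ (gramMap ∘ trivMap θ) (y, e) =
      (fderiv ℝ gramMap (y, x)).comp (fderiv ℝ (trivMap θ) (y, e)) := by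
    rw [fderiv_comp _ (differentiableAt_gramMap _) hΦ, ht]
  have hF' : fderiv ℝ (liftMap T C θ ε p ∘ trivMap θ) (y, e) =
      (fderiv ℝ (liftMap T C θ ε p) (y, x)).comp (fderiv ℝ (trivMap θ) (y, e)) := by
    rw [fderiv_comp _ (by rw [ht]; exact h.differentiableAt_liftMap hU (q := (y, x)) hy p) hΦ, ht]
  have hsurj := h.fderiv_trivMap_surjective hU (q := (y, e)) hy
  have hmap : (frameBundleTangent (cofMetric θ) y e).map
      (fderiv ℝ (fun q : E3 × (Fin 3 → E3) => curvMap (cofMetric θ) p q.1 q.2) (y, e) :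
        (E3 × (Fin 3 → E3)) →ₗ[ℝ] CurvSpace p) =
      LinearMap.range ((fderiv ℝ (liftMap T C θ ε p) (y, x) :
      (E3 × (Fin 3 → E3)) →ₗ[ℝ] CurvSpace p) ∘ₗ tangentParam x) := by
    rw [LinearMap.range_comp, range_tangentParam (inv_mem hX) (y := y) hxX, frameBundleTangent, hG,
      hF.fderiv_eq, hG', hF']
    ext R
    simp only [Submodule.mem_map, LinearMap.mem_ker]
    constructor
    · rintro ⟨q, hq, rfl⟩
      exact ⟨fderiv ℝ (trivMap θ) (y, e) q, hq, rfl⟩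
    · rintro ⟨q, hq, rfl⟩
      obtain ⟨q', rfl⟩ := hsurj q
      exact ⟨q', hq, rfl⟩
  rw [liftedRankAt, hmap]
  have h1 := LinearMap.finrank_range_add_finrank_ker
    ((fderiv ℝ (liftMap T C θ ε p) (y, x) :
      (E3 × (Fin 3 → E3)) →ₗ[ℝ] CurvSpace p) ∘ₗ tangentParam x)
  rw [h.ker_lift hTC hU hy hFI p hxX, finrank_submodule_prod, finrank_isotropyAlg,
    Module.finrank_prod, finrank_euclideanSpace_fin, Module.finrank_fin_fun] at h1
  have h2 := finrank_commonKer (Φ := invDiff θ ε y) hFI (tSeq_le_three p)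
  have h3 := rSeq_eq p
  omega

end

end Lorentz3

end

noncomputable section

namespace Lorentz3

/-! ### Petrov type -/

theorem eta_inv : eta⁻¹ = !![0, 0, -1; 0, 2, 0; -1, 0, 0] := by
  refine Matrix.inv_eq_right_inv ?_
  ext i j
  fin_cases i <;> fin_cases j <;> simp [eta, Matrix.mul_apply, Fin.sum_univ_three]

theorem ricci_curvZero (T C : ℝ) :
    (Matrix.of fun a b => ∑ c, ∑ d, eta⁻¹ c d * curvZero T C ![c, a, d, b]) =
      !![0, 0, 4 * T ^ 2 - 2 * (C + 2 * T ^ 2); 0, -2 * T ^ 2, 0;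
        4 * T ^ 2 - 2 * (C + 2 * T ^ 2), 0, 0] := by
  rw [eta_inv]
  ext i j
  fin_cases i <;> fin_cases j <;>
    simp [curvZero, eta, bivec, Fin.sum_univ_three] <;> ring

theorem SolvesStructureEqs.typeD {T C : ℝ} (hTC : C + 2 * T ^ 2 ≠ 0) {U : Set E3}
    {θ : E3 → Fin 3 → E3 →L[ℝ] ℝ} {ε : E3 → ℝ} (hU : IsOpen U)
    (h : SolvesStructureEqs T C U θ ε) {y : E3} (hy : y ∈ U) :
    ∃ e : Fin 3 → E3, IsEtaFrame (cofMetric θ) y e ∧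
    ∃ Ψ₂ : ℝ, Ψ₂ ≠ 0 ∧
      let ric : Matrix (Fin 3) (Fin 3) ℝ := Matrix.of fun a b =>
        ∑ c, ∑ d, eta⁻¹ c d * frameComp (riemann (cofMetric θ) y) e ![c, a, d, b]
      let R : ℝ := ∑ a, ∑ b, eta⁻¹ a b * ric a b
      ric - (R / 3) • eta = !![0, 0, Ψ₂; 0, Ψ₂, 0; Ψ₂, 0, 0] := by
  -- The constant-curvature part has no trace-free Ricci tensor, so Ψ₂ comes entirely from the
  -- bivector term and is a multiple of C+2T².
  refine ⟨dualFrame θ y, isEtaFrame_dualFrame (h.coframe y hy), -2 / 3 * (C + 2 * T ^ 2),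
    mul_ne_zero (by norm_num) hTC, ?_⟩
  have h1 : frameComp (riemann (cofMetric θ) y) (dualFrame θ y) = curvZero T C :=
    congrFun (h.curvMap_dualFrame hU 0 hy) 0
  intro ric R
  have hric : ric = !![0, 0, 4 * T ^ 2 - 2 * (C + 2 * T ^ 2); 0, -2 * T ^ 2, 0;
        4 * T ^ 2 - 2 * (C + 2 * T ^ 2), 0, 0] := by
    simp only [ric, h1]
    exact ricci_curvZero T C
  have hR : R = 4 * C - 4 * T ^ 2 := by
    simp only [R, hric, eta_inv]
    simp [Fin.sum_univ_three]
    ring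
  rw [hR, hric]
  ext i j
  fin_cases i <;> fin_cases j <;> simp [eta] <;> ring

theorem SolvesStructureEqs.isMovingFrame {T C : ℝ} {U : Set E3}
    {θ : E3 → Fin 3 → E3 →L[ℝ] ℝ} {ε : E3 → ℝ} (hU : IsOpen U)
    (h : SolvesStructureEqs T C U θ ε) : IsMovingFrame (cofMetric θ) U (dualFrame θ) where
  isOpen := hU
  smooth := contDiffOn_pi.2 h.contDiffOn_dualFrame
  orthogonal y hy := isEtaFrame_dualFrame (h.coframe y hy)

theorem SolvesStructureEqs.curvMap_mem_crossSection {T C : ℝ} (hTC : C + 2 * T ^ 2 ≠ 0)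
    {U : Set E3} {θ : E3 → Fin 3 → E3 →L[ℝ] ℝ} {ε : E3 → ℝ} (hU : IsOpen U)
    (h : SolvesStructureEqs T C U θ ε) (p : ℕ) :
    ∀ y ∈ U, curvMap (cofMetric θ) p y (dualFrame θ y) ∈ crossSection T C p := by
  intro y hy
  rw [h.curvMap_dualFrame hU p hy]
  exact frameCurvMap_mem_crossSection hTC θ p (h.epsilon_pos y hy)

/-! ### Manifolds -/

section Manifold

variable {M : Type*} [TopologicalSpace M] [ChartedSpace E3 M] {T C : ℝ} {θ : Coframe M}
  {ε : M → ℝ}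

theorem inChart_coframeMetric (θ : Coframe M) (x₀ : M) :
    inChart (coframeMetric θ) x₀ = cofMetric (coframeInChart θ x₀) := rfl

theorem isTypeD_of_solves (hTC : C + 2 * T ^ 2 ≠ 0) (h : SolvesStructureEqsOn T C θ ε) :
    IsTypeD (coframeMetric θ) := fun x₀ _ hy =>
  (h x₀).typeD hTC (chartAt E3 x₀).open_target hy

theorem hasFrameFreedomAndHorizontalRank_of_solves (hTC : C + 2 * T ^ 2 ≠ 0)
    (h : SolvesStructureEqsOn T C θ ε) (hFI : FunctionallyIndependent θ ε) (p : ℕ) :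
    HasFrameFreedomAndHorizontalRank (coframeMetric θ) p (sSeq p) (tSeq p) := by
  refine ⟨crossSection T C p, crossGroup T C p, ⟨isSubmanifold_crossSection T C p,
    crossGroup_le p, crossGroup_fixes p, ?_, ?_⟩, groupDim_crossGroup hTC p, ?_⟩
  · rintro X hX ⟨R, ⟨R', hR', rfl⟩, hR⟩
    exact crossGroup_maximal hTC p X hX R' hR' hR
  · intro x₀
    have hU := (chartAt E3 x₀).open_target
    have h1 := (h x₀).isMovingFrame hU
    have h2 := (h x₀).curvMap_mem_crossSection hTC hU p
    rw [← inChart_coframeMetric] at h1 h2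
    exact ⟨_, _, mem_chart_target E3 x₀, subset_rfl, h1, h2⟩
  · intro x₀ V e hV he hS y hy
    exact (h x₀).horizontalRank hTC (chartAt E3 x₀).open_target (hFI x₀) p hV he hS hy

theorem hasLiftedRank_of_solves (hTC : C + 2 * T ^ 2 ≠ 0)
    (h : SolvesStructureEqsOn T C θ ε) (hFI : FunctionallyIndependent θ ε) (p : ℕ) :
    HasLiftedRank (coframeMetric θ) p (rSeq p) := fun x₀ y hy _ he =>
  (h x₀).liftedRankAt_eq hTC (chartAt E3 x₀).open_target hy (hFI x₀ y hy) p he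

theorem isLeast_rSeq : IsLeast {k : ℕ | (if k = 0 then 0 else rSeq (k - 1)) = rSeq k} 5 := by
  constructor
  · simp [rSeq]
  · intro k hk
    by_contra hlt
    push Not at hlt
    interval_cases k <;> simp [rSeq] at hk

end Manifold

end Lorentz3

end

/-! ### Existence and genericity of solutions -/

noncomputable section

namespace Lorentz3

/-! ### Existence of solutions -/

theorem dForm_eq {α : E3 → E3 →L[ℝ] ℝ} {y : E3} {A : E3 →L[ℝ] E3 →L[ℝ] ℝ}
    (h : HasFDerivAt α A y) (v w : E3) : dForm α y v w = A v w - A w v := by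
  rw [dForm, h.fderiv]

theorem opD_eq_of_fderiv {θ : E3 → Fin 3 → E3 →L[ℝ] ℝ} {f : E3 → ℝ} {y : E3}
    (hθ : LinearIndependent ℝ (θ y)) {p q r : ℝ}
    (h : fderiv ℝ f y = p • θ y 0 + q • θ y 1 + r • θ y 2) : opD θ f y = p := by
  rw [opD, h]
  simp [apply_dualFrame hθ]

/-- The solution data in coordinates in which the coframe is triangular. -/
def triCoframe (b : ℝ) (a m n g : E3 → ℝ) : E3 → Fin 3 → E3 →L[ℝ] ℝ := fun y =>
  ![a y • EuclideanSpace.proj 0,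
    b • EuclideanSpace.proj 1 + m y • EuclideanSpace.proj 0,
    n y • EuclideanSpace.proj 2 + g y • EuclideanSpace.proj 0]

/-- In the ansatz ω⁰ = a dy⁰, ω¹ = b dy¹ + m dy⁰, ω² = n dy² + g dy⁰ nothing depends on y⁰. The
derivative n₂ of n along y² is unconstrained because dy²∧dy² = 0. -/
theorem triCoframe_solves {T C b : ℝ} (hb : b ≠ 0) {a m n n₂ g ε : E3 → ℝ}
    (ha : ContDiff ℝ ∞ a) (hm : ContDiff ℝ ∞ m) (hn : ContDiff ℝ ∞ n) (hg : ContDiff ℝ ∞ g)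
    (hε : ContDiff ℝ ∞ ε) (ha0 : ∀ y, a y ≠ 0) (hn0 : ∀ y, n y ≠ 0) (hε0 : ∀ y, 0 < ε y)
    (da : ∀ y, HasFDerivAt a ((T * a y * b) • EuclideanSpace.proj 1 : E3 →L[ℝ] ℝ) y)
    (dm : ∀ y, HasFDerivAt m ((4 * T * a y * n y) • EuclideanSpace.proj 2 : E3 →L[ℝ] ℝ) y)
    (dn : ∀ y, HasFDerivAt n ((-T * b * n y) • EuclideanSpace.proj 1
      + n₂ y • EuclideanSpace.proj 2 : E3 →L[ℝ] ℝ) y)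
    (dg : ∀ y, HasFDerivAt g ((-(a y * b) - T * b * g y) • EuclideanSpace.proj 1
      + (T * m y * n y - 2 * ε y * a y * n y) • EuclideanSpace.proj 2 : E3 →L[ℝ] ℝ) y)
    (dε : ∀ y, HasFDerivAt ε ((-T * ε y * b) • EuclideanSpace.proj 1
      + (C * n y) • EuclideanSpace.proj 2 : E3 →L[ℝ] ℝ) y) :
    SolvesStructureEqs T C Set.univ (triCoframe b a m n g) ε := by
  have hli : ∀ y, LinearIndependent ℝ (triCoframe b a m n g y) := by
    intro y
    rw [Fintype.linearIndependent_iff]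
    intro c hc
    have h0 := DFunLike.congr_fun hc (coordVec 0)
    have h1 := DFunLike.congr_fun hc (coordVec 1)
    have h2 := DFunLike.congr_fun hc (coordVec 2)
    simp [triCoframe, Fin.sum_univ_three, coordVec, hn0, hb] at h0 h1 h2
    simp [h1, h2, ha0] at h0
    intro i
    fin_cases i <;> simp [h0, h1, h2]
  refine ⟨?_, hε.contDiffOn, fun y _ => hli y, fun y _ => hε0 y, ?_, ?_, ?_, ?_⟩
  · refine contDiffOn_pi.2 fun i => ContDiff.contDiffOn ?_
    fin_cases i
    · exact ha.smul contDiff_const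
    · exact contDiff_const.add (hm.smul contDiff_const)
    · exact (hn.smul contDiff_const).add (hg.smul contDiff_const)
  · intro y _ v w
    have h : HasFDerivAt (fun z => triCoframe b a m n g z 0) _ y :=
      (da y).smul_const (EuclideanSpace.proj 0 : E3 →L[ℝ] ℝ)
    rw [dForm_eq h]
    simp [triCoframe, wedge]
    ring
  · intro y _ v w
    have h : HasFDerivAt (fun z => triCoframe b a m n g z 1) _ y :=
      (hasFDerivAt_const (b • EuclideanSpace.proj 1 : E3 →L[ℝ] ℝ) y).add
        ((dm y).smul_const (EuclideanSpace.proj 0 : E3 →L[ℝ] ℝ))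
    rw [dForm_eq h]
    simp [triCoframe, wedge]
    ring
  · intro y _ v w
    have h : HasFDerivAt (fun z => triCoframe b a m n g z 2) _ y :=
      ((dn y).smul_const (EuclideanSpace.proj 2 : E3 →L[ℝ] ℝ)).add
        ((dg y).smul_const (EuclideanSpace.proj 0 : E3 →L[ℝ] ℝ))
    rw [dForm_eq h]
    simp [triCoframe, wedge]
    ring
  · intro y _
    have h : fderiv ℝ ε y = ((T * ε y * m y - C * g y) / a y) • triCoframe b a m n g y 0
        + (-(T * ε y)) • triCoframe b a m n g y 1 + C • triCoframe b a m n g y 2 := by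
      rw [(dε y).fderiv]
      ext v
      have := ha0 y
      simp [triCoframe]
      field_simp
      ring
    rw [opD_eq_of_fderiv (hli y) h, h]
    module

theorem hasFDerivAt_of_eq {f g : E3 → ℝ} {f' g' : E3 →L[ℝ] ℝ} {y : E3} (h : HasFDerivAt f f' y)
    (hfg : ∀ z, f z = g z) (h' : ∀ v, f' v = g' v) : HasFDerivAt g g' y := by
  obtain rfl : f = g := funext hfg
  obtain rfl : f' = g' := ContinuousLinearMap.ext h'
  exact h

/-- Needed to solve ∂₁g = -ab - Tbg with a = exp(Ty¹), b = 1: multiplied by exp(Ty¹) it reads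
(exp(Ty¹)g)' = -exp(2Ty¹). The case T = 0 has no division by 2T. -/
theorem exists_antideriv_exp (T : ℝ) :
    ∃ s : ℝ → ℝ, ContDiff ℝ ∞ s ∧ ∀ x, HasDerivAt s (Real.exp (2 * T * x)) x := by
  rcases eq_or_ne T 0 with rfl | hT
  · exact ⟨id, contDiff_id, fun x => by simpa using hasDerivAt_id x⟩
  · refine ⟨fun x => Real.exp (2 * T * x) / (2 * T), by fun_prop, fun x => ?_⟩
    have h1 := (((hasDerivAt_id' x).const_mul (2 * T)).exp).div_const (2 * T)
    have h2 : Real.exp (2 * T * x) * (2 * T * 1) / (2 * T) = Real.exp (2 * T * x) := by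
      field_simp
    rwa [h2] at h1

theorem hasFDerivAt_euclideanCoord (i : Fin 3) (y : E3) :
    HasFDerivAt (fun z : E3 => z i) (EuclideanSpace.proj i : E3 →L[ℝ] ℝ) y :=
  (EuclideanSpace.proj i : E3 →L[ℝ] ℝ).hasFDerivAt

/-- For C ≠ 0 take b = 1 and ε = exp(y² - Ty¹); the equation ∂₂ε = Cn then forces n = ε/C. For C =
0, where T ≠ 0, ε depends on y¹ only, and b = -1/T makes it exp(y¹). The functions m and g follow by
integration. -/
theorem exists_solves_univ {T C : ℝ} (hTC : C + 2 * T ^ 2 ≠ 0) :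
    ∃ θ ε, SolvesStructureEqs T C Set.univ θ ε := by
  have c1 := fun y : E3 => hasFDerivAt_euclideanCoord 1 y
  have c2 := fun y : E3 => hasFDerivAt_euclideanCoord 2 y
  rcases eq_or_ne C 0 with rfl | hC
  · have hT : T ≠ 0 := by
      rintro rfl
      simp at hTC
    refine ⟨_, _, triCoframe_solves (b := -1 / T) (a := fun y => Real.exp (-y 1))
      (m := fun y => y 2 / T) (n := fun y => Real.exp (y 1) / (4 * T ^ 2)) (n₂ := 0)
      (g := fun y => Real.exp (y 1) * (y 2 - 2) ^ 2 / (8 * T ^ 2) - Real.exp (-y 1) / (2 * T))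
      (ε := fun y => Real.exp (y 1)) (by simpa) (by fun_prop) (by fun_prop) (by fun_prop)
      (by fun_prop) (by fun_prop) (fun y => Real.exp_ne_zero _)
      (fun y => by positivity) (fun y => Real.exp_pos _) ?_ ?_ ?_ ?_ ?_⟩
    · intro y
      refine hasFDerivAt_of_eq (c1 y).neg.exp (fun z => by simp) fun v => ?_
      simp
      field_simp
    · intro y
      refine hasFDerivAt_of_eq ((c2 y).mul_const (1 / T)) (fun z => by ring) fun v => ?_
      simp [Real.exp_neg]
      field_simp
      simp
    · intro y
      refine hasFDerivAt_of_eq ((c1 y).exp.mul_const (1 / (4 * T ^ 2))) (fun z => by ring)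
        fun v => ?_
      simp
      field_simp
    · intro y
      refine hasFDerivAt_of_eq ((((c1 y).exp.mul (((c2 y).sub_const 2).pow 2)).mul_const
        (1 / (8 * T ^ 2))).sub ((c1 y).neg.exp.mul_const (1 / (2 * T))))
        (fun z => by simp; ring) fun v => ?_
      simp [Real.exp_neg]
      field_simp
      ring
    · intro y
      refine hasFDerivAt_of_eq (c1 y).exp (fun z => rfl) fun v => ?_
      simp
      field_simp
  · obtain ⟨s, hs, hs'⟩ := exists_antideriv_exp T
    have cs : ∀ y : E3, HasFDerivAt (fun z : E3 => s (z 1)) _ y := fun y =>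
      (hs' (y 1)).comp_hasFDerivAt y (c1 y)
    have hs2 : ContDiff ℝ ∞ fun z : E3 => s (z 1) := hs.comp (by fun_prop)
    refine ⟨_, _, triCoframe_solves (b := 1) (a := fun y => Real.exp (T * y 1))
      (m := fun y => 4 * T / C * Real.exp (y 2))
      (n := fun y => Real.exp (y 2 - T * y 1) / C)
      (n₂ := fun y => Real.exp (y 2 - T * y 1) / C)
      (g := fun y => (2 * T ^ 2 / C ^ 2 - 1 / C) * Real.exp (2 * y 2 - T * y 1)
        - Real.exp (-(T * y 1)) * s (y 1))
      (ε := fun y => Real.exp (y 2 - T * y 1)) one_ne_zero (by fun_prop) (by fun_prop)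
      (by fun_prop) (by fun_prop) (by fun_prop) (fun y => Real.exp_ne_zero _)
      (fun y => by positivity) (fun y => Real.exp_pos _) ?_ ?_ ?_ ?_ ?_⟩
    · intro y
      refine hasFDerivAt_of_eq ((c1 y).const_mul T).exp (fun z => rfl) fun v => ?_
      simp
      ring
    · intro y
      refine hasFDerivAt_of_eq ((c2 y).exp.const_mul (4 * T / C)) (fun z => rfl) fun v => ?_
      simp [Real.exp_sub]
      field_simp
    · intro y
      refine hasFDerivAt_of_eq (((c2 y).sub ((c1 y).const_mul T)).exp.mul_const (1 / C))
        (fun z => by simp; ring) fun v => ?_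
      simp
      field_simp
      ring
    · intro y
      refine hasFDerivAt_of_eq ((((((c2 y).const_mul 2).sub ((c1 y).const_mul T)).exp).const_mul
        (2 * T ^ 2 / C ^ 2 - 1 / C)).sub ((((c1 y).const_mul T).neg.exp).mul (cs y)))
        (fun z => by simp) fun v => ?_
      have e1 : Real.exp (2 * y 2 - T * y 1) = Real.exp (y 2) ^ 2 * (Real.exp (T * y 1))⁻¹ := by
        rw [← Real.exp_neg, ← Real.exp_nat_mul, ← Real.exp_add]
        push_cast
        ring_nf
      have e2 : Real.exp (2 * T * y 1) = Real.exp (T * y 1) ^ 2 := by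
        rw [← Real.exp_nat_mul]
        push_cast
        ring_nf
      simp [e1, e2, Real.exp_sub, Real.exp_neg]
      field_simp
      ring
    · intro y
      refine hasFDerivAt_of_eq ((c2 y).sub ((c1 y).const_mul T)).exp (fun z => rfl) fun v => ?_
      simp
      field_simp
      ring

theorem SolvesStructureEqs.mono {T C : ℝ} {U V : Set E3} {θ : E3 → Fin 3 → E3 →L[ℝ] ℝ}
    {ε : E3 → ℝ} (h : SolvesStructureEqs T C U θ ε) (hVU : V ⊆ U) :
    SolvesStructureEqs T C V θ ε where
  smooth_coframe := h.smooth_coframe.mono hVU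
  smooth_epsilon := h.smooth_epsilon.mono hVU
  coframe y hy := h.coframe y (hVU hy)
  epsilon_pos y hy := h.epsilon_pos y (hVU hy)
  d_omega0 y hy := h.d_omega0 y (hVU hy)
  d_omega1 y hy := h.d_omega1 y (hVU hy)
  d_omega2 y hy := h.d_omega2 y (hVU hy)
  d_epsilon y hy := h.d_epsilon y (hVU hy)

theorem nonempty_solutionSpace {T C : ℝ} (hTC : C + 2 * T ^ 2 ≠ 0) (U : Set E3) :
    Nonempty (SolutionSpace T C U) := by
  obtain ⟨θ, ε, h⟩ := exists_solves_univ hTC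
  exact ⟨⟨(θ, ε), h.mono (Set.subset_univ U)⟩⟩

end Lorentz3

end

noncomputable section

namespace Lorentz3

/-! ### Families of functions whose derivatives depend continuously on the parameter -/

section JetCont

variable {X : Type*} [TopologicalSpace X] {U : Set E3}

/-- At each point of `U`, the partial derivatives up to order `n` of `F σ` are continuous
in `σ`. -/
def JetCont (U : Set E3) : ℕ → (X → E3 → ℝ) → Prop
  | 0, F => ∀ y ∈ U, Continuous fun σ => F σ y
  | n + 1, F => (∀ y ∈ U, Continuous fun σ => F σ y) ∧
      ∀ i, JetCont U n fun σ => pderiv i (F σ)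

theorem JetCont.of_succ {n : ℕ} {F : X → E3 → ℝ} (h : JetCont U (n + 1) F) : JetCont U n F := by
  induction n generalizing F with
  | zero => exact h.1
  | succ n ih => exact ⟨h.1, fun i => ih (h.2 i)⟩

theorem JetCont.congr (hU : IsOpen U) {n : ℕ} {F G : X → E3 → ℝ} (h : JetCont U n F)
    (hFG : ∀ σ, ∀ y ∈ U, F σ y = G σ y) : JetCont U n G := by
  induction n generalizing F G with
  | zero =>
    intro y hy
    simpa only [hFG _ y hy] using h y hy
  | succ n ih =>
    refine ⟨fun y hy => by simpa only [hFG _ y hy] using h.1 y hy, fun i => ?_⟩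
    exact ih (h.2 i) fun σ y hy => pderiv_congr hU (hFG σ) hy i

/-- The family consists of smooth functions, all of whose derivatives depend continuously on the
parameter. -/
structure SmoothFamily (U : Set E3) (F : X → E3 → ℝ) : Prop where
  smooth : ∀ σ, ContDiffOn ℝ ∞ (F σ) U
  jetCont : ∀ n, JetCont U n F

theorem SmoothFamily.continuous {F : X → E3 → ℝ} (h : SmoothFamily U F) {y : E3} (hy : y ∈ U) :
    Continuous fun σ => F σ y := h.jetCont 0 y hy

theorem SmoothFamily.pderiv (hU : IsOpen U) {F : X → E3 → ℝ} (h : SmoothFamily U F)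
    (i : Fin 3) : SmoothFamily U fun σ => pderiv i (F σ) :=
  ⟨fun σ => contDiffOn_pderiv hU (h.smooth σ) i, fun n => (h.jetCont (n + 1)).2 i⟩

theorem SmoothFamily.const (c : ℝ) : SmoothFamily U fun (_ : X) _ => c := by
  refine ⟨fun _ => contDiffOn_const, fun n => ?_⟩
  induction n generalizing c with
  | zero => exact fun _ _ => continuous_const
  | succ n ih =>
    refine ⟨fun _ _ => continuous_const, fun i => ?_⟩
    have : (fun (_ : X) => Lorentz3.pderiv i fun _ : E3 => c) = fun _ _ => 0 := by
      funext _ y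
      exact pderiv_const i c y
    rw [this]
    exact ih 0

theorem JetCont.add (hU : IsOpen U) {n : ℕ} {F G : X → E3 → ℝ}
    (hF' : ∀ σ, ContDiffOn ℝ ∞ (F σ) U) (hG' : ∀ σ, ContDiffOn ℝ ∞ (G σ) U)
    (hF : JetCont U n F) (hG : JetCont U n G) : JetCont U n fun σ y => F σ y + G σ y := by
  induction n generalizing F G with
  | zero => exact fun y hy => (hF y hy).add (hG y hy)
  | succ n ih =>
    refine ⟨fun y hy => (hF.1 y hy).add (hG.1 y hy), fun i => ?_⟩
    refine (ih (fun σ => contDiffOn_pderiv hU (hF' σ) i)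
      (fun σ => contDiffOn_pderiv hU (hG' σ) i) (hF.2 i) (hG.2 i)).congr hU fun σ y hy => ?_
    exact (pderiv_add (differentiableAt_of_smooth hU (hF' σ) hy)
      (differentiableAt_of_smooth hU (hG' σ) hy) i).symm

theorem JetCont.mul (hU : IsOpen U) {n : ℕ} {F G : X → E3 → ℝ}
    (hF' : ∀ σ, ContDiffOn ℝ ∞ (F σ) U) (hG' : ∀ σ, ContDiffOn ℝ ∞ (G σ) U)
    (hF : JetCont U n F) (hG : JetCont U n G) : JetCont U n fun σ y => F σ y * G σ y := by
  induction n generalizing F G with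
  | zero => exact fun y hy => (hF y hy).mul (hG y hy)
  | succ n ih =>
    refine ⟨fun y hy => (hF.1 y hy).mul (hG.1 y hy), fun i => ?_⟩
    have hFi := fun σ => contDiffOn_pderiv hU (hF' σ) i
    have hGi := fun σ => contDiffOn_pderiv hU (hG' σ) i
    refine (JetCont.add hU (fun σ => (hFi σ).mul (hG' σ)) (fun σ => (hF' σ).mul (hGi σ))
      (ih hFi hG' (hF.2 i) hG.of_succ) (ih hF' hGi hF.of_succ (hG.2 i))).congr hU
      fun σ y hy => ?_
    exact (pderiv_mul (differentiableAt_of_smooth hU (hF' σ) hy)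
      (differentiableAt_of_smooth hU (hG' σ) hy) i).symm

theorem SmoothFamily.add (hU : IsOpen U) {F G : X → E3 → ℝ} (hF : SmoothFamily U F)
    (hG : SmoothFamily U G) : SmoothFamily U fun σ y => F σ y + G σ y :=
  ⟨fun σ => (hF.smooth σ).add (hG.smooth σ), fun n =>
    JetCont.add hU hF.smooth hG.smooth (hF.jetCont n) (hG.jetCont n)⟩

theorem SmoothFamily.mul (hU : IsOpen U) {F G : X → E3 → ℝ} (hF : SmoothFamily U F)
    (hG : SmoothFamily U G) : SmoothFamily U fun σ y => F σ y * G σ y :=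
  ⟨fun σ => (hF.smooth σ).mul (hG.smooth σ), fun n =>
    JetCont.mul hU hF.smooth hG.smooth (hF.jetCont n) (hG.jetCont n)⟩

theorem SmoothFamily.sum (hU : IsOpen U) {ι : Type*} (s : Finset ι) {F : ι → X → E3 → ℝ}
    (hF : ∀ i ∈ s, SmoothFamily U (F i)) : SmoothFamily U fun σ y => ∑ i ∈ s, F i σ y := by
  classical
  induction s using Finset.induction_on with
  | empty => simpa using SmoothFamily.const (X := X) 0
  | insert a s ha ih =>
    simp only [Finset.sum_insert ha]
    exact (hF a (Finset.mem_insert_self a s)).add hU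
      (ih fun i hi => hF i (Finset.mem_insert_of_mem hi))

theorem SmoothFamily.prod (hU : IsOpen U) {ι : Type*} (s : Finset ι) {F : ι → X → E3 → ℝ}
    (hF : ∀ i ∈ s, SmoothFamily U (F i)) : SmoothFamily U fun σ y => ∏ i ∈ s, F i σ y := by
  classical
  induction s using Finset.induction_on with
  | empty => simpa using SmoothFamily.const (X := X) 1
  | insert a s ha ih =>
    simp only [Finset.prod_insert ha]
    exact (hF a (Finset.mem_insert_self a s)).mul hU
      (ih fun i hi => hF i (Finset.mem_insert_of_mem hi))

theorem pderiv_inv {f : E3 → ℝ} {y : E3} (hf : DifferentiableAt ℝ f y) (h0 : f y ≠ 0)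
    (i : Fin 3) : pderiv i (fun z => (f z)⁻¹) y = -1 * (pderiv i f y * ((f y)⁻¹ * (f y)⁻¹)) := by
  have h : HasFDerivAt (fun z => (f z)⁻¹) _ y :=
    (hasDerivAt_inv h0).comp_hasFDerivAt y hf.hasFDerivAt
  rw [pderiv, pderiv, h.fderiv]
  simp
  field_simp

/-- Induction on the order: ∂(1/F) = -∂F · (1/F)² expresses derivatives of order n+1 by those of 1/F
up to order n. -/
theorem SmoothFamily.inv (hU : IsOpen U) {F : X → E3 → ℝ} (hF : SmoothFamily U F)
    (h0 : ∀ σ, ∀ y ∈ U, F σ y ≠ 0) : SmoothFamily U fun σ y => (F σ y)⁻¹ := by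
  have hs : ∀ σ, ContDiffOn ℝ ∞ (fun y => (F σ y)⁻¹) U := fun σ => (hF.smooth σ).inv (h0 σ)
  refine ⟨hs, fun n => ?_⟩
  have hc : ∀ y ∈ U, Continuous fun σ => (F σ y)⁻¹ := fun y hy =>
    (hF.continuous hy).inv₀ fun σ => h0 σ y hy
  induction n with
  | zero => exact hc
  | succ n ih =>
    refine ⟨hc, fun i => ?_⟩
    have hFi := hF.pderiv hU i
    refine JetCont.congr hU (F := fun σ y => -1 * (Lorentz3.pderiv i (F σ) y *
      ((F σ y)⁻¹ * (F σ y)⁻¹))) ?_ fun σ y hy =>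
      (pderiv_inv (differentiableAt_of_smooth hU (hF.smooth σ) hy) (h0 σ y hy) i).symm
    refine JetCont.mul hU (fun _ => contDiffOn_const)
      (fun σ => (hFi.smooth σ).mul ((hs σ).mul (hs σ))) ((SmoothFamily.const (-1)).jetCont n) ?_
    exact JetCont.mul hU hFi.smooth (fun σ => (hs σ).mul (hs σ)) (hFi.jetCont n)
      (JetCont.mul hU hs hs ih ih)

theorem SmoothFamily.det (hU : IsOpen U) {A : X → E3 → Matrix (Fin 3) (Fin 3) ℝ}
    (hA : ∀ a b, SmoothFamily U fun σ y => A σ y a b) :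
    SmoothFamily U fun σ y => (A σ y).det := by
  simp only [Matrix.det_apply, Units.smul_def, zsmul_eq_mul]
  exact SmoothFamily.sum hU _ fun τ _ => (SmoothFamily.const _).mul hU
    (SmoothFamily.prod hU _ fun i _ => hA _ _)

theorem SmoothFamily.matrix_inv (hU : IsOpen U) {A : X → E3 → Matrix (Fin 3) (Fin 3) ℝ}
    (hA : ∀ a b, SmoothFamily U fun σ y => A σ y a b) (hdet : ∀ σ, ∀ y ∈ U, (A σ y).det ≠ 0)
    (a b : Fin 3) : SmoothFamily U fun σ y => (A σ y)⁻¹ a b := by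
  simp only [Matrix.inv_def, Matrix.smul_apply, Ring.inverse_eq_inv', smul_eq_mul,
    Matrix.adjugate_apply]
  refine ((SmoothFamily.det hU hA).inv hU hdet).mul hU
    (SmoothFamily.det hU (A := fun σ z => (A σ z).updateRow b (Pi.single a 1)) fun c d => ?_)
  by_cases h : c = b
  · subst h
    simp only [Matrix.updateRow_self]
    exact SmoothFamily.const _
  · simp only [Matrix.updateRow_ne h]
    exact hA c d

/-- Passes from the iterated derivatives that define the topology to iterated partial derivatives.
In the induction, the j-th derivative of a partial derivative is a continuous linear image of the
(j+1)-st derivative. -/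
theorem smoothFamily_clm_comp {F : Type*} [NormedAddCommGroup F] [NormedSpace ℝ F] (hU : IsOpen U)
    {G : X → E3 → F} (hs : ∀ σ, ContDiffOn ℝ ∞ (G σ) U)
    (hc : ∀ j : ℕ, ∀ y ∈ U, Continuous fun σ => iteratedFDeriv ℝ j (G σ) y) (φ : F →L[ℝ] ℝ) :
    SmoothFamily U fun σ y => φ (G σ y) := by
  refine ⟨fun σ => φ.contDiff.comp_contDiffOn (hs σ), fun n => ?_⟩
  have h0 : ∀ (G : X → E3 → F), (∀ j : ℕ, ∀ y ∈ U, Continuous fun σ =>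
      iteratedFDeriv ℝ j (G σ) y) → ∀ y ∈ U, Continuous fun σ => φ (G σ y) := by
    intro G hc y hy
    have h1 := hc 0 y hy
    have h2 : Continuous fun σ => iteratedFDeriv ℝ 0 (G σ) y 0 := by fun_prop
    exact φ.continuous.comp h2
  induction n generalizing G with
  | zero => exact h0 G hc
  | succ n ih =>
    refine ⟨h0 G hc, fun i => ?_⟩
    let A : (E3 →L[ℝ] F) →L[ℝ] F := ContinuousLinearMap.apply ℝ F (coordVec i)
    have hf : ∀ σ, ContDiffOn ℝ ∞ (fderiv ℝ (G σ)) U := fun σ =>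
      (hs σ).fderiv_of_isOpen hU (by simp)
    refine JetCont.congr hU (ih (G := fun σ y => A (fderiv ℝ (G σ) y))
      (fun σ => A.contDiff.comp_contDiffOn (hf σ)) ?_) fun σ y hy => ?_
    · intro j y hy
      have h1 : ∀ σ, iteratedFDeriv ℝ j (fun y => A (fderiv ℝ (G σ) y)) y =
          A.compContinuousMultilinearMap (continuousMultilinearCurryRightEquiv' ℝ j E3 F
            (iteratedFDeriv ℝ (j + 1) (G σ) y)) := by
        intro σ
        rw [iteratedFDeriv_succ_eq_comp_right]
        simp only [Function.comp_apply, LinearIsometryEquiv.apply_symm_apply]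
        exact A.iteratedFDeriv_comp_left ((hf σ).contDiffAt (hU.mem_nhds hy))
          (WithTop.coe_le_coe.2 le_top)
      simp only [h1]
      have h2 := hc (j + 1) y hy
      exact (ContinuousLinearMap.compContinuousMultilinearMapL ℝ (fun _ : Fin j => E3)
        (E3 →L[ℝ] F) F A).continuous.comp ((LinearIsometryEquiv.continuous _).comp h2)
    · have hd := differentiableAt_of_smooth hU (hs σ) hy
      exact (congrArg (fun L : E3 →L[ℝ] ℝ => L (coordVec i))
        (φ.hasFDerivAt.comp y hd.hasFDerivAt).fderiv).symm

end JetCont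

/-! ### Functional independence is an open condition -/

section Openness

variable {T C : ℝ} {U : Set E3}

/-- A singleton is compact, so convergence on compact subsets includes convergence at the point. -/
theorem continuous_iteratedFDeriv_omega (j : ℕ) {y : E3} (hy : y ∈ U) :
    Continuous fun σ : SolutionSpace T C U => iteratedFDeriv ℝ j σ.omega y := by
  have h1 : Continuous fun σ : SolutionSpace T C U =>
      UniformOnFun.ofFun {K : Set E3 | IsCompact K ∧ K ⊆ U} (iteratedFDeriv ℝ j σ.omega) := by
    rw [continuous_iff_le_induced]
    exact inf_le_left.trans (iInf_le _ j)
  have hm : ({y} : Set E3) ∈ {K : Set E3 | IsCompact K ∧ K ⊆ U} :=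
    ⟨isCompact_singleton, Set.singleton_subset_iff.2 hy⟩
  exact (UniformOnFun.uniformContinuous_eval_of_mem _ _ (Set.mem_singleton y) hm).continuous.comp
    h1

theorem continuous_iteratedFDeriv_eps (j : ℕ) {y : E3} (hy : y ∈ U) :
    Continuous fun σ : SolutionSpace T C U => iteratedFDeriv ℝ j σ.eps y := by
  have h1 : Continuous fun σ : SolutionSpace T C U =>
      UniformOnFun.ofFun {K : Set E3 | IsCompact K ∧ K ⊆ U} (iteratedFDeriv ℝ j σ.eps) := by
    rw [continuous_iff_le_induced]
    exact inf_le_right.trans (iInf_le _ j)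
  have hm : ({y} : Set E3) ∈ {K : Set E3 | IsCompact K ∧ K ⊆ U} :=
    ⟨isCompact_singleton, Set.singleton_subset_iff.2 hy⟩
  exact (UniformOnFun.uniformContinuous_eval_of_mem _ _ (Set.mem_singleton y) hm).continuous.comp
    h1

theorem smoothFamily_eps (hU : IsOpen U) :
    SmoothFamily U fun σ : SolutionSpace T C U => σ.eps :=
  smoothFamily_clm_comp hU (fun σ : SolutionSpace T C U => σ.2.smooth_epsilon)
    (fun j _ hy => continuous_iteratedFDeriv_eps j hy) (ContinuousLinearMap.id ℝ ℝ)

theorem smoothFamily_cofMat (hU : IsOpen U) (a j : Fin 3) :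
    SmoothFamily U fun (σ : SolutionSpace T C U) y => cofMat σ.omega y a j :=
  smoothFamily_clm_comp hU (fun σ : SolutionSpace T C U => σ.2.smooth_coframe)
    (fun j _ hy => continuous_iteratedFDeriv_omega j hy)
    ((ContinuousLinearMap.apply ℝ ℝ (coordVec j)).comp (ContinuousLinearMap.proj a))

theorem opD_eq_sum (θ : E3 → Fin 3 → E3 →L[ℝ] ℝ) (f : E3 → ℝ) (y : E3) :
    opD θ f y = ∑ i, (cofMat θ y)⁻¹ i 0 * pderiv i f y := clm_apply_eq_sum _ _

theorem SmoothFamily.opD (hU : IsOpen U) {F : SolutionSpace T C U → E3 → ℝ}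
    (hF : SmoothFamily U F) : SmoothFamily U fun σ => opD σ.omega (F σ) := by
  simp only [funext (opD_eq_sum _ _)]
  exact SmoothFamily.sum hU _ fun i _ => (SmoothFamily.matrix_inv hU (smoothFamily_cofMat hU)
    (fun σ y hy => σ.2.det_ne_zero y hy) i 0).mul hU (hF.pderiv hU i)

theorem linearIndependent_of_det_ne_zero {α : Fin 3 → E3 →L[ℝ] ℝ} {v : Fin 3 → E3}
    (h : (Matrix.of fun a b => α a (v b)).det ≠ 0) : LinearIndependent ℝ α := by
  rw [← isUnit_iff_ne_zero, ← Matrix.isUnit_iff_isUnit_det,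
    ← Matrix.linearIndependent_rows_iff_isUnit] at h
  let L : (E3 →L[ℝ] ℝ) →ₗ[ℝ] (Fin 3 → ℝ) :=
    { toFun := fun φ j => φ (v j)
      map_add' := fun _ _ => rfl
      map_smul' := fun _ _ => rfl }
  exact LinearIndependent.of_comp L h

/-- Independence is nonvanishing of a determinant of partial derivatives of ε, Dε, D²ε. Since D is
built from the inverse coframe matrix, these depend continuously on the solution. -/
theorem isOpen_functionallyIndependentAt (hU : IsOpen U) {y : E3} (hy : y ∈ U) :
    IsOpen {σ : SolutionSpace T C U | FunctionallyIndependentAt σ.omega σ.eps y} := by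
  have h1 : {σ : SolutionSpace T C U | FunctionallyIndependentAt σ.omega σ.eps y} =
      {σ | (cofMat (invDiff σ.omega σ.eps) y).det ≠ 0} := by
    ext σ
    exact ⟨fun h => det_cofMat_ne_zero (θ := invDiff σ.omega σ.eps) h,
      fun h => linearIndependent_of_det_ne_zero h⟩
  rw [h1]
  refine isOpen_ne.preimage (Continuous.matrix_det (continuous_matrix fun a b => ?_))
  have h0 := smoothFamily_eps (T := T) (C := C) hU
  fin_cases a
  · exact (h0.pderiv hU b).continuous hy
  · exact ((SmoothFamily.opD hU h0).pderiv hU b).continuous hy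
  · exact ((SmoothFamily.opD hU (SmoothFamily.opD hU h0)).pderiv hU b).continuous hy

end Openness

end Lorentz3

end

noncomputable section

namespace Lorentz3

/-! ### Integrability conditions -/

section Integrability

variable {T C : ℝ} {U : Set E3} {θ : E3 → Fin 3 → E3 →L[ℝ] ℝ} {ε : E3 → ℝ}

theorem fderiv_fderiv_symm (hU : IsOpen U) {f : E3 → ℝ} (hf : ContDiffOn ℝ ∞ f U) {y : E3}
    (hy : y ∈ U) (v w : E3) : fderiv ℝ (fderiv ℝ f) y v w = fderiv ℝ (fderiv ℝ f) y w v :=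
  (hf.contDiffAt (hU.mem_nhds hy)).isSymmSndFDerivAt
    (by rw [minSmoothness_of_isRCLikeNormedField]; exact WithTop.coe_le_coe.2 le_top) v w

/-- The exterior derivative of a combination of the coframe. -/
theorem dForm_sum (hU : IsOpen U) (hθ : ContDiffOn ℝ ∞ θ U) {c : Fin 3 → E3 → ℝ}
    (hc : ∀ a, ContDiffOn ℝ ∞ (c a) U) {y : E3} (hy : y ∈ U) (v w : E3) :
    dForm (fun z => ∑ a, c a z • θ z a) y v w =
      ∑ a, (wedge (fderiv ℝ (c a) y) (θ y a) v w + c a y * dForm (fun z => θ z a) y v w) := by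
  have hd : ∀ a, HasFDerivAt (fun z => c a z • θ z a) _ y := fun a =>
    (differentiableAt_of_smooth hU (hc a) hy).hasFDerivAt.smul
      (differentiableAt_of_smooth hU (contDiffOn_pi.1 hθ a) hy).hasFDerivAt
  rw [dForm_eq (HasFDerivAt.fun_sum fun a _ => hd a)]
  simp only [_root_.sum_apply, ← Finset.sum_sub_distrib]
  refine Finset.sum_congr rfl fun a _ => ?_
  simp [wedge, dForm]
  ring

theorem dForm_congr (hU : IsOpen U) {α β : E3 → E3 →L[ℝ] ℝ} (h : ∀ z ∈ U, α z = β z) {y : E3}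
    (hy : y ∈ U) (v w : E3) : dForm α y v w = dForm β y v w := by
  have : α =ᶠ[𝓝 y] β := Filter.eventually_of_mem (hU.mem_nhds hy) h
  rw [dForm, dForm, this.fderiv_eq]

/-- `d² = 0` for a function whose differential is expanded in the coframe. -/
theorem sum_wedge_add_dForm_eq_zero (hU : IsOpen U) (hθ : ContDiffOn ℝ ∞ θ U)
    {c : Fin 3 → E3 → ℝ} (hc : ∀ a, ContDiffOn ℝ ∞ (c a) U) {f : E3 → ℝ}
    (hf : ContDiffOn ℝ ∞ f U) (h : ∀ z ∈ U, fderiv ℝ f z = ∑ a, c a z • θ z a) {y : E3}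
    (hy : y ∈ U) (v w : E3) :
    ∑ a, (wedge (fderiv ℝ (c a) y) (θ y a) v w + c a y * dForm (fun z => θ z a) y v w) = 0 := by
  rw [← dForm_sum hU hθ hc hy, ← dForm_congr hU h hy, dForm, fderiv_fderiv_symm hU hf hy, sub_self]

theorem clm_eq_sum_dualFrame {y : E3} (h : LinearIndependent ℝ (θ y)) (φ : E3 →L[ℝ] ℝ) :
    φ = ∑ b, φ (dualFrame θ y b) • θ y b := by
  ext v
  conv_lhs => rw [← sum_apply_smul_dualFrame h v]
  simp [mul_comm]

/-- If `df = c₀ θ⁰ + c₁ θ¹ + c₂ θ²`, then `c₁` and `c₂` determine the derivatives of `c₀` along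
`e₁` and `e₂`. -/
theorem SolvesStructureEqs.fderiv_coeff (hU : IsOpen U) (h : SolvesStructureEqs T C U θ ε)
    {c : Fin 3 → E3 → ℝ} (hc : ∀ a, ContDiffOn ℝ ∞ (c a) U) {f : E3 → ℝ}
    (hf : ContDiffOn ℝ ∞ f U) (hfc : ∀ z ∈ U, fderiv ℝ f z = ∑ a, c a z • θ z a) {y : E3}
    (hy : y ∈ U) :
    fderiv ℝ (c 0) y (dualFrame θ y 1) =
      -T * c 0 y + fderiv ℝ (c 1) y (dualFrame θ y 0) + c 2 y ∧
    fderiv ℝ (c 0) y (dualFrame θ y 2) =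
      -4 * T * c 1 y + fderiv ℝ (c 2) y (dualFrame θ y 0) + 2 * ε y * c 2 y := by
  have h1 := sum_wedge_add_dForm_eq_zero hU h.smooth_coframe hc hf hfc hy
    (dualFrame θ y 0) (dualFrame θ y 1)
  have h2 := sum_wedge_add_dForm_eq_zero hU h.smooth_coframe hc hf hfc hy
    (dualFrame θ y 0) (dualFrame θ y 2)
  simp only [Fin.sum_univ_three, h.d_omega0 y hy, h.d_omega1 y hy, h.d_omega2 y hy, wedge,
    apply_dualFrame (h.coframe y hy)] at h1 h2
  simp at h1 h2
  constructor <;> linarith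

/-- From d²ε = 0: the equation for dε prescribes two of the three coefficients, so the derivatives
of Dε along e₁ and e₂ are determined and only D²ε is new. -/
theorem SolvesStructureEqs.fderiv_opD_epsilon (hU : IsOpen U) (h : SolvesStructureEqs T C U θ ε)
    {y : E3} (hy : y ∈ U) :
    fderiv ℝ (opD θ ε) y = opD θ (opD θ ε) y • θ y 0 + (C - 2 * T * opD θ ε y) • θ y 1
      + (2 * (C + 2 * T ^ 2) * ε y) • θ y 2 := by
  have hε := h.smooth_epsilon
  obtain ⟨h1, h2⟩ := h.fderiv_coeff hU
    (c := ![opD θ ε, fun z => -T * ε z, fun _ => C]) (f := ε) (by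
      intro a
      fin_cases a
      · exact h.contDiffOn_opD hU hε
      · exact contDiffOn_const.mul hε
      · exact contDiffOn_const) hε (by
      intro z hz
      rw [h.d_epsilon z hz, Fin.sum_univ_three]
      simp
      module) hy
  have h3 : fderiv ℝ (fun z => -T * ε z) y = -T • fderiv ℝ ε y :=
    fderiv_const_mul (differentiableAt_of_smooth hU hε hy) _
  have h4 : opD θ ε y = fderiv ℝ ε y (dualFrame θ y 0) := rfl
  simp only [Matrix.cons_val_zero, Matrix.cons_val_one, Matrix.cons_val, h3,
    _root_.smul_apply, smul_eq_mul, ← h4, fderiv_fun_const, Pi.zero_apply,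
    _root_.zero_apply] at h1 h2
  rw [clm_eq_sum_dualFrame (h.coframe y hy) (fderiv ℝ (opD θ ε) y), Fin.sum_univ_three]
  congr 1
  · congr 1
    rw [h1]
    congr 1
    ring
  · rw [h2]
    congr 1
    ring

/-- The same argument one order higher, from d²(Dε) = 0. -/
theorem SolvesStructureEqs.fderiv_opD_opD_epsilon (hU : IsOpen U)
    (h : SolvesStructureEqs T C U θ ε) {y : E3} (hy : y ∈ U) :
    fderiv ℝ (opD θ (opD θ ε)) y (dualFrame θ y 1) =
      -3 * T * opD θ (opD θ ε) y + 2 * (C + 2 * T ^ 2) * ε y ∧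
    fderiv ℝ (opD θ (opD θ ε)) y (dualFrame θ y 2) =
      (2 * (C + 2 * T ^ 2) + 8 * T ^ 2) * opD θ ε y - 4 * T * C
        + 4 * (C + 2 * T ^ 2) * ε y ^ 2 := by
  have hε := h.smooth_epsilon
  have hP := h.contDiffOn_opD hU hε
  obtain ⟨h1, h2⟩ := h.fderiv_coeff hU
    (c := ![opD θ (opD θ ε), fun z => C + -2 * T * opD θ ε z,
      fun z => 2 * (C + 2 * T ^ 2) * ε z]) (f := opD θ ε) (by
      intro a
      fin_cases a
      · exact h.contDiffOn_opD hU hP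
      · exact contDiffOn_const.add (contDiffOn_const.mul hP)
      · exact contDiffOn_const.mul hε) hP (by
      intro z hz
      rw [h.fderiv_opD_epsilon hU hz, Fin.sum_univ_three]
      simp [sub_eq_add_neg]) hy
  have h3 : fderiv ℝ (fun z => C + -2 * T * opD θ ε z) y = (-2 * T) • fderiv ℝ (opD θ ε) y := by
    rw [fderiv_const_add]
    exact fderiv_const_mul (differentiableAt_of_smooth hU hP hy) _
  have h4 : fderiv ℝ (fun z => 2 * (C + 2 * T ^ 2) * ε z) y =
      (2 * (C + 2 * T ^ 2)) • fderiv ℝ ε y :=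
    fderiv_const_mul (differentiableAt_of_smooth hU hε hy) _
  have h5 : opD θ ε y = fderiv ℝ ε y (dualFrame θ y 0) := rfl
  have h6 : opD θ (opD θ ε) y = fderiv ℝ (opD θ ε) y (dualFrame θ y 0) := rfl
  simp only [Matrix.cons_val_zero, Matrix.cons_val_one, Matrix.cons_val, h3, h4,
    _root_.smul_apply, smul_eq_mul, ← h5, ← h6] at h1 h2
  rw [h1, h2]
  constructor <;> ring

/-- The determinant of the differentials of `ε`, `Dε`, `D²ε` in the coframe, as a function of
the values `P, Q, N` of `Dε`, `D²ε`, `D³ε`. -/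
def indepDet (T C e P Q N : ℝ) : ℝ :=
  Matrix.det !![P, -T * e, C; Q, C - 2 * T * P, 2 * (C + 2 * T ^ 2) * e;
    N, -3 * T * Q + 2 * (C + 2 * T ^ 2) * e,
    (2 * (C + 2 * T ^ 2) + 8 * T ^ 2) * P - 4 * T * C + 4 * (C + 2 * T ^ 2) * e ^ 2]

theorem SolvesStructureEqs.functionallyIndependentAt (hU : IsOpen U)
    (h : SolvesStructureEqs T C U θ ε) {y : E3} (hy : y ∈ U)
    (hdet : indepDet T C (ε y) (opD θ ε y) (opD θ (opD θ ε) y) (opD θ (opD θ (opD θ ε)) y) ≠ 0) :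
    FunctionallyIndependentAt θ ε y := by
  refine linearIndependent_of_det_ne_zero (v := dualFrame θ y) ?_
  convert hdet using 1
  rw [indepDet]
  congr 1
  obtain ⟨h1, h2⟩ := h.fderiv_opD_opD_epsilon hU hy
  have h3 := h.fderiv_epsilon_dualFrame hy
  have h4 := h.fderiv_opD_epsilon hU hy
  ext a b
  fin_cases a
  · exact (h3 b).trans (by fin_cases b <;> rfl)
  · change fderiv ℝ (opD θ ε) y (dualFrame θ y b) = _
    rw [h4]
    fin_cases b <;> simp [apply_dualFrame (h.coframe y hy)]
  · fin_cases b
    · rfl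
    · exact h1
    · exact h2

end Integrability

end Lorentz3

end

noncomputable section

namespace Lorentz3

/-! ### Shifting a solution -/

/-- A function `h` for which replacing `θ²` by `θ² + h θ⁰` preserves the structure equations. -/
structure AdmissibleShift (T : ℝ) (U : Set E3) (θ : E3 → Fin 3 → E3 →L[ℝ] ℝ) (h : E3 → ℝ) :
    Prop where
  smooth : ContDiffOn ℝ ∞ h U
  fderiv_eq : ∀ y ∈ U, fderiv ℝ h y = opD θ h y • θ y 0 + (-2 * T * h y) • θ y 1

/-- The coframe `θ⁰, θ¹, θ² + h θ⁰`. -/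
def shiftCoframe (θ : E3 → Fin 3 → E3 →L[ℝ] ℝ) (h : E3 → ℝ) : E3 → Fin 3 → E3 →L[ℝ] ℝ :=
  fun y => ![θ y 0, θ y 1, θ y 2 + h y • θ y 0]

theorem opD_congr {U : Set E3} (hU : IsOpen U) {θ : E3 → Fin 3 → E3 →L[ℝ] ℝ} {f f' : E3 → ℝ}
    (h : ∀ z ∈ U, f z = f' z) {y : E3} (hy : y ∈ U) : opD θ f y = opD θ f' y := by
  have : f =ᶠ[𝓝 y] f' := Filter.eventually_of_mem (hU.mem_nhds hy) h
  rw [opD, opD, this.fderiv_eq]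

section Shift

variable {T C : ℝ} {U : Set E3} {θ : E3 → Fin 3 → E3 →L[ℝ] ℝ} {ε h : E3 → ℝ}

theorem linearIndependent_shiftCoframe {y : E3} (hθ : LinearIndependent ℝ (θ y)) :
    LinearIndependent ℝ (shiftCoframe θ h y) := by
  refine linearIndependent_of_det_ne_zero (v := dualFrame θ y) ?_
  rw [Matrix.det_fin_three]
  simp [shiftCoframe, apply_dualFrame hθ]

theorem dualFrame_shiftCoframe {y : E3} (hθ : LinearIndependent ℝ (θ y)) :
    dualFrame (shiftCoframe θ h) y 0 = dualFrame θ y 0 - h y • dualFrame θ y 2 := by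
  rw [← sum_apply_smul_dualFrame (linearIndependent_shiftCoframe (h := h) hθ)
    (dualFrame θ y 0 - h y • dualFrame θ y 2), Fin.sum_univ_three]
  simp [shiftCoframe, apply_dualFrame hθ]

theorem opD_shiftCoframe {y : E3} (hθ : LinearIndependent ℝ (θ y)) (f : E3 → ℝ) :
    opD (shiftCoframe θ h) f y = opD θ f y - h y * fderiv ℝ f y (dualFrame θ y 2) := by
  rw [opD, dualFrame_shiftCoframe hθ, map_sub, map_smul, smul_eq_mul, opD]

/-- Terms with ω⁰∧ω² do not notice the shift, as ω⁰∧ω⁰ = 0. In dω² the extra dh∧ω⁰ + h dω⁰ equals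
-Tω¹∧hω⁰ precisely because the ω¹-coefficient of dh is -2Th. The function ε stays, but e₀ becomes e₀
- h e₂, so Dε changes. -/
theorem SolvesStructureEqs.shift (hU : IsOpen U) (hs : SolvesStructureEqs T C U θ ε)
    (hh : AdmissibleShift T U θ h) : SolvesStructureEqs T C U (shiftCoframe θ h) ε where
  smooth_coframe := by
    have hθ := contDiffOn_pi.1 hs.smooth_coframe
    refine contDiffOn_pi.2 fun i => ?_
    fin_cases i
    · exact hθ 0
    · exact hθ 1
    · exact (hθ 2).add (hh.smooth.smul (hθ 0))
  smooth_epsilon := hs.smooth_epsilon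
  coframe y hy := linearIndependent_shiftCoframe (hs.coframe y hy)
  epsilon_pos := hs.epsilon_pos
  d_omega0 := hs.d_omega0
  d_omega1 y hy v w := by
    have := hs.d_omega1 y hy v w
    simp only [shiftCoframe, Matrix.cons_val_zero, Matrix.cons_val_one, Matrix.cons_val, wedge,
      _root_.add_apply, _root_.smul_apply, smul_eq_mul] at this ⊢
    rw [this]
    ring
  d_omega2 y hy v w := by
    have hθ := contDiffOn_pi.1 hs.smooth_coframe
    have h1 : dForm (fun z => θ z 2 + h z • θ z 0) y v w = dForm (fun z => θ z 2) y v w +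
        (wedge (fderiv ℝ h y) (θ y 0) v w + h y * dForm (fun z => θ z 0) y v w) := by
      have := dForm_sum hU hs.smooth_coframe (c := ![h, 0, fun _ => 1]) (by
        intro a
        fin_cases a
        · exact hh.smooth
        · exact contDiffOn_const
        · exact contDiffOn_const) hy v w
      simp [Fin.sum_univ_three, wedge] at this
      simp only [add_comm (θ _ 2), wedge]
      rw [this]
      ring
    change dForm (fun z => θ z 2 + h z • θ z 0) y v w = _
    rw [h1, hs.d_omega2 y hy, hs.d_omega0 y hy, hh.fderiv_eq y hy]
    simp only [shiftCoframe, Matrix.cons_val_zero, Matrix.cons_val_one, Matrix.cons_val, wedge,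
      _root_.add_apply, _root_.smul_apply, smul_eq_mul]
    ring
  d_epsilon y hy := by
    have h2 := hs.fderiv_epsilon_dualFrame hy 2
    rw [opD_shiftCoframe (hs.coframe y hy), h2, hs.d_epsilon y hy]
    simp [shiftCoframe]
    module

/-- From d²h = 0; needed because the shifted D involves e₂, which is applied to Dh when D³ε is
recomputed. -/
theorem AdmissibleShift.fderiv_opD (hU : IsOpen U) (hs : SolvesStructureEqs T C U θ ε)
    (hh : AdmissibleShift T U θ h) {y : E3} (hy : y ∈ U) :
    fderiv ℝ (opD θ h) y (dualFrame θ y 2) = 8 * T ^ 2 * h y := by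
  obtain ⟨-, h2⟩ := hs.fderiv_coeff hU
    (c := ![opD θ h, fun z => -2 * T * h z, fun _ => 0]) (f := h) (by
      intro a
      fin_cases a
      · exact hs.contDiffOn_opD hU hh.smooth
      · exact contDiffOn_const.mul hh.smooth
      · exact contDiffOn_const) hh.smooth (by
      intro z hz
      rw [hh.fderiv_eq z hz, Fin.sum_univ_three]
      simp) hy
  simp at h2
  rw [h2]
  ring

theorem opD_shift_epsilon (hs : SolvesStructureEqs T C U θ ε) {y : E3} (hy : y ∈ U) :
    opD (shiftCoframe θ h) ε y = opD θ ε y - C * h y := by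
  rw [opD_shiftCoframe (hs.coframe y hy), hs.fderiv_epsilon_dualFrame hy 2]
  simp [mul_comm]

theorem opD_opD_shift_epsilon (hU : IsOpen U) (hs : SolvesStructureEqs T C U θ ε)
    (hh : AdmissibleShift T U θ h) {y : E3} (hy : y ∈ U) :
    opD (shiftCoframe θ h) (opD (shiftCoframe θ h) ε) y =
      opD θ (opD θ ε) y - C * opD θ h y - 2 * (C + 2 * T ^ 2) * (ε y * h y) := by
  have hli := hs.coframe y hy
  rw [opD_congr hU (f' := fun z => opD θ ε z - C * h z)
    (fun z hz => opD_shift_epsilon hs hz) hy, opD_shiftCoframe hli]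
  have hd : HasFDerivAt (fun z => opD θ ε z - C * h z) _ y :=
    (differentiableAt_of_smooth hU (hs.contDiffOn_opD hU hs.smooth_epsilon) hy).hasFDerivAt.sub
      ((differentiableAt_of_smooth hU hh.smooth hy).hasFDerivAt.const_mul C)
  have h1 := hs.fderiv_opD_epsilon hU hy
  have h2 := hh.fderiv_eq y hy
  rw [opD, hd.fderiv, h1, h2]
  simp [apply_dualFrame hli]
  ring

theorem opD_opD_opD_shift_epsilon (hU : IsOpen U) (hs : SolvesStructureEqs T C U θ ε)
    (hh : AdmissibleShift T U θ h) {y : E3} (hy : y ∈ U) :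
    opD (shiftCoframe θ h) (opD (shiftCoframe θ h) (opD (shiftCoframe θ h) ε)) y =
      opD θ (opD θ (opD θ ε)) y - C * opD θ (opD θ h) y
        - 2 * (C + 2 * T ^ 2) * (opD θ ε y * h y + ε y * opD θ h y)
        - h y * ((2 * (C + 2 * T ^ 2) + 8 * T ^ 2) * opD θ ε y - 4 * T * C
          + 4 * (C + 2 * T ^ 2) * ε y ^ 2 - 8 * C * T ^ 2 * h y
          - 2 * (C + 2 * T ^ 2) * C * h y) := by
  have hli := hs.coframe y hy
  rw [opD_congr hU (f' := fun z => opD θ (opD θ ε) z - C * opD θ h z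
    - 2 * (C + 2 * T ^ 2) * (ε z * h z))
    (fun z hz => opD_opD_shift_epsilon hU hs hh hz) hy, opD_shiftCoframe hli]
  have hP := hs.contDiffOn_opD hU hs.smooth_epsilon
  have hd : HasFDerivAt (fun z => opD θ (opD θ ε) z - C * opD θ h z
      - 2 * (C + 2 * T ^ 2) * (ε z * h z)) _ y :=
    ((differentiableAt_of_smooth hU (hs.contDiffOn_opD hU hP) hy).hasFDerivAt.sub
      ((differentiableAt_of_smooth hU (hs.contDiffOn_opD hU hh.smooth) hy).hasFDerivAt.const_mul
        C)).sub (((differentiableAt_of_smooth hU hs.smooth_epsilon hy).hasFDerivAt.mul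
        (differentiableAt_of_smooth hU hh.smooth hy).hasFDerivAt).const_mul _)
  obtain ⟨-, h1⟩ := hs.fderiv_opD_opD_epsilon hU hy
  have h2 := hh.fderiv_opD hU hs hy
  have h3 := hs.d_epsilon y hy
  have h4 := hh.fderiv_eq y hy
  rw [opD, hd.fderiv, h3, h4]
  simp only [_root_.sub_apply, _root_.add_apply, _root_.smul_apply, smul_eq_mul, h1, h2,
    apply_dualFrame hli]
  rw [show opD θ (opD θ (opD θ ε)) y = fderiv ℝ (opD θ (opD θ ε)) y (dualFrame θ y 0) from rfl,
    show opD θ (opD θ h) y = fderiv ℝ (opD θ h) y (dualFrame θ y 0) from rfl]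
  simp
  ring

/-- The determinant `indepDet` of a shifted solution, as a function of the values `x` of
`h`, `Dh`, `D²h`. -/
def shiftDet (T C e P Q N : ℝ) (x : Fin 3 → ℝ) : ℝ :=
  indepDet T C e (P - C * x 0) (Q - C * x 1 - 2 * (C + 2 * T ^ 2) * (e * x 0))
    (N - C * x 2 - 2 * (C + 2 * T ^ 2) * (P * x 0 + e * x 1)
      - x 0 * ((2 * (C + 2 * T ^ 2) + 8 * T ^ 2) * P - 4 * T * C
        + 4 * (C + 2 * T ^ 2) * e ^ 2 - 8 * C * T ^ 2 * x 0 - 2 * (C + 2 * T ^ 2) * C * x 0))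

theorem functionallyIndependentAt_shift (hU : IsOpen U) (hs : SolvesStructureEqs T C U θ ε)
    (hh : AdmissibleShift T U θ h) {y : E3} (hy : y ∈ U)
    (hdet : shiftDet T C (ε y) (opD θ ε y) (opD θ (opD θ ε) y) (opD θ (opD θ (opD θ ε)) y)
      ![h y, opD θ h y, opD θ (opD θ h) y] ≠ 0) :
    FunctionallyIndependentAt (shiftCoframe θ h) ε y := by
  refine (hs.shift hU hh).functionallyIndependentAt hU hy ?_
  rw [opD_shift_epsilon hs hy, opD_opD_shift_epsilon hU hs hh hy,
    opD_opD_opD_shift_epsilon hU hs hh hy]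
  exact hdet

/-- If C ≠ 0, the determinant is affine in D²h, and its slope depends on h through Dε - Ch;
vanishing of the slope at h = 0 and h = 1 gives T = 0 and then C = 0. If C = 0, D²h drops out, but
Dh enters with coefficient 16T⁵ε³. -/
theorem exists_shiftDet_ne_zero (hTC : C + 2 * T ^ 2 ≠ 0) {e : ℝ} (he : 0 < e) (P Q N : ℝ) :
    ∃ x, shiftDet T C e P Q N x ≠ 0 := by
  by_contra! hzero
  have h0 := hzero ![0, 0, 0]
  have h1 := hzero ![0, 0, 1]
  have h2 := hzero ![0, 1, 0]
  have h3 := hzero ![1, 0, 0]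
  have h4 := hzero ![1, 0, 1]
  simp only [shiftDet, indepDet, Matrix.det_fin_three, Matrix.of_apply, Matrix.cons_val_zero,
    Matrix.cons_val_one, Matrix.cons_val] at h0 h1 h2 h3 h4
  have hA : C * (-2 * T * (C + 2 * T ^ 2) * e ^ 2 - C ^ 2 + 2 * T * C * P) = 0 := by
    linear_combination h0 - h1
  have hB : C * (-2 * T * (C + 2 * T ^ 2) * e ^ 2 - C ^ 2 + 2 * T * C * (P - C)) = 0 := by
    linear_combination h3 - h4
  rcases eq_or_ne C 0 with rfl | hC
  · have hT : T ≠ 0 := by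
      rintro rfl
      simp at hTC
    have : T ^ 5 * e ^ 3 = 0 := by linear_combination (1 / 16) * (h2 - h0)
    rcases mul_eq_zero.1 this with h | h
    · exact hT (pow_eq_zero_iff (by norm_num) |>.1 h)
    · exact he.ne' (pow_eq_zero_iff (by norm_num) |>.1 h)
  · have hA' := (mul_eq_zero.1 hA).resolve_left hC
    have hB' := (mul_eq_zero.1 hB).resolve_left hC
    have hT : T = 0 := by
      have : T * C ^ 2 = 0 := by linear_combination (1 / 2) * (hA' - hB')
      exact (mul_eq_zero.1 this).resolve_right (pow_ne_zero 2 hC)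
    subst hT
    have : C ^ 2 = 0 := by linear_combination -hA'
    exact pow_ne_zero 2 hC this

theorem analyticOnNhd_shiftDet_line (e P Q N : ℝ) (x d : Fin 3 → ℝ) :
    AnalyticOnNhd ℝ (fun t : ℝ => shiftDet T C e P Q N (x + t • d)) Set.univ := by
  intro t _
  simp only [shiftDet, indepDet, Matrix.det_fin_three, Matrix.of_apply, Matrix.cons_val_zero,
    Matrix.cons_val_one, Matrix.cons_val, Pi.add_apply, Pi.smul_apply, smul_eq_mul]
  fun_prop

theorem continuous_shiftDet (e P Q N : ℝ) :
    Continuous (shiftDet T C e P Q N) := by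
  unfold shiftDet indepDet
  simp only [Matrix.det_fin_three, Matrix.of_apply, Matrix.cons_val_zero,
    Matrix.cons_val_one, Matrix.cons_val]
  fun_prop

/-- If the determinant vanished near some k, it would vanish, being analytic, along the whole line
from k to a parameter where it is nonzero. -/
theorem dense_shiftDet_ne_zero (hTC : C + 2 * T ^ 2 ≠ 0) {e : ℝ} (he : 0 < e) (P Q N : ℝ)
    {A : (Fin 3 → ℝ) →ₗ[ℝ] (Fin 3 → ℝ)} (hA : Function.Surjective A) :
    Dense {k | shiftDet T C e P Q N (A k) ≠ 0} := by
  obtain ⟨x, hx⟩ := exists_shiftDet_ne_zero hTC he P Q N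
  obtain ⟨k₁, rfl⟩ := hA x
  intro k
  by_contra hk
  have h1 : ∀ᶠ k' in 𝓝 k, shiftDet T C e P Q N (A k') = 0 := by
    rw [mem_closure_iff_frequently, Filter.not_frequently] at hk
    exact hk.mono fun k' hk' => by simpa using hk'
  have h2 : ∀ᶠ t : ℝ in 𝓝 0, shiftDet T C e P Q N (A k + t • A (k₁ - k)) = 0 := by
    have hc : Filter.Tendsto (fun t : ℝ => k + t • (k₁ - k)) (𝓝 0) (𝓝 k) := by
      have : Continuous fun t : ℝ => k + t • (k₁ - k) := by fun_prop
      simpa using this.tendsto 0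
    exact (hc.eventually h1).mono fun t ht => by rwa [map_add, map_smul] at ht
  have h3 := (analyticOnNhd_shiftDet_line (T := T) (C := C) e P Q N (A k)
    (A (k₁ - k))).eqOn_zero_of_preconnected_of_eventuallyEq_zero isPreconnected_univ
    (Set.mem_univ 0) h2 (Set.mem_univ 1)
  apply hx
  simpa using h3

theorem isOpen_shiftDet_ne_zero (e P Q N : ℝ) (A : (Fin 3 → ℝ) →ₗ[ℝ] (Fin 3 → ℝ)) :
    IsOpen {k | shiftDet T C e P Q N (A k) ≠ 0} :=
  isOpen_ne.preimage ((continuous_shiftDet e P Q N).comp A.continuous_of_finiteDimensional)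

end Shift

end Lorentz3

end

noncomputable section

namespace Lorentz3

/-! ### A family of admissible shifts -/

section Potentials

variable {T C : ℝ} {U : Set E3} {θ : E3 → Fin 3 → E3 →L[ℝ] ℝ} {ε : E3 → ℝ}

/-- The Poincaré lemma for 1-forms on a convex open set. -/
theorem exists_potential (hU : IsOpen U) (hc : Convex ℝ U) {α : E3 → E3 →L[ℝ] ℝ}
    (hα : ContDiffOn ℝ ∞ α U) (hd : ∀ y ∈ U, ∀ v w, dForm α y v w = 0) :
    ∃ f : E3 → ℝ, ContDiffOn ℝ ∞ f U ∧ ∀ y ∈ U, fderiv ℝ f y = α y := by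
  obtain ⟨f, hf⟩ := hc.exists_forall_hasFDerivAt_of_fderiv_symmetric hU
    (hα.differentiableOn (by simp)) fun y hy v w => sub_eq_zero.1 (hd y hy v w)
  refine ⟨f, ?_, fun y hy => (hf y hy).fderiv⟩
  rw [contDiffOn_infty_iff_fderiv_of_isOpen hU]
  exact ⟨fun y hy => (hf y hy).differentiableAt.differentiableWithinAt,
    hα.congr fun y hy => (hf y hy).fderiv⟩

theorem exists_potential_coframe (hU : IsOpen U) (hc : Convex ℝ U)
    (hθ : ContDiffOn ℝ ∞ θ U) {c : Fin 3 → E3 → ℝ} (hcs : ∀ a, ContDiffOn ℝ ∞ (c a) U)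
    (hd : ∀ y ∈ U, ∀ v w, ∑ a, (wedge (fderiv ℝ (c a) y) (θ y a) v w
      + c a y * dForm (fun z => θ z a) y v w) = 0) :
    ∃ f : E3 → ℝ, ContDiffOn ℝ ∞ f U ∧ ∀ y ∈ U, fderiv ℝ f y = ∑ a, c a y • θ y a :=
  exists_potential hU hc (ContDiffOn.sum fun a _ => (hcs a).smul (contDiffOn_pi.1 hθ a))
    fun y hy v w => (dForm_sum hU hθ hcs hy v w).trans (hd y hy v w)

/-- The form Tω¹ is completed by a multiple of ω⁰ to a closed form. For C ≠ 0 the coefficient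
-4T²ε/C works, because the Cω² in dε cancels dω¹ = -4Tω⁰∧ω². For C = 0, -log ε is already a
potential. -/
theorem SolvesStructureEqs.exists_weight (hTC : C + 2 * T ^ 2 ≠ 0) (hU : IsOpen U)
    (hc : Convex ℝ U) (hs : SolvesStructureEqs T C U θ ε) :
    ∃ f a : E3 → ℝ, ContDiffOn ℝ ∞ f U ∧ ContDiffOn ℝ ∞ a U ∧
      ∀ y ∈ U, fderiv ℝ f y = a y • θ y 0 + T • θ y 1 := by
  rcases eq_or_ne C 0 with rfl | hC
  · have hε0 : ∀ y ∈ U, ε y ≠ 0 := fun y hy => (hs.epsilon_pos y hy).ne'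
    refine ⟨fun y => -Real.log (ε y), fun y => -(opD θ ε y / ε y),
      (hs.smooth_epsilon.log hε0).neg,
      ((hs.contDiffOn_opD hU hs.smooth_epsilon).div hs.smooth_epsilon hε0).neg, fun y hy => ?_⟩
    have h1 : HasFDerivAt (fun y => -Real.log (ε y)) _ y :=
      ((differentiableAt_of_smooth hU hs.smooth_epsilon hy).hasFDerivAt.log (hε0 y hy)).fun_neg
    have h2 := hs.d_epsilon y hy
    rw [h1.fderiv, h2]
    ext v
    have := hε0 y hy
    simp
    field_simp
    ring
  · obtain ⟨f, hf, hf'⟩ := exists_potential_coframe hU hc hs.smooth_coframe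
      (c := ![fun z => (-4 * T ^ 2 / C) * ε z, fun _ => T, fun _ => 0]) (by
        intro a
        fin_cases a
        · exact contDiffOn_const.mul hs.smooth_epsilon
        · exact contDiffOn_const
        · exact contDiffOn_const) (by
        intro y hy v w
        have h1 : fderiv ℝ (fun z => (-4 * T ^ 2 / C) * ε z) y =
            (-4 * T ^ 2 / C) • fderiv ℝ ε y :=
          fderiv_const_mul (differentiableAt_of_smooth hU hs.smooth_epsilon hy) _
        simp only [Fin.sum_univ_three, Matrix.cons_val_zero, Matrix.cons_val_one, Matrix.cons_val,
          hs.d_omega0 y hy, hs.d_omega1 y hy, wedge, h1, fderiv_fun_const, Pi.zero_apply,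
          _root_.zero_apply, _root_.smul_apply]
        rw [hs.d_epsilon y hy]
        simp
        field_simp
        ring)
    refine ⟨f, fun z => (-4 * T ^ 2 / C) * ε z, hf,
      contDiffOn_const.mul hs.smooth_epsilon, fun y hy => ?_⟩
    rw [hf' y hy, Fin.sum_univ_three]
    simp

/-- With w = exp(-f) the form wω⁰ is closed, hence equals du. Then w² times any function of u is an
admissible shift: w² supplies the required ω¹-coefficient, and du is a multiple of ω⁰. -/
theorem SolvesStructureEqs.exists_weight_param (hTC : C + 2 * T ^ 2 ≠ 0) (hU : IsOpen U)
    (hc : Convex ℝ U) (hs : SolvesStructureEqs T C U θ ε) :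
    ∃ w u a : E3 → ℝ, ContDiffOn ℝ ∞ w U ∧ ContDiffOn ℝ ∞ u U ∧ ContDiffOn ℝ ∞ a U ∧
      (∀ y ∈ U, w y ≠ 0) ∧
      (∀ y ∈ U, fderiv ℝ w y = (-(a y * w y)) • θ y 0 + (-(T * w y)) • θ y 1) ∧
      ∀ y ∈ U, fderiv ℝ u y = w y • θ y 0 := by
  obtain ⟨f, a, hf, ha, hf'⟩ := hs.exists_weight hTC hU hc
  have hw : ContDiffOn ℝ ∞ (fun y => Real.exp (-f y)) U := hf.neg.exp
  have hw' : ∀ y ∈ U, fderiv ℝ (fun y => Real.exp (-f y)) y =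
      (-(a y * Real.exp (-f y))) • θ y 0 + (-(T * Real.exp (-f y))) • θ y 1 := by
    intro y hy
    have h1 : HasFDerivAt (fun y => Real.exp (-f y)) _ y :=
      (differentiableAt_of_smooth hU hf hy).hasFDerivAt.fun_neg.exp
    rw [h1.fderiv, hf' y hy]
    module
  obtain ⟨u, hu, hu'⟩ := exists_potential_coframe hU hc hs.smooth_coframe
    (c := ![fun y => Real.exp (-f y), fun _ => 0, fun _ => 0]) (by
      intro a
      fin_cases a
      · exact hw
      · exact contDiffOn_const
      · exact contDiffOn_const) (by
      intro y hy v w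
      simp only [Fin.sum_univ_three, Matrix.cons_val_zero, Matrix.cons_val_one, Matrix.cons_val,
        hs.d_omega0 y hy, wedge, hw' y hy, fderiv_fun_const, Pi.zero_apply,
        _root_.zero_apply, _root_.smul_apply, _root_.add_apply, smul_eq_mul]
      ring)
  refine ⟨_, u, a, hw, hu, ha, fun y _ => Real.exp_ne_zero _, hw', fun y hy => ?_⟩
  rw [hu' y hy, Fin.sum_univ_three]
  simp

/-- The shifts `w² (k₀ + k₁ u + k₂ u²)`. -/
def quadShift (w u : E3 → ℝ) (k : Fin 3 → ℝ) (y : E3) : ℝ :=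
  ∑ i, k i * (w y ^ 2 * u y ^ (i : ℕ))

theorem quadShift_eq (w u : E3 → ℝ) (k : Fin 3 → ℝ) (y : E3) :
    quadShift w u k y = w y ^ 2 * (k 0 + k 1 * u y + k 2 * u y ^ 2) := by
  simp [quadShift, Fin.sum_univ_three]
  ring

theorem SolvesStructureEqs.admissibleShift_quadShift (hU : IsOpen U) (hs : SolvesStructureEqs T C U θ ε)
    {w u a : E3 → ℝ} (hw : ContDiffOn ℝ ∞ w U) (hu : ContDiffOn ℝ ∞ u U)
    (hw' : ∀ y ∈ U, fderiv ℝ w y = (-(a y * w y)) • θ y 0 + (-(T * w y)) • θ y 1)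
    (hu' : ∀ y ∈ U, fderiv ℝ u y = w y • θ y 0) (k : Fin 3 → ℝ) :
    AdmissibleShift T U θ (quadShift w u k) ∧ ∀ y ∈ U, opD θ (quadShift w u k) y =
      -2 * a y * (w y ^ 2 * (k 0 + k 1 * u y + k 2 * u y ^ 2))
        + w y ^ 3 * (k 1 + 2 * k 2 * u y) := by
  have hq : quadShift w u k =
      fun y => w y * w y * (k 0 + k 1 * u y + k 2 * (u y * u y)) := by
    funext y
    rw [quadShift_eq]
    ring
  have hder : ∀ y ∈ U, fderiv ℝ (quadShift w u k) y =
      (-2 * a y * (w y ^ 2 * (k 0 + k 1 * u y + k 2 * u y ^ 2))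
        + w y ^ 3 * (k 1 + 2 * k 2 * u y)) • θ y 0
      + (-2 * T * quadShift w u k y) • θ y 1
      + (0 : ℝ) • θ y 2 := by
    intro y hy
    have h1 := (differentiableAt_of_smooth hU hw hy).hasFDerivAt
    have h2 := (differentiableAt_of_smooth hU hu hy).hasFDerivAt
    rw [hw' y hy] at h1
    rw [hu' y hy] at h2
    have h3 : HasFDerivAt (fun y => w y * w y * (k 0 + k 1 * u y + k 2 * (u y * u y))) _ y :=
      (h1.mul h1).mul (((h2.const_mul (k 1)).const_add (k 0)).add ((h2.mul h2).const_mul (k 2)))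
    rw [quadShift_eq, hq, h3.fderiv]
    simp only [Pi.mul_apply]
    module
  have hop : ∀ y ∈ U, opD θ (quadShift w u k) y = _ := fun y hy =>
    opD_eq_of_fderiv (hs.coframe y hy) (hder y hy)
  refine ⟨⟨?_, fun y hy => ?_⟩, hop⟩
  · rw [hq]
    exact (hw.mul hw).mul ((contDiffOn_const.add (contDiffOn_const.mul hu)).add
      (contDiffOn_const.mul (hu.mul hu)))
  · rw [hop y hy, hder y hy, zero_smul, add_zero]

theorem SolvesStructureEqs.opD_opD_quadShift (hU : IsOpen U) (hs : SolvesStructureEqs T C U θ ε)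
    {w u a : E3 → ℝ} (hw : ContDiffOn ℝ ∞ w U) (hu : ContDiffOn ℝ ∞ u U)
    (ha : ContDiffOn ℝ ∞ a U)
    (hw' : ∀ y ∈ U, fderiv ℝ w y = (-(a y * w y)) • θ y 0 + (-(T * w y)) • θ y 1)
    (hu' : ∀ y ∈ U, fderiv ℝ u y = w y • θ y 0) (k : Fin 3 → ℝ) {y : E3} (hy : y ∈ U) :
    opD θ (opD θ (quadShift w u k)) y =
      (4 * a y ^ 2 - 2 * opD θ a y) * (w y ^ 2 * (k 0 + k 1 * u y + k 2 * u y ^ 2))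
        - 5 * a y * (w y ^ 3 * (k 1 + 2 * k 2 * u y)) + w y ^ 4 * (2 * k 2) := by
  have hli := hs.coframe y hy
  rw [opD_congr hU (hs.admissibleShift_quadShift hU hw hu hw' hu' k).2 hy]
  have h1 := (differentiableAt_of_smooth hU hw hy).hasFDerivAt
  have h2 := (differentiableAt_of_smooth hU hu hy).hasFDerivAt
  have h3 := (differentiableAt_of_smooth hU ha hy).hasFDerivAt
  rw [hw' y hy] at h1
  rw [hu' y hy] at h2
  have hd : HasFDerivAt (fun y => -2 * a y * (w y ^ 2 * (k 0 + k 1 * u y + k 2 * u y ^ 2))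
        + w y ^ 3 * (k 1 + 2 * k 2 * u y)) _ y :=
    ((h3.const_mul (-2)).mul ((h1.pow 2).mul (((h2.const_mul (k 1)).const_add (k 0)).add
      ((h2.pow 2).const_mul (k 2))))).add
      ((h1.pow 3).mul ((h2.const_mul (2 * k 2)).const_add (k 1)))
  rw [opD, hd.fderiv]
  simp [apply_dualFrame hli]
  rw [show opD θ a y = fderiv ℝ a y (dualFrame θ y 0) from rfl]
  ring

/-- The values of the shift and its first two `D`-derivatives at a point, as a linear function of
the coefficients. -/
def quadShiftJet (w u a b : ℝ) : (Fin 3 → ℝ) →ₗ[ℝ] (Fin 3 → ℝ) where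
  toFun k := ![w ^ 2 * (k 0 + k 1 * u + k 2 * u ^ 2),
    -2 * a * (w ^ 2 * (k 0 + k 1 * u + k 2 * u ^ 2)) + w ^ 3 * (k 1 + 2 * k 2 * u),
    (4 * a ^ 2 - 2 * b) * (w ^ 2 * (k 0 + k 1 * u + k 2 * u ^ 2))
        - 5 * a * (w ^ 3 * (k 1 + 2 * k 2 * u)) + w ^ 4 * (2 * k 2)]
  map_add' k l := by
    ext i
    fin_cases i <;> simp <;> ring
  map_smul' c k := by
    ext i
    fin_cases i <;> simp <;> ring

/-- The map is triangular in the quadratic's value, first and second derivative at u, with diagonal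
entries w², w³, w⁴. The values s₀, s₁, s₂ solve for these, and the witness is the quadratic with
that Taylor expansion. -/
theorem quadShiftJet_surjective {w : ℝ} (hw : w ≠ 0) (u a b : ℝ) :
    Function.Surjective (quadShiftJet w u a b) := by
  intro x
  let s₀ := x 0 / w ^ 2
  let s₁ := (x 1 + 2 * a * x 0) / w ^ 3
  let s₂ := (x 2 - (4 * a ^ 2 - 2 * b) * x 0 + 5 * a * (x 1 + 2 * a * x 0)) / w ^ 4
  refine ⟨![s₀ - (s₁ - s₂ * u) * u - s₂ / 2 * u ^ 2, s₁ - s₂ * u, s₂ / 2], ?_⟩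
  ext i
  fin_cases i <;> simp [quadShiftJet, s₀, s₁, s₂] <;> field_simp <;> ring

end Potentials

end Lorentz3

end

noncomputable section

namespace Lorentz3

/-! ### Genericity -/

section Genericity

variable {T C : ℝ} {U : Set E3}

theorem tendsto_solutionSpace {ι : Type*} {l : Filter ι} {s : ι → SolutionSpace T C U}
    {σ : SolutionSpace T C U}
    (h₁ : ∀ j : ℕ, ∀ K : Set E3, IsCompact K → K ⊆ U →
      TendstoUniformlyOn (fun k => iteratedFDeriv ℝ j (s k).omega)
        (iteratedFDeriv ℝ j σ.omega) l K)
    (h₂ : ∀ j : ℕ, ∀ K : Set E3, IsCompact K → K ⊆ U →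
      TendstoUniformlyOn (fun k => iteratedFDeriv ℝ j (s k).eps)
        (iteratedFDeriv ℝ j σ.eps) l K) :
    Filter.Tendsto s l (𝓝 σ) := by
  have h : 𝓝 σ = _ ⊓ _ := @nhds_inf (SolutionSpace T C U) (⨅ j : ℕ, _) (⨅ j : ℕ, _) σ
  rw [h, nhds_iInf, nhds_iInf, Filter.tendsto_inf, Filter.tendsto_iInf, Filter.tendsto_iInf]
  refine ⟨fun j => ?_, fun j => ?_⟩
  · rw [nhds_induced, Filter.tendsto_comap_iff, UniformOnFun.tendsto_iff_tendstoUniformlyOn]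
    exact fun K hK => h₁ j K hK.1 hK.2
  · rw [nhds_induced, Filter.tendsto_comap_iff, UniformOnFun.tendsto_iff_tendstoUniformlyOn]
    exact fun K hK => h₂ j K hK.1 hK.2

theorem iteratedFDeriv_add_sum_smul {F : Type*} [NormedAddCommGroup F] [NormedSpace ℝ F]
    (hU : IsOpen U) {f : E3 → F} (hf : ContDiffOn ℝ ∞ f U) {g : Fin 3 → E3 → F}
    (hg : ∀ i, ContDiffOn ℝ ∞ (g i) U) (k : Fin 3 → ℝ) (j : ℕ) {y : E3} (hy : y ∈ U) :
    iteratedFDeriv ℝ j (fun z => f z + ∑ i, k i • g i z) y =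
      iteratedFDeriv ℝ j f y + ∑ i, k i • iteratedFDeriv ℝ j (g i) y := by
  have hj : (j : WithTop ℕ∞) ≤ ∞ := WithTop.coe_le_coe.2 le_top
  have hf' : ContDiffAt ℝ j f y := (hf.contDiffAt (hU.mem_nhds hy)).of_le hj
  have hg' : ∀ i, ContDiffAt ℝ j (g i) y := fun i => ((hg i).contDiffAt (hU.mem_nhds hy)).of_le hj
  have hkg : ∀ i, ContDiffAt ℝ j (fun z => k i • g i z) y := fun i => contDiffAt_const.smul (hg' i)
  have h1 : ∀ i, iteratedFDeriv ℝ j (fun z => k i • g i z) y =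
      k i • iteratedFDeriv ℝ j (g i) y := fun i => iteratedFDeriv_const_smul_apply (hg' i)
  have h2 : ∀ {a b : E3 → F}, ContDiffAt ℝ j a y → ContDiffAt ℝ j b y →
      iteratedFDeriv ℝ j (fun z => a z + b z) y =
        iteratedFDeriv ℝ j a y + iteratedFDeriv ℝ j b y := fun ha hb =>
    iteratedFDeriv_add_apply ha hb
  simp only [Fin.sum_univ_three]
  rw [h2 hf' (((hkg 0).add (hkg 1)).add (hkg 2)), h2 ((hkg 0).add (hkg 1)) (hkg 2),
    h2 (hkg 0) (hkg 1), h1, h1, h1]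

theorem tendstoUniformlyOn_add_sum_smul {F : Type*} [NormedAddCommGroup F] [NormedSpace ℝ F]
    (hU : IsOpen U) {f : E3 → F} (hf : ContDiffOn ℝ ∞ f U) {g : Fin 3 → E3 → F}
    (hg : ∀ i, ContDiffOn ℝ ∞ (g i) U) (j : ℕ) {K : Set E3} (hK : IsCompact K) (hKU : K ⊆ U) :
    TendstoUniformlyOn (fun (k : Fin 3 → ℝ) => iteratedFDeriv ℝ j fun z => f z + ∑ i, k i • g i z)
      (iteratedFDeriv ℝ j f) (𝓝 0) K := by
  have hb : ∀ i, ∃ M, ∀ y ∈ K, ‖iteratedFDeriv ℝ j (g i) y‖ ≤ M := by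
    intro i
    refine hK.exists_bound_of_continuousOn (ContinuousOn.mono ?_ hKU)
    refine ((hg i).continuousOn_iteratedFDerivWithin (m := j) (WithTop.coe_le_coe.2 le_top)
      hU.uniqueDiffOn).congr fun y hy => ?_
    exact (iteratedFDerivWithin_of_isOpen j hU hy).symm
  choose M hM using hb
  rw [Metric.tendstoUniformlyOn_iff]
  intro δ hδ
  have hc : Continuous fun k : Fin 3 → ℝ => ∑ i, |k i| * M i := by fun_prop
  have h0 : Filter.Tendsto (fun k : Fin 3 → ℝ => ∑ i, |k i| * M i) (𝓝 0) (𝓝 0) := by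
    simpa using hc.tendsto 0
  filter_upwards [h0.eventually_lt_const hδ] with k hk y hy
  rw [iteratedFDeriv_add_sum_smul hU hf hg k j (hKU hy), dist_eq_norm, sub_add_cancel_left,
    norm_neg]
  refine (norm_sum_le _ _).trans_lt (lt_of_le_of_lt (Finset.sum_le_sum fun i _ => ?_) hk)
  rw [norm_smul, Real.norm_eq_abs]
  exact mul_le_mul_of_nonneg_left (hM i y hy) (abs_nonneg _)

theorem shiftCoframe_quadShift (θ : E3 → Fin 3 → E3 →L[ℝ] ℝ) (w u : E3 → ℝ) (k : Fin 3 → ℝ) :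
    shiftCoframe θ (quadShift w u k) = fun y => θ y + ∑ i, k i •
      (![0, 0, (w y ^ 2 * u y ^ (i : ℕ)) • θ y 0] : Fin 3 → E3 →L[ℝ] ℝ) := by
  funext y a
  fin_cases a <;> simp [shiftCoframe, quadShift, Fin.sum_univ_three]
  module

/-- Every solution is the limit at `0` of a three-parameter family of solutions, for which
functional independence at a given point holds on an open dense set of parameters. -/
theorem exists_generic_family (hTC : C + 2 * T ^ 2 ≠ 0) (hU : IsOpen U) (hc : Convex ℝ U)
    (σ : SolutionSpace T C U) :
    ∃ s : (Fin 3 → ℝ) → SolutionSpace T C U, Filter.Tendsto s (𝓝 0) (𝓝 σ) ∧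
      ∀ y ∈ U, ∃ O : Set (Fin 3 → ℝ), IsOpen O ∧ Dense O ∧
        ∀ k ∈ O, FunctionallyIndependentAt (s k).omega (s k).eps y := by
  have hs : SolvesStructureEqs T C U σ.omega σ.eps := σ.2
  obtain ⟨w, u, a, hw, hu, ha, hw0, hw', hu'⟩ := hs.exists_weight_param hTC hU hc
  have hadm := fun k => (hs.admissibleShift_quadShift hU hw hu hw' hu' k).1
  refine ⟨fun k => ⟨(shiftCoframe σ.omega (quadShift w u k), σ.eps), hs.shift hU (hadm k)⟩,
    tendsto_solutionSpace (fun j K hK hKU => ?_) (fun j K hK hKU => ?_), fun y hy => ?_⟩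
  · simp only [SolutionSpace.omega]
    simp only [shiftCoframe_quadShift]
    refine tendstoUniformlyOn_add_sum_smul hU hs.smooth_coframe (fun i => ?_) j hK hKU
    refine contDiffOn_pi.2 fun b => ?_
    fin_cases b
    · exact contDiffOn_const
    · exact contDiffOn_const
    · exact ((hw.pow 2).mul (hu.pow i)).smul (contDiffOn_pi.1 hs.smooth_coframe 0)
  · exact Metric.tendstoUniformlyOn_iff.2 fun δ hδ => Filter.Eventually.of_forall fun k z _ => by
      simpa [SolutionSpace.eps] using hδ
  -- The family was chosen before y; only the open dense set of parameters depends on the point.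
  · have hA := quadShiftJet_surjective (hw0 y hy) (u y) (a y) (opD σ.omega a y)
    refine ⟨_, isOpen_shiftDet_ne_zero (T := T) (C := C) _ _ _ _ _,
      dense_shiftDet_ne_zero hTC (hs.epsilon_pos y hy) (opD σ.omega σ.eps y)
      (opD σ.omega (opD σ.omega σ.eps) y) (opD σ.omega (opD σ.omega (opD σ.omega σ.eps)) y) hA,
      fun k hk => functionallyIndependentAt_shift hU hs (hadm k) hy ?_⟩
    rw [quadShift_eq, (hs.admissibleShift_quadShift hU hw hu hw' hu' k).2 y hy,
      hs.opD_opD_quadShift hU hw hu ha hw' hu' k hy]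
    exact hk

/-- Functional independence at countably many points is generic. -/
theorem dense_functionallyIndependentAt (hTC : C + 2 * T ^ 2 ≠ 0) (hU : IsOpen U)
    (hc : Convex ℝ U) {D : Set E3} (hD : D.Countable) (hDU : D ⊆ U) :
    Dense {σ : SolutionSpace T C U | ∀ y ∈ D, FunctionallyIndependentAt σ.omega σ.eps y} := by
  intro σ
  obtain ⟨s, hs, hO⟩ := exists_generic_family hTC hU hc σ
  choose! O hOo hOd hO using hO
  -- Baire's theorem is applied in the parameter space ℝ³, so density in the solution space does not
  -- rely on a Baire property there.
  have hdense : Dense (⋂ y ∈ D, O y) :=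
    dense_biInter_of_isOpen (fun y hy => hOo y (hDU hy)) hD fun y hy => hOd y (hDU hy)
  rw [mem_closure_iff_frequently]
  refine hs.frequently ((mem_closure_iff_frequently.1 (hdense 0)).mono fun k hk y hy => ?_)
  exact hO y (hDU hy) k (Set.mem_iInter₂.1 hk y hy)

theorem dense_functionallyIndependentAt_singleton (hTC : C + 2 * T ^ 2 ≠ 0) (hU : IsOpen U)
    (hc : Convex ℝ U) {y : E3} (hy : y ∈ U) :
    Dense {σ : SolutionSpace T C U | FunctionallyIndependentAt σ.omega σ.eps y} := by
  simpa using dense_functionallyIndependentAt hTC hU hc (Set.countable_singleton y)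
    (Set.singleton_subset_iff.2 hy)

theorem exists_countable_subset_closure (U : Set E3) :
    ∃ D ⊆ U, D.Countable ∧ U ⊆ closure D :=
  (TopologicalSpace.IsSeparable.of_separableSpace U).exists_countable_dense_subset

/-- Independence at each point of a countable dense subset of U is a countable intersection of open
dense conditions, hence residual. Density is proved separately, from the parameter families. -/
theorem generic_functionallyIndependent (hTC : C + 2 * T ^ 2 ≠ 0) (hU : IsOpen U)
    (hc : Convex ℝ U) :
    {σ : SolutionSpace T C U |
        U ⊆ closure {y ∈ U | FunctionallyIndependentAt σ.omega σ.eps y}}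
      ∈ residual (SolutionSpace T C U) ∧
    Dense {σ : SolutionSpace T C U |
        U ⊆ closure {y ∈ U | FunctionallyIndependentAt σ.omega σ.eps y}} := by
  obtain ⟨D, hDU, hD, hUD⟩ := exists_countable_subset_closure U
  have hsub : {σ : SolutionSpace T C U | ∀ y ∈ D, FunctionallyIndependentAt σ.omega σ.eps y} ⊆
      {σ | U ⊆ closure {y ∈ U | FunctionallyIndependentAt σ.omega σ.eps y}} := fun σ hσ =>
    hUD.trans (closure_mono fun y hy => ⟨hDU hy, hσ y hy⟩)
  refine ⟨Filter.mem_of_superset ?_ hsub,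
    (dense_functionallyIndependentAt hTC hU hc hD hDU).mono hsub⟩
  have : {σ : SolutionSpace T C U | ∀ y ∈ D, FunctionallyIndependentAt σ.omega σ.eps y} =
      ⋂ y ∈ D, {σ | FunctionallyIndependentAt σ.omega σ.eps y} := by
    ext σ
    simp
  rw [this, countable_bInter_mem hD]
  exact fun y hy => residual_of_dense_open (isOpen_functionallyIndependentAt hU (hDU hy))
    (dense_functionallyIndependentAt_singleton hTC hU hc (hDU hy))

end Genericity

end Lorentz3

end

/-! ### Assembly of the proposition -/

open Lorentz3
theorem mainTheorem4 (T C : ℝ) (hTC : C + 2 * T ^ 2 ≠ 0) :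
    -- there are solutions, and generic solutions are functionally independent
    (∀ U : Set E3, IsOpen U → Nonempty (SolutionSpace T C U)) ∧
    (∀ U : Set E3, IsOpen U → Convex ℝ U →
      (∀ y ∈ U, IsOpen {σ : SolutionSpace T C U | FunctionallyIndependentAt σ.omega σ.eps y} ∧
        Dense {σ : SolutionSpace T C U | FunctionallyIndependentAt σ.omega σ.eps y}) ∧
      {σ : SolutionSpace T C U |
          U ⊆ closure {y ∈ U | FunctionallyIndependentAt σ.omega σ.eps y}}
        ∈ residual (SolutionSpace T C U) ∧
      Dense {σ : SolutionSpace T C U |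
          U ⊆ closure {y ∈ U | FunctionallyIndependentAt σ.omega σ.eps y}}) ∧
    -- the metrics of functionally independent solutions are classified by 5th order invariants
    (∀ (M : Type*) [TopologicalSpace M] [ChartedSpace E3 M] [IsManifold 𝓘(ℝ, E3) ∞ M]
      (θ : Coframe M) (ε : M → ℝ),
      SolvesStructureEqsOn T C θ ε → FunctionallyIndependent θ ε →
        IsTypeD (coframeMetric θ) ∧
        (∀ p, HasFrameFreedomAndHorizontalRank (coframeMetric θ) p (sSeq p) (tSeq p)) ∧
        (∀ p, HasLiftedRank (coframeMetric θ) p (rSeq p)) ∧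
        IsClassifiedByOrder (coframeMetric θ) 5) := by
  refine ⟨fun U _ => nonempty_solutionSpace hTC U, fun U hU hc => ?_, ?_⟩
  · exact ⟨fun y hy => ⟨isOpen_functionallyIndependentAt hU hy,
      dense_functionallyIndependentAt_singleton hTC hU hc hy⟩,
      generic_functionallyIndependent hTC hU hc⟩
  · intro M _ _ _ θ ε h hFI
    have hr := hasLiftedRank_of_solves hTC h hFI
    exact ⟨isTypeD_of_solves hTC h, hasFrameFreedomAndHorizontalRank_of_solves hTC h hFI, hr,
      rSeq, hr, isLeast_rSeq⟩
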